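/- Let $V$ be a finite-dimensional real inner product space which is the product of pairwise orthogonal subspaces $V_1^{(1)},\dots,V_1^{(r)}$ of dimension $1$ and $V_2^{(1)},\dots,V_2^{(s)}$ of dimension $2$ (with $r,s\ge 0$). Let $e^{(j)}$ be a unit vector of $V_1^{(j)}$, let $\mathcal H_1^{(j)}=\{0\}$ be the rank one arrangement on $V_1^{(j)}$, and let $\mathcal H_2^{(j)}$ be an arrangement of type $I_2(2m^{(j)})$ on $V_2^{(j)}$ with $m^{(j)}\ge 2$ (that is, $2m^{(j)}$ lines through $0$ at equal angles). Let $\mathcal H$ be the product arrangement on $V$, let $T_0$ be a base chamber of $\mathcal H$, let $(-1)^T$ be the parity of the number of hyperplanes of $\mathcal H$ separating the chamber $T$ from $T_0$, and let $W$ be the group generated by the orthogonal reflections in the hyperplanes of $\mathcal H$. Let $\mathcal C(V)$ be a family of subsets of $V$ that is stable under finite intersections, affine isometries, and intersection with closed affine half-spaces. Let $K(V)$ be the quotient of the free abelian group on $\mathcal C(V)$ by the relations $[\varnothing]=0$ (if $\varnothing\in\mathcal C(V)$), $[A\cup B]+[A\cap B]=[A]+[B]$ for $A,B\in\mathcal C(V)$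 with $A\cup B\in\mathcal C(V)$, and $[g(A)]=[A]$ for affine isometries $g$ of $V$. For $L\in\mathcal C(V)$ put $$P(\mathcal H,L)=\sum_{T}(-1)^T[\overline T\cap L]\in K(V),$$ the sum being over the chambers $T$ of $\mathcal H$. Let $a\in V$ and $K\in\mathcal C(V)$, and suppose that $K$ is stable under $W$ and contains the convex hull of $\{w(a):w\in W\}$. (i) If $s\ge 1$, then $P(\mathcal H,K+a)=0$ in $K(V)$. (ii) If $s=0$ and $T_0$ is the chamber $\{x:(x,e^{(i)})>0\text{ for all }i\}$, then in $K(V)$ $$P(\mathcal H,K+a)=\Big(\prod_{i=1}^r\operatorname{sgn}(a,e^{(i)})\Big)\cdot\Big[\prod_{i=1}^r\big(0,\,2(a,e^{(i)})e^{(i)}\big]\Big],$$ where $(0,v]=\{\lambda v:0<\lambda\le 1\}$ for $v\ne 0$ and $(0,0]=\varnothing$. The class of the half-open box is the one given by additivity, $[A\cup B]=[A]+[B]-[A\cap B]$ and $[A\setminus B]=[A]-[A\cap B]$; with $v_i=2(a,e^{(i)})e^{(i)}$ it equals $$\sum_{S\subseteq\{1,\dots,r\}}(-1)^{|S|}\Big[\prod_{i\in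 S}\{0\}\times\prod_{i\notin S}[0,v_i]\Big].$$ -/

import Mathlib

open scoped RealInnerProductSpace Pointwise

noncomputable section

namespace Pizza

variable {V : Type*} [NormedAddCommGroup V] [InnerProductSpace ℝ V]

/-! ### The dissection group -/

/-- A family `C` of subsets of `V` that is stable under finite intersections, affine isometries,
and intersection with closed affine half-spaces. (A further closure property, under Cartesian
products, relates families on different spaces; it is not imposed, so the families considered
here are more general.) -/
structure IsAdmissible (C : Set (Set V)) : Prop where
  inter : ∀ A ∈ C, ∀ B ∈ C, A ∩ B ∈ C
  isometry : ∀ g : V ≃ᵃⁱ[ℝ] V, ∀ A ∈ C, g '' A ∈ C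
  halfSpace : ∀ (v : V) (c : ℝ), v ≠ 0 → ∀ A ∈ C, A ∩ {x | ⟪v, x⟫ ≤ c} ∈ C

/-- The relations of the dissection group: `[∅] = 0`,
`[A ∪ B] + [A ∩ B] = [A] + [B]` whenever all four sets are in `C`, and `[g A] = [A]`
for affine isometries `g`. -/
inductive DissectionRel (C : Set (Set V)) : FreeAbelianGroup C → Prop
  | empty (h : ∅ ∈ C) : DissectionRel C (FreeAbelianGroup.of ⟨∅, h⟩)
  | union (A B : Set V) (hA : A ∈ C) (hB : B ∈ C) (hU : A ∪ B ∈ C) (hI : A ∩ B ∈ C) :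
      DissectionRel C (FreeAbelianGroup.of ⟨A ∪ B, hU⟩ + FreeAbelianGroup.of ⟨A ∩ B, hI⟩
        - (FreeAbelianGroup.of ⟨A, hA⟩ + FreeAbelianGroup.of ⟨B, hB⟩))
  | isometry (g : V ≃ᵃⁱ[ℝ] V) (A : Set V) (hA : A ∈ C) (hg : g '' A ∈ C) :
      DissectionRel C (FreeAbelianGroup.of ⟨g '' A, hg⟩ - FreeAbelianGroup.of ⟨A, hA⟩)

/-- The dissection group `K(V)` of the family `C`. -/
abbrev DissectionGroup (C : Set (Set V)) : Type _ :=
  FreeAbelianGroup C ⧸ AddSubgroup.closure {z : FreeAbelianGroup C | DissectionRel C z}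

open Classical in
/-- The class `[A]` in `K(V)` of a member `A` of `C` (and, by convention, `0` for a set that is
not in `C`). -/
def cls (C : Set (Set V)) (A : Set V) : DissectionGroup C :=
  if h : A ∈ C then QuotientAddGroup.mk (FreeAbelianGroup.of ⟨A, h⟩) else 0

/-- The extension of the class symbol to the relative Boolean algebra generated by `C`, by the
rules `[A ∪ B] = [A] + [B] - [A ∩ B]` and `[A \ B] = [A] - [A ∩ B]`: `HasClass C A x` says that
these rules give `A` the class `x`. Every additive extension of the class symbol to the relative
Boolean algebra then takes the value `x` at `A`. -/
inductive HasClass (C : Set (Set V)) : Set V → DissectionGroup C → Prop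
  | of (A : Set V) (hA : A ∈ C) : HasClass C A (cls C A)
  | union (A B : Set V) (x y z : DissectionGroup C) (hA : HasClass C A x) (hB : HasClass C B y)
      (hI : HasClass C (A ∩ B) z) : HasClass C (A ∪ B) (x + y - z)
  | diff (A B : Set V) (x y z : DissectionGroup C) (hA : HasClass C A x) (hB : HasClass C B y)
      (hI : HasClass C (A ∩ B) z) : HasClass C (A \ B) (x - z)

/-! ### Arrangements, chambers, the pizza quantity

A central hyperplane arrangement is given by a finite set `E` of unit vectors with
`E ∩ (-E) = ∅`; its hyperplanes are the `e^⊥`, `e ∈ E`. -/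

/-- The complement of the union of the hyperplanes `e^⊥`, `e ∈ E`. -/
def arrComplement (E : Set V) : Set V := {x | ∀ e ∈ E, ⟪e, x⟫ ≠ 0}

/-- The chambers: the connected components of the complement of the hyperplanes. -/
def IsChamber (E : Set V) (T : Set V) : Prop :=
  ∃ x ∈ arrComplement E, T = connectedComponentIn (arrComplement E) x

/-- The vectors `e ∈ E` such that `T` and `T₀` are on different sides of `e^⊥`. -/
def separating (E T T₀ : Set V) : Set V :=
  {e ∈ E | ∀ x ∈ T, ∀ y ∈ T₀, ⟪e, x⟫ * ⟪e, y⟫ < 0}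

/-- The pizza quantity `P(H, L) = ∑_T (-1)^T [closure T ∩ L]`, where `T` runs over the chambers
and signs are taken with respect to the base chamber `T₀`. -/
def pizza (C : Set (Set V)) (E T₀ L : Set V) : DissectionGroup C :=
  ∑ᶠ T ∈ {T : Set V | IsChamber E T},
    ((-1 : ℤ) ^ (separating E T T₀).ncard) • cls C (closure T ∩ L)

/-- The Coxeter group: the group of isometries of `V` generated by the orthogonal reflections
in the hyperplanes `e^⊥`, `e ∈ E`. -/
def coxeterGroup (E : Set V) : Subgroup (V ≃ₗᵢ[ℝ] V) :=
  Subgroup.closure {w | ∃ e ∈ E, w = (ℝ ∙ e)ᗮ.reflection}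

/-- `E` gives an arrangement of type `I₂(n)` in the plane `U`: its pseudo-roots `E ∪ (-E)` are
the `2n` unit vectors at the angles `kπ/n` from some unit vector of `U`, and `E` contains exactly
one of each pair of opposite pseudo-roots. -/
def IsDihedral (U : Submodule ℝ V) (n : ℕ) (E : Set V) : Prop :=
  E ∩ (-E) = ∅ ∧
  ∃ u ∈ U, ∃ v ∈ U, ‖u‖ = 1 ∧ ‖v‖ = 1 ∧ ⟪u, v⟫ = 0 ∧
    E ∪ (-E) = {x | ∃ k : Fin (2 * n),
      x = Real.cos (((k : ℕ) : ℝ) * Real.pi / (n : ℝ)) • u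
        + Real.sin (((k : ℕ) : ℝ) * Real.pi / (n : ℝ)) • v}

/-! ### Half-open boxes -/

/-- The half-open segment `(0, v]`; it is empty if `v = 0`. -/
def halfOpenSegment (v : V) : Set V := segment ℝ 0 v \ {0}

/-- The product of sets `S i`, each contained in one of several pairwise orthogonal factors
of `V`. -/
def prodSet {r : ℕ} (S : Fin r → Set V) : Set V :=
  {x | ∃ y : Fin r → V, (∀ i, y i ∈ S i) ∧ ∑ i, y i = x}

open Classical in
/-- The class of the half-open box `∏ (0, v i]` by inclusion-exclusion:
the closed box `∏ [0, v i]` minus its intersections with the hyperplanes where a coordinate is `0`,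
that is, the sum over `S` of `(-1)^|S| [∏_{i ∈ S} {0} × ∏_{i ∉ S} [0, v i]]`. -/
def boxClass (C : Set (Set V)) {r : ℕ} (v : Fin r → V) : DissectionGroup C :=
  ∑ S : Finset (Fin r),
    ((-1 : ℤ) ^ S.card) • cls C (prodSet fun i => if i ∈ S then {0} else segment ℝ 0 (v i))

end Pizza

end

noncomputable section

namespace Pizza

variable {V : Type*} [NormedAddCommGroup V] [InnerProductSpace ℝ V] {C : Set (Set V)}

/-! ### Elementary properties of the class symbol -/

/-! Let `B` be one closed chamber. Every closed chamber is `w⁻¹ B` for some `w` in the reflection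
group. As `K` is stable under the group and classes are isometry invariant, applying `w` and then
translating by `-w a` turns `[w⁻¹ B ∩ (K + a)]` into `[K ∩ (B - w a)]`. Up to one global sign, the
pizza quantity is therefore the class relative to `K` of the function `f = ∑ det(w) 1_{B - w a}`
(`pizza_prod_eq`, `pizza_eq_polyCls`).

For this to make sense, `S ↦ [K ∩ S]` must extend linearly from closed polyhedra to integer
combinations of their indicator functions. `sum_polyhedra_eq_zero` shows that it does. The same
lemma shows that the ambient set may be shrunk to any member of `C` that still carries the function.
Hence the class of a function is unchanged by every translation that keeps its support inside `K`
(`polyCls_translation_invariant`).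

The function `f` is a product with one function per factor. Each of these cancels to zero wherever a
vector of the factor has positive inner product with all `x + w a`. A separation argument then
places the support of `f` in the convex hull of the orbit, hence in `K` (`mem_convexHull_orbit`).

In a plane factor, the function is a signed sum of translated quadrants in the oblique coordinates
given by the two wall normals. The signs cancel along each coordinate, so it is a finite combination
of half-open parallelograms. With the other factors frozen, a translation invariant valuation on
such parallelograms is an additive function of the area (`IsPlanarInvariant.exists_area`). The total
signed area is zero because `m ≥ 2` (`sum_dih_mul`), so the class vanishes.

If all factors are lines, each function is, up to the sign of `b = (a, e)`, the indicator of `[-|b|,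
|b|)`. Expanding the product gives the alternating sum of faces of a box centred at the origin, and
an isometry moves it to the required half-open box (`polyCls_lines_eq`). -/

theorem cls_empty (C : Set (Set V)) : cls C ∅ = 0 := by
  unfold cls
  split_ifs with h
  · exact (QuotientAddGroup.eq_zero_iff _).2 (AddSubgroup.subset_closure (DissectionRel.empty h))
  · rfl

theorem cls_union {A B : Set V} (hA : A ∈ C) (hB : B ∈ C) (hU : A ∪ B ∈ C) (hI : A ∩ B ∈ C) :
    cls C (A ∪ B) + cls C (A ∩ B) = cls C A + cls C B := by
  simp only [cls, hA, hB, hU, hI, dif_pos]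
  rw [← sub_eq_zero]
  exact (QuotientAddGroup.eq_zero_iff _).2
    (AddSubgroup.subset_closure (DissectionRel.union A B hA hB hU hI))

theorem cls_image (hC : IsAdmissible C) (g : V ≃ᵃⁱ[ℝ] V) (A : Set V) :
    cls C (g '' A) = cls C A := by
  by_cases hA : A ∈ C
  · have hg := hC.isometry g A hA
    simp only [cls, hA, hg, dif_pos]
    rw [← sub_eq_zero]
    exact (QuotientAddGroup.eq_zero_iff _).2
      (AddSubgroup.subset_closure (DissectionRel.isometry g A hA hg))
  · have hg : g '' A ∉ C := fun h => hA <| by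
      have := hC.isometry g.symm _ h
      rwa [Set.image_image, show (fun x => g.symm (g x)) = id from funext fun x => by simp,
        Set.image_id] at this
    simp [cls, hA, hg]

/-- The empty set is adjoined because a cut may be empty although `∅` need not belong to `C`. This
is harmless: the class of `∅` is `0` in either case. -/
theorem cls_union' (hC : IsAdmissible C) {A B : Set V} (hA : A ∈ insert ∅ C) (hB : B ∈ insert ∅ C)
    (hU : A ∪ B ∈ insert ∅ C) : cls C (A ∪ B) + cls C (A ∩ B) = cls C A + cls C B := by
  rcases hA with rfl | hA
  · simp [cls_empty]
  rcases hB with rfl | hB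
  · simp [cls_empty]
  rcases hU with hU | hU
  · obtain ⟨rfl, rfl⟩ := Set.union_empty_iff.1 hU
    simp [cls_empty]
  · exact cls_union hA hB hU (hC.inter _ hA _ hB)

theorem IsAdmissible.inter_insert (hC : IsAdmissible C) {A B : Set V} (hA : A ∈ insert ∅ C)
    (hB : B ∈ insert ∅ C) : A ∩ B ∈ insert ∅ C := by
  rcases hA with rfl | hA
  · simp
  rcases hB with rfl | hB
  · simp
  exact Or.inr (hC.inter _ hA _ hB)

theorem IsAdmissible.inter_le (hC : IsAdmissible C) {A : Set V} (hA : A ∈ insert ∅ C) (v : V)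
    (c : ℝ) : A ∩ {x | ⟪v, x⟫ ≤ c} ∈ insert ∅ C := by
  rcases hA with rfl | hA
  · simp
  by_cases hv : v = 0
  · subst hv
    by_cases hc : 0 ≤ c
    · simp [hc, hA]
    · simp [hc]
  · exact Or.inr (hC.halfSpace v c hv A hA)

theorem IsAdmissible.inter_ge (hC : IsAdmissible C) {A : Set V} (hA : A ∈ insert ∅ C) (v : V)
    (c : ℝ) : A ∩ {x | c ≤ ⟪v, x⟫} ∈ insert ∅ C := by
  have := hC.inter_le hA (-v) (-c)
  simpa using this

theorem IsAdmissible.inter_eq (hC : IsAdmissible C) {A : Set V} (hA : A ∈ insert ∅ C) (v : V)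
    (c : ℝ) : A ∩ {x | ⟪v, x⟫ = c} ∈ insert ∅ C := by
  have := hC.inter_le (hC.inter_ge hA v c) v c
  convert this using 1
  ext x
  simp only [Set.mem_inter_iff, Set.mem_ofPred_eq]
  constructor
  · rintro ⟨h, rfl⟩; exact ⟨⟨h, le_rfl⟩, le_rfl⟩
  · rintro ⟨⟨h, h1⟩, h2⟩; exact ⟨h, le_antisymm h2 h1⟩

/-! ### Polyhedral sets and the extension of the class symbol to polyhedral functions -/

/-- The closed polyhedral set cut out by the half-spaces `h.2 ≤ ⟪h.1, x⟫`, `h ∈ S`. -/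
def polyhedron (S : Finset (V × ℝ)) : Set V := {x | ∀ h ∈ S, h.2 ≤ ⟪h.1, x⟫}

theorem IsAdmissible.inter_polyhedron (hC : IsAdmissible C) {A : Set V} (hA : A ∈ insert ∅ C)
    (S : Finset (V × ℝ)) : A ∩ polyhedron S ∈ insert ∅ C := by
  classical
  induction S using Finset.induction_on with
  | empty => simpa [polyhedron] using hA
  | insert h S _ ih =>
    convert hC.inter_ge ih h.1 h.2 using 1
    ext x
    simp only [polyhedron, Finset.forall_mem_insert, Set.mem_inter_iff, Set.mem_ofPred_eq]
    tauto

/-- `δ` is additive under cutting by a hyperplane. -/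
def CutAdditive {M : Type*} [AddCommGroup M] (C : Set (Set V)) (δ : Set V → M) : Prop :=
  ∀ A ∈ insert ∅ C, ∀ (v : V) (c : ℝ),
    δ A = δ (A ∩ {x | c ≤ ⟪v, x⟫}) + δ (A ∩ {x | ⟪v, x⟫ ≤ c}) - δ (A ∩ {x | ⟪v, x⟫ = c})

theorem cutAdditive_cls (hC : IsAdmissible C) : CutAdditive C (cls C) := by
  intro A hA v c
  have hU : (A ∩ {x | c ≤ ⟪v, x⟫}) ∪ (A ∩ {x | ⟪v, x⟫ ≤ c}) = A := by
    ext x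
    have := le_total c ⟪v, x⟫
    simp only [Set.mem_union, Set.mem_inter_iff, Set.mem_ofPred_eq]
    tauto
  have hI : (A ∩ {x | c ≤ ⟪v, x⟫}) ∩ (A ∩ {x | ⟪v, x⟫ ≤ c}) = A ∩ {x | ⟪v, x⟫ = c} := by
    ext x
    simp only [Set.mem_inter_iff, Set.mem_ofPred_eq, le_antisymm_iff]
    tauto
  have := cls_union' hC (hC.inter_ge hA v c) (hC.inter_le hA v c) (by rwa [hU])
  rw [hU, hI] at this
  rw [← this]; abel

/-- Induction that removes the largest set of the chain. If it exceeds the next largest only inside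
`B`, both have the same `δ` and their coefficients merge. Otherwise some point outside `B` lies in
the largest set alone, which forces its coefficient to be zero. -/
theorem sum_chain_eq_zero {α ι M : Type*} [AddCommGroup M] (𝒟 : Set (Set α)) (B : Set α)
    (δ : Set α → M) (h0 : ∀ Z ∈ 𝒟, Z ⊆ B → δ Z = 0)
    (h1 : ∀ Z ∈ 𝒟, ∀ Z' ∈ 𝒟, Z ⊆ Z' → Z' \ Z ⊆ B → δ Z = δ Z')
    (Z : ι → Set α) (n : ℕ) : ∀ (s : Finset ι) (_ : s.card = n) (_ : ∀ i ∈ s, Z i ∈ 𝒟)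
    (_ : ∀ i ∈ s, ∀ j ∈ s, Z i ⊆ Z j ∨ Z j ⊆ Z i) (c : ι → ℤ)
    (_ : ∀ x ∉ B, ∑ i ∈ s, c i * (Z i).indicator 1 x = 0), ∑ i ∈ s, c i • δ (Z i) = 0 := by
  classical
  have hmax : ∀ s : Finset ι, s.Nonempty → (∀ i ∈ s, ∀ j ∈ s, Z i ⊆ Z j ∨ Z j ⊆ Z i) →
      ∃ i ∈ s, ∀ j ∈ s, Z j ⊆ Z i := by
    intro s hs hch
    obtain ⟨i, hi, hm⟩ := s.exists_maximalFor Z hs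
    refine ⟨i, hi, fun j hj => ?_⟩
    rcases hch j hj i hi with h | h
    · exact h
    · exact hm hj h
  induction n with
  | zero =>
    intro s hs _ _ c _
    simp [Finset.card_eq_zero.1 hs]
  | succ n ih =>
    intro s hs hD hch c hc
    have hne : s.Nonempty := Finset.card_pos.1 (by omega)
    obtain ⟨i, hi, him⟩ := hmax s hne hch
    have hcard : (s.erase i).card = n := by rw [Finset.card_erase_of_mem hi]; omega
    have hD' : ∀ j ∈ s.erase i, Z j ∈ 𝒟 := fun j hj => hD j (Finset.mem_of_mem_erase hj)
    have hch' : ∀ j ∈ s.erase i, ∀ k ∈ s.erase i, Z j ⊆ Z k ∨ Z k ⊆ Z j := fun j hj k hk =>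
      hch j (Finset.mem_of_mem_erase hj) k (Finset.mem_of_mem_erase hk)
    rw [← Finset.add_sum_erase s _ hi]
    rcases (s.erase i).eq_empty_or_nonempty with he | he
    · have hc' : ∀ x ∉ B, c i * (Z i).indicator 1 x = 0 := fun x hx => by
        have := hc x hx
        rwa [← Finset.add_sum_erase s _ hi, he, Finset.sum_empty, add_zero] at this
      rw [he, Finset.sum_empty, add_zero]
      by_cases hZ : Z i ⊆ B
      · rw [h0 _ (hD i hi) hZ, smul_zero]
      · obtain ⟨x, hx, hxB⟩ := Set.not_subset.1 hZ
        have := hc' x hxB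
        simp only [Set.indicator_of_mem hx, Pi.one_apply, mul_one] at this
        rw [this, zero_smul]
    · obtain ⟨j, hj, hjm⟩ := hmax _ he hch'
      by_cases hZ : Z i \ Z j ⊆ B
      · have hij : δ (Z i) = δ (Z j) :=
          (h1 _ (hD' j hj) _ (hD i hi) (him j (Finset.mem_of_mem_erase hj)) hZ).symm
        have := ih _ hcard hD' hch' (fun k => c k + if k = j then c i else 0) fun x hx => by
          have h2 := hc x hx
          rw [← Finset.add_sum_erase s _ hi] at h2
          refine Eq.trans ?_ h2
          simp only [add_mul, Finset.sum_add_distrib, ite_mul, zero_mul]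
          rw [Finset.sum_ite_eq' _ _ _, if_pos hj, add_comm]
          congr 2
          by_cases hxj : x ∈ Z j
          · rw [Set.indicator_of_mem hxj,
              Set.indicator_of_mem (him j (Finset.mem_of_mem_erase hj) hxj)]
          · rw [Set.indicator_of_notMem hxj, Set.indicator_of_notMem fun h => hx (hZ ⟨h, hxj⟩)]
        rw [← this]
        simp only [add_smul, Finset.sum_add_distrib, ite_smul, zero_smul]
        rw [Finset.sum_ite_eq' _ _ _, if_pos hj, add_comm, hij]
      · obtain ⟨x, ⟨hx, hxj⟩, hxB⟩ := Set.not_subset.1 hZ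
        have h2 := hc x hxB
        have h3 : ∑ k ∈ s.erase i, c k * (Z k).indicator 1 x = 0 :=
          Finset.sum_eq_zero fun k hk => by
            rw [Set.indicator_of_notMem fun h => hxj (hjm k hk h), mul_zero]
        rw [← Finset.add_sum_erase s _ hi, h3, Set.indicator_of_mem hx, Pi.one_apply, mul_one,
          add_zero] at h2
        rw [h2, zero_smul, zero_add]
        refine ih _ hcard hD' hch' c fun y hy => ?_
        have h4 := hc y hy
        rwa [← Finset.add_sum_erase s _ hi, h2, zero_mul, zero_add] at h4

/-- Cutting `A` by the hyperplanes where two of the defining affine functions agree leaves pieces on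
which these functions are totally ordered. There the half-spaces, and so the polyhedra, are nested,
and the chain case applies. The set `B`, where nothing is known about the combination, serves the
comparison of ambient sets; well-definedness is the case `B = ∅`. -/
theorem sum_polyhedra_eq_zero {M : Type*} [AddCommGroup M] (hC : IsAdmissible C) (B : Set V)
    (δ : Set V → M) (hδ : CutAdditive C δ) (h0 : ∀ Z ∈ insert ∅ C, Z ⊆ B → δ Z = 0)
    (h1 : ∀ Z ∈ insert ∅ C, ∀ Z' ∈ insert ∅ C, Z ⊆ Z' → Z' \ Z ⊆ B → δ Z = δ Z')
    (s : Finset (Finset (V × ℝ))) (c : Finset (V × ℝ) → ℤ) {A : Set V} (hA : A ∈ insert ∅ C)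
    (hc : ∀ x ∈ A \ B, ∑ S ∈ s, c S * (polyhedron S).indicator 1 x = 0) :
    ∑ S ∈ s, c S • δ (A ∩ polyhedron S) = 0 := by
  classical
  let J : Finset (V × ℝ) := s.biUnion id
  let Sorted : (V × ℝ) × (V × ℝ) → Set V → Prop := fun p A =>
    (∀ x ∈ A, ⟪p.1.1, x⟫ - p.1.2 ≤ ⟪p.2.1, x⟫ - p.2.2) ∨
    (∀ x ∈ A, ⟪p.2.1, x⟫ - p.2.2 ≤ ⟪p.1.1, x⟫ - p.1.2)
  have main : ∀ P : Finset ((V × ℝ) × (V × ℝ)), (∀ A ∈ insert ∅ C, (∀ p ∈ P, Sorted p A) →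
      (∀ x ∈ A \ B, ∑ S ∈ s, c S * (polyhedron S).indicator 1 x = 0) →
      ∑ S ∈ s, c S • δ (A ∩ polyhedron S) = 0) → ∀ A ∈ insert ∅ C,
      (∀ x ∈ A \ B, ∑ S ∈ s, c S * (polyhedron S).indicator 1 x = 0) →
      ∑ S ∈ s, c S • δ (A ∩ polyhedron S) = 0 := by
    intro P
    induction P using Finset.induction_on with
    | empty => exact fun h A hA => h A hA (by simp)
    | insert p P _ ih =>
      intro h
      refine ih fun A hA hs hz => ?_
      -- The hyperplane where the two affine functions of the pair `p` coincide; the pair is sorted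
      -- on both sides of it.
      let v := p.1.1 - p.2.1
      let k := p.1.2 - p.2.2
      have key : ∀ A' ⊆ A, A' ∈ insert ∅ C → Sorted p A' →
          ∑ S ∈ s, c S • δ (A' ∩ polyhedron S) = 0 := fun A' hsub hA' hp =>
        h A' hA' (Finset.forall_mem_insert _ _ _ |>.2 ⟨hp, fun q hq => (hs q hq).imp
          (fun h x hx => h x (hsub hx)) (fun h x hx => h x (hsub hx))⟩)
          fun x hx => hz x ⟨hsub hx.1, hx.2⟩
      have hS : ∀ S, δ (A ∩ polyhedron S) = δ (A ∩ {x | k ≤ ⟪v, x⟫} ∩ polyhedron S)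
          + δ (A ∩ {x | ⟪v, x⟫ ≤ k} ∩ polyhedron S) - δ (A ∩ {x | ⟪v, x⟫ = k} ∩ polyhedron S) := by
        intro S
        rw [hδ _ (hC.inter_polyhedron hA S) v k]
        simp only [Set.inter_right_comm]
      simp only [hS, smul_sub, smul_add, Finset.sum_sub_distrib, Finset.sum_add_distrib]
      rw [key _ Set.inter_subset_left (hC.inter_ge hA v k),
        key _ Set.inter_subset_left (hC.inter_le hA v k),
        key _ Set.inter_subset_left (hC.inter_eq hA v k)]
      · simp
      · left
        rintro x ⟨_, hx⟩
        simp only [v, k, Set.mem_ofPred_eq, inner_sub_left] at hx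
        linarith
      · left
        rintro x ⟨_, hx⟩
        simp only [v, k, Set.mem_ofPred_eq, inner_sub_left] at hx
        linarith
      · right
        rintro x ⟨_, hx⟩
        simp only [v, k, Set.mem_ofPred_eq, inner_sub_left] at hx
        linarith
  refine main (J ×ˢ J) (fun A hA hs hz => ?_) A hA hc
  refine sum_chain_eq_zero (insert ∅ C) B δ h0 h1 (fun S => A ∩ polyhedron S) _ s rfl
    (fun S _ => hC.inter_polyhedron hA S) (fun S hS S' hS' => ?_) c fun x hx => ?_
  -- If neither polyhedron contains the other, each has a half-space violated at a point of the
  -- other. The order of these two affine functions on the piece contradicts one of the violations.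
  · by_contra! hcon
    obtain ⟨⟨x, hx, hx'⟩, ⟨y, hy, hy'⟩⟩ := hcon.imp Set.not_subset.1 Set.not_subset.1
    have hx2 : x ∉ polyhedron S' := fun h => hx' ⟨hx.1, h⟩
    have hy2 : y ∉ polyhedron S := fun h => hy' ⟨hy.1, h⟩
    simp only [polyhedron, Set.mem_ofPred_eq, not_forall, not_le] at hx2 hy2
    obtain ⟨h', hh', hlt'⟩ := hx2
    obtain ⟨h, hh, hlt⟩ := hy2
    have hJ : (h, h') ∈ J ×ˢ J := Finset.mem_product.2
      ⟨Finset.mem_biUnion.2 ⟨S, hS, hh⟩, Finset.mem_biUnion.2 ⟨S', hS', hh'⟩⟩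
    have hx3 := hx.2 h hh
    have hy3 := hy.2 h' hh'
    rcases hs _ hJ with hle | hle
    · have := hle x hx.1
      simp only at this
      linarith
    · have := hle y hy.1
      simp only at this
      linarith
  · by_cases hxA : x ∈ A
    · rw [← hz x ⟨hxA, hx⟩]
      refine Finset.sum_congr rfl fun S _ => ?_
      simp [Set.indicator, hxA]
    · exact Finset.sum_eq_zero fun S _ => by simp [Set.indicator, hxA]

/-- The indicator function of a closed polyhedral set. -/
def polyInd (S : Finset (V × ℝ)) : V → ℤ := (polyhedron S).indicator 1

variable (V) in
/-- The algebra of integer-valued functions on `V` spanned by the indicator functions of closed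
polyhedral sets. -/
def polyFun : Subalgebra ℤ (V → ℤ) :=
  (Submodule.span ℤ (Set.range (polyInd (V := V)))).toSubalgebra
    (Submodule.subset_span ⟨∅, by ext x; simp [polyInd, polyhedron]⟩) fun f g hf hg => by
      classical
      have := Submodule.mul_mem_mul hf hg
      rw [Submodule.span_mul_span] at this
      refine Submodule.span_mono ?_ this
      rintro _ ⟨_, ⟨S, rfl⟩, _, ⟨S', rfl⟩, rfl⟩
      refine ⟨S ∪ S', ?_⟩
      simp only [polyInd]
      rw [show polyhedron (S ∪ S') = polyhedron S ∩ polyhedron S' by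
        ext x; simp only [polyhedron, Finset.mem_union, Set.mem_inter_iff, Set.mem_ofPred_eq]
        exact ⟨fun h => ⟨fun k hk => h k (.inl hk), fun k hk => h k (.inr hk)⟩,
          fun h k hk => hk.elim (h.1 k) (h.2 k)⟩]
      ext x
      simp only [Set.indicator, Pi.mul_apply, Set.mem_inter_iff]
      split_ifs <;> simp_all

theorem polyInd_mem (S : Finset (V × ℝ)) : polyInd S ∈ polyFun V :=
  Submodule.subset_span ⟨S, rfl⟩

theorem exists_linearCombination (g : polyFun V) :
    ∃ z : Finset (V × ℝ) →₀ ℤ, Finsupp.linearCombination ℤ polyInd z = (g : V → ℤ) :=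
  (Finsupp.mem_span_range_iff_exists_finsupp (R := ℤ)).1 g.2 |>.imp fun _ h => h

theorem linearCombination_polyInd (z : Finset (V × ℝ) →₀ ℤ) (x : V) :
    Finsupp.linearCombination ℤ polyInd z x
      = ∑ S ∈ z.support, z S * (polyhedron S).indicator 1 x := by
  simp [Finsupp.linearCombination_apply, Finsupp.sum, polyInd, Finset.sum_apply]

theorem exists_polyCls (hC : IsAdmissible C) {A : Set V} (hA : A ∈ C) :
    ∃ Φ : polyFun V →ₗ[ℤ] DissectionGroup C,
      ∀ S, Φ ⟨polyInd S, polyInd_mem S⟩ = cls C (A ∩ polyhedron S) := by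
  let ev : (Finset (V × ℝ) →₀ ℤ) →ₗ[ℤ] polyFun V :=
    Finsupp.linearCombination ℤ fun S => ⟨polyInd S, polyInd_mem S⟩
  let cl : (Finset (V × ℝ) →₀ ℤ) →ₗ[ℤ] DissectionGroup C :=
    Finsupp.linearCombination ℤ fun S => cls C (A ∩ polyhedron S)
  have hev : ∀ z, (ev z : V → ℤ) = Finsupp.linearCombination ℤ polyInd z := fun z => by
    simp only [ev, Finsupp.linearCombination_apply, Finsupp.sum, AddSubmonoidClass.coe_finsetSum,
      SetLike.val_smul]
  have hsurj : Function.Surjective ev := fun g => by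
    obtain ⟨z, hz⟩ := exists_linearCombination g
    exact ⟨z, Subtype.ext ((hev z).trans hz)⟩
  have hker : LinearMap.ker ev ≤ LinearMap.ker cl := fun z hz => by
    rw [LinearMap.mem_ker] at hz ⊢
    simp only [cl, Finsupp.linearCombination_apply, Finsupp.sum]
    refine sum_polyhedra_eq_zero hC ∅ (cls C) (cutAdditive_cls hC) (fun Z _ h => ?_)
      (fun Z _ Z' _ h h' => ?_) z.support z (Or.inr hA) fun x _ => ?_
    · rw [Set.subset_empty_iff.1 h, cls_empty]
    · rw [h.antisymm (Set.sdiff_eq_empty.1 (Set.subset_empty_iff.1 h'))]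
    · rw [← linearCombination_polyInd, ← hev, hz]; rfl
  refine ⟨((LinearMap.ker ev).liftQ cl hker).comp
    (ev.quotKerEquivOfSurjective hsurj).symm.toLinearMap, fun S => ?_⟩
  have h1 : ev (Finsupp.single S 1) = ⟨polyInd S, polyInd_mem S⟩ := by simp [ev]
  have h2 : cl (Finsupp.single S 1) = cls C (A ∩ polyhedron S) := by simp [cl]
  rw [← h1, ← h2, LinearMap.comp_apply, LinearEquiv.coe_coe,
    show ev (Finsupp.single S 1)
      = ev.quotKerEquivOfSurjective hsurj (Submodule.Quotient.mk (Finsupp.single S 1)) from rfl,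
    LinearEquiv.symm_apply_apply]
  rfl

/-- The extension of `S ↦ [A ∩ S]` from closed polyhedral sets to polyhedral functions. -/
def polyCls (hC : IsAdmissible C) {A : Set V} (hA : A ∈ C) : polyFun V →ₗ[ℤ] DissectionGroup C :=
  (exists_polyCls hC hA).choose

theorem polyCls_polyInd (hC : IsAdmissible C) {A : Set V} (hA : A ∈ C) (S : Finset (V × ℝ)) :
    polyCls hC hA ⟨polyInd S, polyInd_mem S⟩ = cls C (A ∩ polyhedron S) :=
  (exists_polyCls hC hA).choose_spec S

theorem polyCls_eq_sum (hC : IsAdmissible C) {A : Set V} (hA : A ∈ C) (g : polyFun V)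
    (z : Finset (V × ℝ) →₀ ℤ) (hz : Finsupp.linearCombination ℤ polyInd z = (g : V → ℤ)) :
    polyCls hC hA g = ∑ S ∈ z.support, z S • cls C (A ∩ polyhedron S) := by
  have : g = ∑ S ∈ z.support, z S • (⟨polyInd S, polyInd_mem S⟩ : polyFun V) := by
    apply Subtype.ext
    rw [← hz]
    simp only [Finsupp.linearCombination_apply, Finsupp.sum, AddSubmonoidClass.coe_finsetSum,
      SetLike.val_smul]
  rw [this, map_sum]
  simp only [map_zsmul, polyCls_polyInd]

/-- Shrinking the ambient set does not change the class of a function supported in the smaller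
set. -/
theorem polyCls_eq_of_subset (hC : IsAdmissible C) {A B : Set V} (hA : A ∈ C) (hB : B ∈ C)
    (hBA : B ⊆ A) (g : polyFun V) (hg : ∀ x ∈ A, x ∉ B → (g : V → ℤ) x = 0) :
    polyCls hC hA g = polyCls hC hB g := by
  obtain ⟨z, hz⟩ := exists_linearCombination g
  rw [polyCls_eq_sum hC hA g z hz, polyCls_eq_sum hC hB g z hz, ← sub_eq_zero,
    ← Finset.sum_sub_distrib]
  -- The defect `[Z] - [Z ∩ B]` is zero for `Z ⊆ B`. It does not change when `Z` grows inside `B`,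
  -- because then `Z' = Z ∪ (Z' ∩ B)`.
  have := sum_polyhedra_eq_zero hC B (fun Z => cls C Z - cls C (Z ∩ B)) (fun D hD v c => ?_)
    (fun Z _ h => ?_) (fun Z hZ Z' hZ' h h' => ?_) z.support z (Or.inr hA) fun x hx => ?_
  · rw [← this]
    refine Finset.sum_congr rfl fun S _ => ?_
    rw [← smul_sub, show A ∩ polyhedron S ∩ B = B ∩ polyhedron S by
      rw [Set.inter_right_comm, Set.inter_eq_right.2 hBA]]
  · have h1 := cutAdditive_cls hC D hD v c
    have h2 := cutAdditive_cls hC _ (hC.inter_insert hD (Or.inr hB)) v c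
    simp only [Set.inter_right_comm _ B] at h2
    simp only [h1, h2]; abel
  · rw [Set.inter_eq_left.2 h, sub_self]
  · have hU : Z ∪ Z' ∩ B = Z' := by
      ext x
      have := @h x
      have := @h' x
      simp only [Set.mem_union, Set.mem_inter_iff, Set.mem_sdiff] at *
      tauto
    have h3 := cls_union' hC hZ (hC.inter_insert hZ' (Or.inr hB)) (by rwa [hU])
    rw [hU, ← Set.inter_assoc, Set.inter_eq_left.2 h] at h3
    rw [sub_eq_sub_iff_add_eq_add, h3]
  · rw [← linearCombination_polyInd, hz]
    exact hg x hx.1 hx.2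

theorem IsAdmissible.translate (hC : IsAdmissible C) {A : Set V} (hA : A ∈ C) (v : V) :
    (fun x => x + v) '' A ∈ C := by
  have := hC.isometry (AffineIsometryEquiv.constVAdd ℝ V v) A hA
  simpa [add_comm] using this

theorem cls_translate (hC : IsAdmissible C) (A : Set V) (v : V) :
    cls C ((fun x => x + v) '' A) = cls C A := by
  have := cls_image hC (AffineIsometryEquiv.constVAdd ℝ V v) A
  simpa [add_comm] using this

theorem polyCls_comp_add (hC : IsAdmissible C) {A : Set V} (hA : A ∈ C) (v : V) (g g' : polyFun V)
    (hg : ∀ x, (g' : V → ℤ) x = (g : V → ℤ) (x + v)) :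
    polyCls hC hA g' = polyCls hC (hC.translate hA v) g := by
  classical
  suffices H : ∀ f ∈ Submodule.span ℤ (Set.range (polyInd (V := V))), ∃ h h' : polyFun V,
      (h : V → ℤ) = f ∧ (∀ x, (h' : V → ℤ) x = f (x + v)) ∧
      polyCls hC hA h' = polyCls hC (hC.translate hA v) h by
    obtain ⟨h, h', h1, h2, h3⟩ := H g g.2
    rwa [show g = h from Subtype.ext h1.symm,
      show g' = h' from Subtype.ext (funext fun x => (hg x).trans (h2 x).symm)]
  intro f hf
  induction hf using Submodule.span_induction with
  | mem f hf =>
    obtain ⟨S, rfl⟩ := hf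
    let S' : Finset (V × ℝ) := S.image fun h => (h.1, h.2 - ⟪h.1, v⟫)
    have hS' : ∀ x, x ∈ polyhedron S' ↔ x + v ∈ polyhedron S := fun x => by
      simp only [polyhedron, S', Finset.mem_image, Set.mem_ofPred_eq, forall_exists_index, and_imp,
        forall_apply_eq_imp_iff₂, inner_add_right, sub_le_iff_le_add]
    refine ⟨⟨_, polyInd_mem S⟩, ⟨_, polyInd_mem S'⟩, rfl, fun x => ?_, ?_⟩
    · simp only [polyInd, Set.indicator, hS']; rfl
    · rw [polyCls_polyInd, polyCls_polyInd, ← cls_translate hC _ v]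
      congr 1
      ext y
      simp only [Set.mem_image, Set.mem_inter_iff, hS']
      constructor
      · rintro ⟨x, ⟨hx, hx'⟩, rfl⟩; exact ⟨⟨x, hx, rfl⟩, hx'⟩
      · rintro ⟨⟨x, hx, rfl⟩, hx'⟩; exact ⟨x, ⟨hx, hx'⟩, rfl⟩
  | zero => exact ⟨0, 0, rfl, fun _ => rfl, by simp⟩
  | add f₁ f₂ _ _ h₁ h₂ =>
    obtain ⟨a, a', h1, h2, h3⟩ := h₁
    obtain ⟨b, b', k1, k2, k3⟩ := h₂
    exact ⟨a + b, a' + b', by simp [h1, k1], fun x => by simp [h2, k2], by simp [h3, k3]⟩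
  | smul n f _ h =>
    obtain ⟨a, a', h1, h2, h3⟩ := h
    exact ⟨n • a, n • a', by simp [h1], fun x => by simp [h2], by rw [map_smul, map_smul, h3]⟩

/-- The class of a polyhedral function supported in `K` is invariant under translations that keep
the support in `K`. -/
theorem polyCls_translation_invariant (hC : IsAdmissible C) {K : Set V} (hK : K ∈ C) (v : V)
    (g g' : polyFun V) (hg : ∀ x, (g' : V → ℤ) x = (g : V → ℤ) (x + v))
    (hs : ∀ x, (g : V → ℤ) x ≠ 0 → x ∈ K) (hs' : ∀ x, (g' : V → ℤ) x ≠ 0 → x ∈ K) :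
    polyCls hC hK g' = polyCls hC hK g := by
  have hKv := hC.translate hK v
  have hI := hC.inter _ hK _ hKv
  -- Translation changes the ambient set from `K` to `K + v`; both are compared with `K ∩ (K + v)`,
  -- which carries the support of `g`.
  rw [polyCls_comp_add hC hK v g g' hg,
    polyCls_eq_of_subset hC hKv hI Set.inter_subset_right g fun x hx hx' => ?_,
    polyCls_eq_of_subset hC hK hI Set.inter_subset_left g fun x hx hx' => ?_]
  · by_contra h
    refine hx' ⟨hx, x - v, hs' _ ?_, sub_add_cancel x v⟩
    rwa [hg, sub_add_cancel]
  · by_contra h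
    exact hx' ⟨hs x h, hx⟩

open Classical in
/-- The indicator function of the half-space `c ≤ ⟪v, x⟫`. -/
def halfInd (v : V) (c : ℝ) : polyFun V := ⟨polyInd {(v, c)}, polyInd_mem _⟩

open Classical in
theorem halfInd_apply (v : V) (c : ℝ) (x : V) :
    (halfInd v c : V → ℤ) x = if c ≤ ⟪v, x⟫ then 1 else 0 := by
  simp [halfInd, polyInd, polyhedron, Set.indicator]

end Pizza

namespace Pizza

variable {V : Type*} [NormedAddCommGroup V] [InnerProductSpace ℝ V] {M : Type*} [AddCommGroup M]

/-! ### Translation invariant valuations on planar boxes -/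

/-- A map that is additive on a segment `[0, δ]` extends to a homomorphism. -/
theorem exists_addMonoidHom_of_local (f : ℝ → M) {δ : ℝ} (hδ : 0 < δ)
    (hf : ∀ x y, 0 ≤ x → 0 ≤ y → x + y ≤ δ → f (x + y) = f x + f y) :
    ∃ F : ℝ →+ M, ∀ x, 0 ≤ x → x ≤ δ → F x = f x := by
  have h0 : f 0 = 0 := by simpa using hf 0 0 le_rfl le_rfl (by simpa using hδ.le)
  -- In units of `δ`, whole parts count copies of `f δ`. When the fractional parts carry, additivity
  -- on `[0, δ]` is used by splitting `δ` at the first fractional part.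
  let G : ℝ → M := fun v => ⌊v⌋ • f δ + f (δ * Int.fract v)
  have hfr : ∀ v : ℝ, 0 ≤ δ * Int.fract v := fun v => mul_nonneg hδ.le (Int.fract_nonneg v)
  have hG : ∀ u v, G (u + v) = G u + G v := by
    intro u v
    have hu := Int.floor_add_fract u
    have hv := Int.floor_add_fract v
    rcases lt_or_ge (Int.fract u + Int.fract v) 1 with h | h
    · have h1 : ⌊u + v⌋ = ⌊u⌋ + ⌊v⌋ := by
        rw [Int.floor_eq_iff]
        have := Int.fract_nonneg u
        have := Int.fract_nonneg v
        push_cast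
        constructor <;> linarith
      have h2 : Int.fract (u + v) = Int.fract u + Int.fract v := by
        rw [Int.fract, h1]; push_cast; linarith
      simp only [G, h1, h2, mul_add, add_smul]
      rw [hf _ _ (hfr u) (hfr v) (by nlinarith)]
      abel
    · have h1 : ⌊u + v⌋ = ⌊u⌋ + ⌊v⌋ + 1 := by
        rw [Int.floor_eq_iff]
        have := Int.fract_lt_one u
        have := Int.fract_lt_one v
        push_cast
        constructor <;> linarith
      have h2 : Int.fract (u + v) = Int.fract u + Int.fract v - 1 := by
        rw [Int.fract, h1]; push_cast; linarith
      have hu1 := Int.fract_lt_one u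
      have hv1 := Int.fract_lt_one v
      have e1 : f δ = f (δ * Int.fract u) + f (δ * (1 - Int.fract u)) := by
        rw [← hf _ _ (hfr u) (mul_nonneg hδ.le (by linarith)) (by linarith)]
        congr 1; ring
      have e2 : f (δ * Int.fract v)
          = f (δ * (1 - Int.fract u)) + f (δ * (Int.fract u + Int.fract v - 1)) := by
        rw [← hf _ _ (mul_nonneg hδ.le (by linarith)) (mul_nonneg hδ.le (by linarith))
          (by nlinarith)]
        congr 1; ring
      simp only [G, h1, h2, add_smul, one_smul]
      rw [e2]
      nth_rewrite 3 [e1]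
      abel
  refine ⟨(AddMonoidHom.mk' G hG).comp (AddMonoidHom.mulRight δ⁻¹), fun x hx hx' => ?_⟩
  change G (x * δ⁻¹) = f x
  rcases hx'.lt_or_eq with h | rfl
  · have h1 : 0 ≤ x * δ⁻¹ := by positivity
    have h2 : x * δ⁻¹ < 1 := by rwa [← div_eq_mul_inv, div_lt_one hδ]
    simp only [G, Int.floor_eq_zero_iff.2 ⟨h1, h2⟩, Int.fract_eq_self.2 ⟨h1, h2⟩, zero_smul,
      zero_add]
    congr 1; field_simp
  · simp [G, mul_inv_cancel₀ hδ.ne', h0]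

/-- The indicator function of a half-open box in the coordinates `⟪s, ·⟫`, `⟪t, ·⟫`. -/
def boxInd (s t : V) (x₀ y₀ x y : ℝ) : polyFun V :=
  (halfInd s x₀ - halfInd s (x₀ + x)) * (halfInd t y₀ - halfInd t (y₀ + y))

/-- The indicator function of the half-open triangle below a line of slope `k`. -/
def triInd (s t : V) (k x₀ y₀ x : ℝ) : polyFun V :=
  (halfInd s x₀ - halfInd s (x₀ + x)) * (halfInd t y₀ - halfInd (t - k • s) (y₀ - k * x₀))

theorem boxInd_apply (s t : V) (x₀ y₀ x y : ℝ) (p : V) : (boxInd s t x₀ y₀ x y : V → ℤ) p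
    = ((if x₀ ≤ ⟪s, p⟫ then 1 else 0) - (if x₀ + x ≤ ⟪s, p⟫ then 1 else 0))
      * ((if y₀ ≤ ⟪t, p⟫ then 1 else 0) - (if y₀ + y ≤ ⟪t, p⟫ then 1 else 0)) := by
  simp [boxInd, halfInd_apply]

theorem triInd_apply (s t : V) (k x₀ y₀ x : ℝ) (p : V) : (triInd s t k x₀ y₀ x : V → ℤ) p
    = ((if x₀ ≤ ⟪s, p⟫ then 1 else 0) - (if x₀ + x ≤ ⟪s, p⟫ then 1 else 0))
      * ((if y₀ ≤ ⟪t, p⟫ then 1 else 0)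
        - (if y₀ - k * x₀ ≤ ⟪t, p⟫ - k * ⟪s, p⟫ then 1 else 0)) := by
  simp [triInd, halfInd_apply, inner_sub_left, inner_smul_left]

/-- The half-open box in the coordinates `⟪s, ·⟫`, `⟪t, ·⟫`. -/
def boxSet (s t : V) (x₀ y₀ x y : ℝ) : Set V :=
  {p | x₀ ≤ ⟪s, p⟫ ∧ ⟪s, p⟫ < x₀ + x ∧ y₀ ≤ ⟪t, p⟫ ∧ ⟪t, p⟫ < y₀ + y}

theorem boxInd_support {s t : V} {x₀ y₀ x y : ℝ} (hx : 0 ≤ x) (hy : 0 ≤ y) {p : V}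
    (hp : (boxInd s t x₀ y₀ x y : V → ℤ) p ≠ 0) : p ∈ boxSet s t x₀ y₀ x y := by
  rw [boxInd_apply] at hp
  obtain ⟨h1, h2⟩ := mul_ne_zero_iff.1 hp
  refine ⟨?_, ?_, ?_, ?_⟩ <;> by_contra! hc
  · exact h1 (by rw [if_neg (by linarith), if_neg (by linarith), sub_zero])
  · exact h1 (by rw [if_pos (by linarith), if_pos (by linarith), sub_self])
  · exact h2 (by rw [if_neg (by linarith), if_neg (by linarith), sub_zero])
  · exact h2 (by rw [if_pos (by linarith), if_pos (by linarith), sub_self])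

theorem triInd_support {s t : V} {k x₀ y₀ x : ℝ} (hk : 0 ≤ k) (hx : 0 ≤ x) {p : V}
    (hp : (triInd s t k x₀ y₀ x : V → ℤ) p ≠ 0) : p ∈ boxSet s t x₀ y₀ x (k * x) := by
  rw [triInd_apply] at hp
  obtain ⟨h1, h2⟩ := mul_ne_zero_iff.1 hp
  have h3 : x₀ ≤ ⟪s, p⟫ := by
    by_contra! hc
    exact h1 (by rw [if_neg (by linarith), if_neg (by linarith), sub_zero])
  have h4 : ⟪s, p⟫ < x₀ + x := by
    by_contra! hc
    exact h1 (by rw [if_pos (by linarith), if_pos (by linarith), sub_self])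
  have h5 : 0 ≤ k * (⟪s, p⟫ - x₀) := mul_nonneg hk (by linarith)
  have h6 : k * (⟪s, p⟫ - x₀) ≤ k * x := mul_le_mul_of_nonneg_left (by linarith) hk
  refine ⟨h3, h4, ?_, ?_⟩ <;> by_contra! hc
  · exact h2 (by rw [if_neg (by linarith), if_neg (by linarith), sub_zero])
  · exact h2 (by rw [if_pos (by linarith), if_pos (by linarith), sub_self])

/-- A triangle over a base `x + z` splits into the triangle over `x`, a box of size `z` by `k * x`,
and a raised triangle over `z`. Half-open conventions make this an exact identity without boundary
terms. -/
theorem triInd_add (s t : V) (k x₀ y₀ x z : ℝ) :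
    triInd s t k x₀ y₀ (x + z) = triInd s t k x₀ y₀ x + boxInd s t (x₀ + x) y₀ z (k * x)
      + triInd s t k (x₀ + x) (y₀ + k * x) z := by
  simp only [triInd, boxInd, show y₀ + k * x - k * (x₀ + x) = y₀ - k * x₀ by ring,
    ← add_assoc x₀ x z]
  ring

theorem boxInd_add_right (s t : V) (x₀ y₀ x y z : ℝ) :
    boxInd s t x₀ y₀ x (y + z) = boxInd s t x₀ y₀ x y + boxInd s t x₀ (y₀ + y) x z := by
  simp only [boxInd, ← add_assoc y₀ y z]
  ring

/-- `Ψ` is invariant under all translations of the plane with coordinates `⟪s, ·⟫`, `⟪t, ·⟫`, on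
functions whose support stays in `D`. -/
def IsPlanarInvariant (s t : V) (Ψ : polyFun V →+ M) (D : Set V) : Prop :=
  ∀ a b : ℝ, ∃ v : V, ⟪s, v⟫ = a ∧ ⟪t, v⟫ = b ∧ ∀ g g' : polyFun V,
    (∀ x, (g' : V → ℤ) x = (g : V → ℤ) (x + v)) → (∀ x, (g : V → ℤ) x ≠ 0 → x ∈ D) →
    (∀ x, (g' : V → ℤ) x ≠ 0 → x ∈ D) → Ψ g' = Ψ g

namespace IsPlanarInvariant

variable {s t : V} {Ψ : polyFun V →+ M} {D : Set V}

theorem box_shift (h : IsPlanarInvariant s t Ψ D) {x₀ y₀ x₁ y₁ x y : ℝ} (hx : 0 ≤ x) (hy : 0 ≤ y)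
    (h₀ : boxSet s t x₀ y₀ x y ⊆ D) (h₁ : boxSet s t x₁ y₁ x y ⊆ D) :
    Ψ (boxInd s t x₀ y₀ x y) = Ψ (boxInd s t x₁ y₁ x y) := by
  obtain ⟨v, hs, ht, hv⟩ := h (x₁ - x₀) (y₁ - y₀)
  refine hv _ _ (fun p => ?_) (fun p hp => h₁ (boxInd_support hx hy hp))
    fun p hp => h₀ (boxInd_support hx hy hp)
  simp only [boxInd_apply, inner_add_right, hs, ht]
  congr! 3 <;> constructor <;> intro <;> linarith

theorem tri_shift (h : IsPlanarInvariant s t Ψ D) {k x₀ y₀ x₁ y₁ x : ℝ} (hk : 0 ≤ k) (hx : 0 ≤ x)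
    (h₀ : boxSet s t x₀ y₀ x (k * x) ⊆ D) (h₁ : boxSet s t x₁ y₁ x (k * x) ⊆ D) :
    Ψ (triInd s t k x₀ y₀ x) = Ψ (triInd s t k x₁ y₁ x) := by
  obtain ⟨v, hs, ht, hv⟩ := h (x₁ - x₀) (y₁ - y₀)
  refine hv _ _ (fun p => ?_) (fun p hp => h₁ (triInd_support hk hx hp))
    fun p hp => h₀ (triInd_support hk hx hp)
  simp only [triInd_apply, inner_add_right, hs, ht]
  congr! 3 <;> constructor <;> intro <;> linarith

theorem box_tri (h : IsPlanarInvariant s t Ψ D) {k x₀ y₀ x z : ℝ} (hk : 0 ≤ k) (hx : 0 ≤ x)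
    (hz : 0 ≤ z) (hD : boxSet s t x₀ y₀ (x + z) (k * (x + z)) ⊆ D) :
    Ψ (boxInd s t x₀ y₀ z (k * x))
      = Ψ (triInd s t k x₀ y₀ (x + z)) - Ψ (triInd s t k x₀ y₀ x) - Ψ (triInd s t k x₀ y₀ z) := by
  have hkx := mul_nonneg hk hx
  have hkz := mul_nonneg hk hz
  have hsub : ∀ a b x' y', 0 ≤ a → 0 ≤ b → a + x' ≤ x + z → b + y' ≤ k * x + k * z →
      boxSet s t (x₀ + a) (y₀ + b) x' y' ⊆ D := fun a b x' y' ha hb ha' hb' p hp => by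
    obtain ⟨h1, h2, h3, h4⟩ := hp
    exact hD ⟨by linarith, by linarith, by linarith, by linarith⟩
  rw [triInd_add, map_add, map_add,
    h.tri_shift hk hz (hsub x (k * x) _ _ hx hkx le_rfl le_rfl)
      (by simpa using hsub 0 0 z (k * z) le_rfl le_rfl (by linarith) (by linarith)),
    h.box_shift hz hkx (x₀ := x₀ + x) (y₀ := y₀) (x₁ := x₀) (y₁ := y₀)
      (by simpa using hsub x 0 z (k * x) hx le_rfl le_rfl (by linarith))
      (by simpa using hsub 0 0 z (k * x) le_rfl le_rfl (by linarith) (by linarith))]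
  abel

/-- By `box_tri` a box is a difference of similar triangles that is symmetric in `x` and `z`. This
is the reason why only the area of a box matters. -/
theorem box_swap (h : IsPlanarInvariant s t Ψ D) {k x₀ y₀ x z : ℝ} (hk : 0 ≤ k) (hx : 0 ≤ x)
    (hz : 0 ≤ z) (hD : boxSet s t x₀ y₀ (x + z) (k * (x + z)) ⊆ D) :
    Ψ (boxInd s t x₀ y₀ z (k * x)) = Ψ (boxInd s t x₀ y₀ x (k * z)) := by
  rw [h.box_tri hk hx hz hD, h.box_tri hk hz hx (by rwa [add_comm z x]), add_comm z x]
  abel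

theorem sum_halfInd (s : V) (x₀ a : ℝ) (N : ℕ) :
    ∑ i ∈ Finset.range N, (halfInd s (x₀ + i * a) - halfInd s (x₀ + i * a + a))
      = halfInd s x₀ - halfInd s (x₀ + N * a) := by
  have := Finset.sum_range_sub' (fun i : ℕ => halfInd s (x₀ + i * a)) N
  simp only [Nat.cast_add, Nat.cast_one, Nat.cast_zero, zero_mul, add_zero] at this
  rw [← this]
  refine Finset.sum_congr rfl fun i _ => ?_
  congr 2; ring

theorem boxInd_subdivide (s t : V) (x₀ y₀ a b : ℝ) (N : ℕ) :
    boxInd s t x₀ y₀ (N * a) (N * b) = ∑ i ∈ Finset.range N, ∑ j ∈ Finset.range N,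
      boxInd s t (x₀ + i * a) (y₀ + j * b) a b := by
  simp only [boxInd, ← sum_halfInd, Finset.sum_mul_sum]

/-- Stacking boxes of a fixed width gives additivity in the area, and `box_swap` reduces any small
box to that width. Larger boxes are subdivided. The map `F` is only additive, not linear, which
suffices since it will be evaluated at total area zero. -/
theorem exists_area (h : IsPlanarInvariant s t Ψ D) : ∃ F : ℝ →+ M, ∀ x₀ y₀ x y : ℝ, 0 ≤ x →
    0 ≤ y → boxSet s t x₀ y₀ x y ⊆ D → Ψ (boxInd s t x₀ y₀ x y) = F (x * y) := by
  by_cases hex : ∃ x₀ y₀ x y : ℝ, 0 < x ∧ 0 < y ∧ boxSet s t x₀ y₀ x y ⊆ D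
  swap
  · refine ⟨0, fun x₀ y₀ x y hx hy hD => ?_⟩
    push Not at hex
    rcases hx.eq_or_lt with rfl | hx
    · simp [boxInd]
    rcases hy.eq_or_lt with rfl | hy
    · simp [boxInd]
    exact absurd hD (hex x₀ y₀ x y hx hy)
  obtain ⟨X, Y, l, m, hl, hm, hlm⟩ := hex
  have hsub : ∀ a b x' y', 0 ≤ a → 0 ≤ b → a + x' ≤ l → b + y' ≤ m →
      boxSet s t (X + a) (Y + b) x' y' ⊆ D := fun a b x' y' ha hb ha' hb' p hp => by
    obtain ⟨h1, h2, h3, h4⟩ := hp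
    exact hlm ⟨by linarith, by linarith, by linarith, by linarith⟩
  have hsub0 : ∀ x' y', x' ≤ l → y' ≤ m → boxSet s t X Y x' y' ⊆ D := fun x' y' hx hy => by
    simpa using hsub 0 0 x' y' le_rfl le_rfl (by simpa using hx) (by simpa using hy)
  -- Half of the reference box leaves room in `D` for the triangles over a base `x + z` used by
  -- `box_swap`.
  have hl2 : 0 < l / 2 := by linarith
  have hm2 : 0 < m / 2 := by linarith
  obtain ⟨F, hF⟩ := exists_addMonoidHom_of_local
    (fun v => Ψ (boxInd s t X Y (l / 2) (v / (l / 2)))) (mul_pos hl2 hm2) fun v w hv hw hvw => by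
      have hv' : 0 ≤ v / (l / 2) := by positivity
      have hw' : 0 ≤ w / (l / 2) := by positivity
      have hvw' : v / (l / 2) + w / (l / 2) ≤ m / 2 := by
        rw [← add_div, div_le_iff₀ hl2]; linarith
      simp only [add_div v w]
      rw [boxInd_add_right, map_add]
      congr 1
      exact h.box_shift hl2.le hw'
        (by simpa using hsub 0 (v / (l / 2)) (l / 2) (w / (l / 2)) le_rfl hv' (by linarith)
              (by linarith))
        (hsub0 _ _ (by linarith) (by linarith))
  have hR : ∀ x y, 0 ≤ x → x ≤ l / 2 → 0 ≤ y → y ≤ m / 2 →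
      Ψ (boxInd s t X Y x y) = F (x * y) := by
    intro x y hx hxl hy hym
    rw [hF _ (mul_nonneg hx hy) (mul_le_mul hxl hym hy hl2.le)]
    have hk : 0 ≤ y / (l / 2) := by positivity
    have := h.box_swap (x₀ := X) (y₀ := Y) hk hl2.le hx (hsub0 _ _ (by linarith) (by
      rw [div_mul_eq_mul_div, div_le_iff₀ hl2]
      nlinarith))
    rw [div_mul_cancel₀ _ hl2.ne'] at this
    rw [this]
    congr 2; ring
  refine ⟨F, fun x₀ y₀ x y hx hy hD => ?_⟩
  -- An `N` by `N` subdivision has cells no larger than half of the reference box; the added `1`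
  -- keeps `N` positive.
  obtain ⟨N, hN⟩ := exists_nat_ge (max (x / (l / 2)) (y / (m / 2)) + 1)
  have hNx : x / (l / 2) ≤ N := by linarith [le_max_left (x / (l / 2)) (y / (m / 2))]
  have hNy : y / (m / 2) ≤ N := by linarith [le_max_right (x / (l / 2)) (y / (m / 2))]
  have hN0 : (0 : ℝ) < N := by
    have : 0 ≤ x / (l / 2) := by positivity
    linarith [le_max_left (x / (l / 2)) (y / (m / 2))]
  have ha : 0 ≤ x / N := by positivity
  have hb : 0 ≤ y / N := by positivity
  have hal : x / N ≤ l / 2 := by rw [div_le_iff₀ hN0]; rw [div_le_iff₀ hl2] at hNx; linarith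
  have hbm : y / N ≤ m / 2 := by rw [div_le_iff₀ hN0]; rw [div_le_iff₀ hm2] at hNy; linarith
  have hxa : N * (x / N) = x := by field_simp
  have hyb : N * (y / N) = y := by field_simp
  have hsum := boxInd_subdivide s t x₀ y₀ (x / N) (y / N) N
  rw [hxa, hyb] at hsum
  rw [hsum, map_sum]
  have hterm : ∀ i ∈ Finset.range N, ∀ j ∈ Finset.range N,
      Ψ (boxInd s t (x₀ + i * (x / N)) (y₀ + j * (y / N)) (x / N) (y / N))
        = F (x / N * (y / N)) := by
    intro i hi j hj
    rw [← hR _ _ ha hal hb hbm]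
    refine h.box_shift ha hb (fun p hp => hD ?_) (hsub0 _ _ (by linarith) (by linarith))
    obtain ⟨h1, h2, h3, h4⟩ := hp
    have hi' : (i : ℝ) + 1 ≤ N := by exact_mod_cast Finset.mem_range.1 hi
    have hj' : (j : ℝ) + 1 ≤ N := by exact_mod_cast Finset.mem_range.1 hj
    have := mul_le_mul_of_nonneg_right hi' ha
    have := mul_le_mul_of_nonneg_right hj' hb
    have : 0 ≤ (i : ℝ) * (x / N) := by positivity
    have : 0 ≤ (j : ℝ) * (y / N) := by positivity
    exact ⟨by linarith, by linarith, by linarith, by linarith⟩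
  calc _ = ∑ i ∈ Finset.range N, ∑ j ∈ Finset.range N, F (x / N * (y / N)) :=
        Finset.sum_congr rfl fun i hi => by
          rw [map_sum]; exact Finset.sum_congr rfl fun j hj => hterm i hi j hj
    _ = F ((N * N : ℕ) • (x / N * (y / N))) := by
        simp only [Finset.sum_const, Finset.card_range, ← mul_nsmul', ← map_nsmul]
        try rw [mul_comm]
    _ = F (x * y) := by
        congr 1
        rw [nsmul_eq_mul]; push_cast; field_simp

end IsPlanarInvariant

/-- A finite family of reals is enumerated by a monotone sequence. -/
theorem exists_monotone_enum {ι : Type*} [Fintype ι] (f : ι → ℝ) :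
    ∃ (N : ℕ) (x : ℕ → ℝ) (p : ι → ℕ), Monotone x ∧ ∀ k, p k ≤ N ∧ x (p k) = f k := by
  rcases isEmpty_or_nonempty ι with he | he
  · exact ⟨0, fun _ => 0, fun _ => 0, monotone_const, fun k => he.elim k⟩
  · let e := Fintype.equivFin ι
    have hc : 0 < Fintype.card ι := Fintype.card_pos
    let g : Fin (Fintype.card ι) → ℝ := f ∘ e.symm
    -- The sorted values are continued by the constant maximum to stay monotone on all of `ℕ`.
    refine ⟨Fintype.card ι, fun n => g (Tuple.sort g ⟨min n (Fintype.card ι - 1), by omega⟩),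
      fun k => (Tuple.sort g).symm (e k), fun a b hab => ?_,
      fun k => ⟨((Tuple.sort g).symm (e k)).2.le, ?_⟩⟩
    · refine Tuple.monotone_sort g ?_
      simp only [Fin.mk_le_mk]
      exact min_le_min_right _ hab
    · have : (⟨min ((Tuple.sort g).symm (e k) : ℕ) (Fintype.card ι - 1), by omega⟩ :
          Fin (Fintype.card ι)) = (Tuple.sort g).symm (e k) := by
        ext; simp; omega
      simp [this, g]

/-- Regroups truncated quadrants by grid cells. Taken in the ring of polyhedral functions it gives
the dissection, and taken in `ℝ` it gives the corresponding identity of areas. -/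
theorem sum_mul_tails {ι R : Type*} [Fintype ι] [CommRing R] (ε : ι → ℤ) (a b : ℕ → R)
    (p q : ι → ℕ) (N N' : ℕ) :
    ∑ k, ε k • ((∑ n ∈ Finset.Ico (p k) N, a n) * ∑ l ∈ Finset.Ico (q k) N', b l)
      = ∑ n ∈ Finset.range N, ∑ l ∈ Finset.range N',
        (∑ k, if p k ≤ n ∧ q k ≤ l then ε k else 0) • (a n * b l) := by
  have hI : ∀ (c : ℕ → R) (m N : ℕ), ∑ n ∈ Finset.Ico m N, c n
      = ∑ n ∈ Finset.range N, if m ≤ n then c n else 0 := fun c m N => by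
    rw [← Finset.sum_filter]
    congr 1
    ext n; simp [and_comm]
  simp only [hI, Finset.sum_mul_sum, Finset.sum_smul, Finset.smul_sum]
  rw [Finset.sum_comm]
  refine Finset.sum_congr rfl fun n _ => ?_
  rw [Finset.sum_comm]
  refine Finset.sum_congr rfl fun l _ => Finset.sum_congr rfl fun k _ => ?_
  by_cases h1 : p k ≤ n <;> by_cases h2 : q k ≤ l <;> simp [h1, h2]

theorem sum_Ico_sub_succ {R : Type*} [AddCommGroup R] (f : ℕ → R) {p N : ℕ} (h : p ≤ N) :
    ∑ n ∈ Finset.Ico p N, (f n - f (n + 1)) = f p - f N := by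
  rw [Finset.sum_Ico_eq_sub _ h, Finset.sum_range_sub', Finset.sum_range_sub']
  abel

/-- The corners of the quadrants span a finite grid. The hypotheses on each coordinate separately
cancel the unbounded remainders, and the one on the products says that the total signed area of the
cells is zero. -/
theorem IsPlanarInvariant.sum_eq_zero {s t : V} {Ψ : polyFun V →+ M} {D : Set V}
    (h : IsPlanarInvariant s t Ψ D) {ι : Type*} [Fintype ι] (ε : ι → ℤ) (σ τ : ι → ℝ)
    (hσ : ∀ φ : ℝ → ℝ, ∑ k, ε k * φ (σ k) = 0) (hτ : ∀ φ : ℝ → ℝ, ∑ k, ε k * φ (τ k) = 0)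
    (hστ : ∑ k, ε k * (σ k * τ k) = 0)
    (hD : ∀ x, ((∑ k, ε k • (halfInd s (σ k) * halfInd t (τ k)) : polyFun V) : V → ℤ) x ≠ 0 →
      x ∈ D) :
    Ψ (∑ k, ε k • (halfInd s (σ k) * halfInd t (τ k))) = 0 := by
  obtain ⟨N, x, p, hx, hp⟩ := exists_monotone_enum σ
  obtain ⟨N', y, q, hy, hq⟩ := exists_monotone_enum τ
  have hs : ∀ (v : V) (σ : ι → ℝ), (∀ φ : ℝ → ℝ, ∑ k, ε k * φ (σ k) = 0) →
      ∑ k, ε k • halfInd v (σ k) = 0 := by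
    intro v σ hσ
    apply Subtype.ext
    ext z
    have := hσ fun c => if c ≤ ⟪v, z⟫ then 1 else 0
    simp only [AddSubmonoidClass.coe_finsetSum, Finset.sum_apply, SetLike.val_smul, Pi.smul_apply,
      halfInd_apply, smul_eq_mul, ZeroMemClass.coe_zero, Pi.zero_apply]
    exact_mod_cast this
  have hε : ∑ k, (ε k : ℝ) = 0 := by simpa using hσ fun _ => 1
  have hεz : ∑ k, ε k = 0 := by exact_mod_cast hε
  have hf : ∑ k, ε k • (halfInd s (σ k) * halfInd t (τ k))
      = ∑ n ∈ Finset.range N, ∑ l ∈ Finset.range N',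
        (∑ k, if p k ≤ n ∧ q k ≤ l then ε k else 0) •
          boxInd s t (x n) (y l) (x (n + 1) - x n) (y (l + 1) - y l) := by
    simp only [boxInd, add_sub_cancel]
    rw [← sum_mul_tails ε (fun n => halfInd s (x n) - halfInd s (x (n + 1)))
      (fun n => halfInd t (y n) - halfInd t (y (n + 1)))]
    have : ∀ k, ε k • ((∑ n ∈ Finset.Ico (p k) N, (halfInd s (x n) - halfInd s (x (n + 1))))
        * ∑ l ∈ Finset.Ico (q k) N', (halfInd t (y l) - halfInd t (y (l + 1))))
        = ε k • (halfInd s (σ k) * halfInd t (τ k)) - (ε k • halfInd s (σ k)) * halfInd t (y N')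
          - (ε k • halfInd t (τ k)) * halfInd s (x N)
          + ε k • (halfInd s (x N) * halfInd t (y N')) := fun k => by
      rw [sum_Ico_sub_succ (fun n => halfInd s (x n)) (hp k).1,
        sum_Ico_sub_succ (fun n => halfInd t (y n)) (hq k).1, (hp k).2, (hq k).2]
      simp only [zsmul_eq_mul]
      ring
    rw [Finset.sum_congr rfl fun k _ => this k]
    simp only [Finset.sum_add_distrib, Finset.sum_sub_distrib, ← Finset.sum_mul,
      ← Finset.sum_smul, hs s σ hσ, hs t τ hτ, hεz]
    simp
  have harea : ∑ n ∈ Finset.range N, ∑ l ∈ Finset.range N',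
        (∑ k, if p k ≤ n ∧ q k ≤ l then ε k else 0) •
          ((x (n + 1) - x n) * (y (l + 1) - y l)) = 0 := by
    have h1 := sum_mul_tails ε (fun n => x n - x (n + 1)) (fun n => y n - y (n + 1)) p q N N'
    have : ∀ k, ε k • ((∑ n ∈ Finset.Ico (p k) N, (x n - x (n + 1)))
        * ∑ l ∈ Finset.Ico (q k) N', (y l - y (l + 1)))
        = ε k * (σ k * τ k) - (ε k * σ k) * y N' - (ε k * τ k) * x N
          + ε k * (x N * y N') := fun k => by
      rw [sum_Ico_sub_succ x (hp k).1, sum_Ico_sub_succ y (hq k).1, (hp k).2, (hq k).2]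
      simp only [zsmul_eq_mul]
      ring
    rw [Finset.sum_congr rfl fun k _ => this k] at h1
    simp only [Finset.sum_add_distrib, Finset.sum_sub_distrib, ← Finset.sum_mul, hστ,
      hσ fun z => z, hτ fun z => z, hε, zero_mul, sub_zero, add_zero] at h1
    rw [h1]
    refine Finset.sum_congr rfl fun n _ => Finset.sum_congr rfl fun l _ => ?_
    congr 1; ring
  obtain ⟨F, hF⟩ := h.exists_area
  have hterm : ∀ n l, (∑ k, if p k ≤ n ∧ q k ≤ l then ε k else 0) •
      Ψ (boxInd s t (x n) (y l) (x (n + 1) - x n) (y (l + 1) - y l))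
      = (∑ k, if p k ≤ n ∧ q k ≤ l then ε k else 0) •
        F ((x (n + 1) - x n) * (y (l + 1) - y l)) := by
    intro n l
    -- The coefficient of a cell is the value of the function on it, so a cell with nonzero
    -- coefficient lies in `D` and the area formula applies.
    by_cases hc : (∑ k, if p k ≤ n ∧ q k ≤ l then ε k else 0) = 0
    · rw [hc, zero_smul, zero_smul]
    · rw [hF _ _ _ _ (sub_nonneg.2 (hx n.le_succ)) (sub_nonneg.2 (hy l.le_succ))]
      rintro z ⟨h1, h2, h3, h4⟩
      rw [add_sub_cancel] at h2 h4
      refine hD z ?_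
      convert hc using 1
      simp only [AddSubmonoidClass.coe_finsetSum, Finset.sum_apply, SetLike.val_smul,
        Pi.smul_apply, MulMemClass.coe_mul, Pi.mul_apply, halfInd_apply, smul_eq_mul]
      refine Finset.sum_congr rfl fun k _ => ?_
      have e1 : σ k ≤ ⟪s, z⟫ ↔ p k ≤ n := by
        rw [← (hp k).2]
        refine ⟨fun hh => ?_, fun hh => (hx hh).trans h1⟩
        by_contra! hcon
        exact absurd (hx (Nat.succ_le_of_lt hcon)) (not_le.2 (hh.trans_lt h2))
      have e2 : τ k ≤ ⟪t, z⟫ ↔ q k ≤ l := by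
        rw [← (hq k).2]
        refine ⟨fun hh => ?_, fun hh => (hy hh).trans h3⟩
        by_contra! hcon
        exact absurd (hy (Nat.succ_le_of_lt hcon)) (not_le.2 (hh.trans_lt h4))
      simp only [e1, e2]
      by_cases g1 : p k ≤ n <;> by_cases g2 : q k ≤ l <;> simp [g1, g2]
  rw [hf]
  simp only [map_sum, map_zsmul]
  simp only [hterm, ← map_zsmul, ← map_sum]
  rw [harea, map_zero]

end Pizza

namespace Pizza

variable {V : Type*} [NormedAddCommGroup V] [InnerProductSpace ℝ V]

/-! ### Chambers -/

/-- The points on the same side as `x` of all hyperplanes. -/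
def sameSide (E : Set V) (x : V) : Set V := {y | ∀ e ∈ E, 0 < ⟪e, x⟫ * ⟪e, y⟫}

theorem mem_sameSide_comm {E : Set V} {x y : V} : y ∈ sameSide E x ↔ x ∈ sameSide E y := by
  simp only [sameSide, Set.mem_ofPred_eq, mul_comm]

theorem mem_sameSide_trans {E : Set V} {x y z : V} (hxy : y ∈ sameSide E x)
    (hyz : z ∈ sameSide E y) : z ∈ sameSide E x := fun e he => by
  have h1 := hxy e he
  have h2 := hyz e he
  rcases mul_pos_iff.1 h1 with ⟨h3, h4⟩ | ⟨h3, h4⟩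
  · exact mul_pos h3 ((pos_iff_pos_of_mul_pos h2).1 h4)
  · exact mul_pos_of_neg_of_neg h3 ((neg_iff_neg_of_mul_pos h2).1 h4)

theorem sameSide_eq {E : Set V} {x y : V} (hxy : y ∈ sameSide E x) :
    sameSide E y = sameSide E x :=
  Set.ext fun _ => ⟨mem_sameSide_trans hxy, mem_sameSide_trans (mem_sameSide_comm.1 hxy)⟩

theorem mem_sameSide_self {E : Set V} {x : V} (hx : x ∈ arrComplement E) : x ∈ sameSide E x :=
  fun e he => mul_self_pos.2 (hx e he)

/-- A connected set avoiding the hyperplanes cannot change sides, by the intermediate value theorem;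
conversely the set of points on the same sides is convex. -/
theorem connectedComponentIn_eq_sameSide {E : Set V} {x : V} (hx : x ∈ arrComplement E) :
    connectedComponentIn (arrComplement E) x = sameSide E x := by
  apply Set.Subset.antisymm
  · intro y hy e he
    by_contra! hcon
    have hpre : IsPreconnected ((fun z => ⟪e, z⟫) '' connectedComponentIn (arrComplement E) x) :=
      isPreconnected_connectedComponentIn.image _ (by fun_prop)
    have hx' := Set.mem_image_of_mem (fun z => ⟪e, z⟫) (mem_connectedComponentIn hx)
    have hy' := Set.mem_image_of_mem (fun z => ⟪e, z⟫) hy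
    have h0 : (0 : ℝ) ∈ (fun z => ⟪e, z⟫) '' connectedComponentIn (arrComplement E) x := by
      rcases mul_nonpos_iff.1 hcon with ⟨h1, h2⟩ | ⟨h1, h2⟩
      · exact hpre.ordConnected.out hy' hx' ⟨h2, h1⟩
      · exact hpre.ordConnected.out hx' hy' ⟨h1, h2⟩
    obtain ⟨z, hz, hz0⟩ := h0
    exact connectedComponentIn_subset _ _ hz e he hz0
  · refine IsPreconnected.subset_connectedComponentIn (Convex.isPreconnected ?_)
      (mem_sameSide_self hx) fun y hy e he h0 => ?_
    · intro y hy z hz a b ha hb hab e he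
      have h1 := hy e he
      have h2 := hz e he
      rw [inner_add_right, inner_smul_right, inner_smul_right]
      have : ⟪e, x⟫ * (a * ⟪e, y⟫ + b * ⟪e, z⟫)
          = a * (⟪e, x⟫ * ⟪e, y⟫) + b * (⟪e, x⟫ * ⟪e, z⟫) := by ring
      rw [this]
      rcases ha.eq_or_lt with rfl | ha
      · have : b = 1 := by linarith
        subst this; simpa using h2
      · have := mul_pos ha h1
        have := mul_nonneg hb h2.le
        linarith
    · have := hy e he
      rw [h0, mul_zero] at this
      exact lt_irrefl _ this

theorem isChamber_iff {E T : Set V} :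
    IsChamber E T ↔ ∃ x ∈ arrComplement E, T = sameSide E x := by
  refine exists_congr fun x => and_congr_right fun hx => ?_
  rw [connectedComponentIn_eq_sameSide hx]

theorem closure_sameSide {E : Set V} {x : V} (hx : x ∈ arrComplement E) :
    closure (sameSide E x) = {y | ∀ e ∈ E, 0 ≤ ⟪e, x⟫ * ⟪e, y⟫} := by
  apply Set.Subset.antisymm
  · refine closure_minimal (fun y hy e he => (hy e he).le) ?_
    simp only [Set.ofPred_forall]
    refine isClosed_iInter fun e => isClosed_iInter fun _ => isClosed_le (by fun_prop) (by fun_prop)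
  · intro y hy
    have h1 : Filter.Tendsto (fun t : ℝ => y + t • x) (nhdsWithin 0 (Set.Ioi 0)) (nhds y) := by
      have : Continuous fun t : ℝ => y + t • x := by fun_prop
      have := (this.tendsto 0).mono_left (nhdsWithin_le_nhds (s := Set.Ioi 0))
      simpa using this
    refine mem_closure_of_tendsto h1 ?_
    filter_upwards [self_mem_nhdsWithin] with t ht e he
    rw [inner_add_right, inner_smul_right, mul_add]
    have h2 := hy e he
    have h3 := mul_pos (Set.mem_Ioi.1 ht) (mul_self_pos.2 (hx e he))
    nlinarith

theorem separating_sameSide {E : Set V} {x y : V} (hx : x ∈ arrComplement E)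
    (hy : y ∈ arrComplement E) :
    separating E (sameSide E x) (sameSide E y) = {e ∈ E | ⟪e, x⟫ * ⟪e, y⟫ < 0} := by
  ext e
  simp only [separating, Set.mem_ofPred_eq]
  refine and_congr_right fun he =>
    ⟨fun h => h x (mem_sameSide_self hx) y (mem_sameSide_self hy), fun h x' hx' y' hy' => ?_⟩
  have h1 := hx' e he
  have h2 := hy' e he
  have h3 : 0 < (⟪e, x⟫ * ⟪e, x'⟫) * (⟪e, y⟫ * ⟪e, y'⟫) := mul_pos h1 h2
  by_contra! hcon
  nlinarith [mul_nonneg_of_nonpos_of_nonpos h.le (neg_nonpos.2 hcon)]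

/-- Turns the parity of separating hyperplanes into the sign of a product, which is multiplicative
over the factors. -/
theorem neg_one_pow_card_filter {α : Type*} (s : Finset α) (f : α → ℝ) (hf : ∀ a ∈ s, f a ≠ 0) :
    (-1 : ℤ) ^ (s.filter fun a => f a < 0).card = SignType.sign (∏ a ∈ s, f a) := by
  classical
  induction s using Finset.induction_on with
  | empty => simp
  | insert a s ha ih =>
    have ih := ih fun b hb => hf b (Finset.mem_insert_of_mem hb)
    rw [Finset.prod_insert ha, sign_mul, Finset.filter_insert]
    rcases lt_or_gt_of_ne (hf a (Finset.mem_insert_self a s)) with h | h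
    · rw [if_pos h, Finset.card_insert_of_notMem (by simp [ha]), pow_succ, ih, sign_neg h]
      simp
    · rw [if_neg (not_lt.2 h.le), ih, sign_pos h]
      simp

/-! ### Product arrangements -/

open Classical in
/-- Data describing one factor of a product of finite reflection arrangements: the arrangement `E`
lives in `U`, the isometries `w k` form its reflection group, and the closed base chamber, which
contains the regular point `base`, is cut out by the inequalities given by `walls`. The field
`vanish` says that the signed sum of the translates of the closed base chamber by an orbit is
supported in the convex hull of that orbit. -/
structure ReflectionFactor (U : Submodule ℝ V) (E : Finset V) where
  /-- index type of the reflection group -/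
  κ : Type
  [fintype : Fintype κ]
  /-- the elements of the reflection group -/
  w : κ → V ≃ₗᵢ[ℝ] V
  /-- their determinants -/
  ε : κ → ℤ
  /-- a point of the base chamber -/
  base : V
  /-- inward normals to the walls of the base chamber -/
  walls : Finset V
  root_mem : ∀ e ∈ E, e ∈ U
  base_mem : base ∈ U
  walls_mem : ∀ n ∈ walls, n ∈ U
  w_mem : ∀ k, w k ∈ coxeterGroup (E : Set V)
  map_mem : ∀ k, ∀ y ∈ U, w k y ∈ U
  symm_mem : ∀ k, ∀ y ∈ U, (w k).symm y ∈ U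
  map_eq : ∀ k, ∀ y ∈ Uᗮ, w k y = y
  map_root : ∀ k, ∀ e ∈ E, w k e ∈ E ∨ -(w k e) ∈ E
  symm_root : ∀ k, ∀ e ∈ E, (w k).symm e ∈ E ∨ -((w k).symm e) ∈ E
  base_ne : ∀ e ∈ E, ⟪e, base⟫ ≠ 0
  existsUnique : ∀ x, (∀ e ∈ E, ⟪e, x⟫ ≠ 0) → ∃! k, ∀ e ∈ E, 0 < ⟪e, base⟫ * ⟪e, w k x⟫
  sign_eq : ∀ k, ε k = 1 ∨ ε k = -1
  prod_eq : ∀ k, ∏ e ∈ E, ⟪e, (w k).symm base⟫ = ε k * ∏ e ∈ E, ⟪e, base⟫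
  walls_iff : ∀ x, (∀ e ∈ E, 0 ≤ ⟪e, base⟫ * ⟪e, x⟫) ↔ ∀ n ∈ walls, 0 ≤ ⟪n, x⟫
  exists_neg : ∀ k, ∃ k', ∀ y ∈ U, ∀ x, ⟪y, w k' x⟫ = -⟪y, w k x⟫
  vanish : ∀ o ∈ U, ∀ x a, (∀ k, 0 < ⟪o, x + w k a⟫) →
    ∑ k, ε k * (if ∀ n ∈ walls, 0 ≤ ⟪n, x + w k a⟫ then 1 else 0) = 0

attribute [instance] ReflectionFactor.fintype

theorem coxeterGroup_mono {E E' : Set V} (h : E ⊆ E') : coxeterGroup E ≤ coxeterGroup E' :=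
  Subgroup.closure_mono fun _ ⟨e, he, hw⟩ => ⟨e, h he, hw⟩

section Product

variable {I : Type*} [Fintype I] {U : I → Submodule ℝ V} {F : I → Finset V}

/-- An element of one factor fixes the orthogonal factors, so chosen elements of all factors can be
multiplied, one index at a time, without disturbing each other. -/
theorem exists_prod_isometry (hU : Pairwise fun i j => U i ⟂ U j)
    (D : ∀ i, ReflectionFactor (U i) (F i)) {E : Set V} (hE : E = ⋃ i, (F i : Set V))
    (c : ∀ i, (D i).κ) : ∃ w ∈ coxeterGroup E, ∀ i, ∀ y ∈ U i,
      w y = (D i).w (c i) y ∧ w.symm y = ((D i).w (c i)).symm y := by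
  classical
  suffices H : ∀ s : Finset I, ∃ w ∈ coxeterGroup E,
      (∀ i ∈ s, ∀ y ∈ U i, w y = (D i).w (c i) y ∧ w.symm y = ((D i).w (c i)).symm y) ∧
      ∀ i ∉ s, ∀ y ∈ U i, w y = y ∧ w.symm y = y by
    obtain ⟨w, hw, h, _⟩ := H Finset.univ
    exact ⟨w, hw, fun i => h i (Finset.mem_univ i)⟩
  have hfix : ∀ i j, i ≠ j → ∀ y ∈ U j, (D i).w (c i) y = y ∧ ((D i).w (c i)).symm y = y := by
    intro i j hij y hy
    have h1 : (D i).w (c i) y = y := (D i).map_eq (c i) y ((hU hij).symm hy)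
    exact ⟨h1, ((D i).w (c i)).symm_apply_eq.2 h1.symm⟩
  intro s
  induction s using Finset.induction_on with
  | empty => exact ⟨1, Subgroup.one_mem _, by simp, fun i _ y _ => ⟨rfl, rfl⟩⟩
  | insert i s hi ih =>
    obtain ⟨w, hw, h1, h2⟩ := ih
    have hFE : (F i : Set V) ⊆ E := fun e he => hE ▸ Set.mem_iUnion.2 ⟨i, he⟩
    have hmem : (D i).w (c i) ∈ coxeterGroup E := coxeterGroup_mono hFE ((D i).w_mem (c i))
    refine ⟨(D i).w (c i) * w, Subgroup.mul_mem _ hmem hw,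
      fun j hj y hy => ?_, fun j hj y hy => ?_⟩
    · change (D i).w (c i) (w y) = _ ∧ w.symm (((D i).w (c i)).symm y) = _
      rcases Finset.mem_insert.1 hj with rfl | hj
      · rw [(h2 j hi y hy).1, (h2 j hi _ ((D j).symm_mem (c j) y hy)).2]
        exact ⟨rfl, rfl⟩
      · have hij : i ≠ j := fun h => hi (h ▸ hj)
        rw [(h1 j hj y hy).1, (hfix i j hij y hy).2, (h1 j hj y hy).2,
          (hfix i j hij _ ((D j).map_mem (c j) y hy)).1]
        exact ⟨rfl, rfl⟩
    · change (D i).w (c i) (w y) = _ ∧ w.symm (((D i).w (c i)).symm y) = _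
      have hij : i ≠ j := fun h => hj (h ▸ Finset.mem_insert_self i s)
      have hjs : j ∉ s := fun h => hj (Finset.mem_insert_of_mem h)
      rw [(h2 j hjs y hy).1, (hfix i j hij y hy).2, (h2 j hjs y hy).2, (hfix i j hij y hy).1]
      exact ⟨rfl, rfl⟩

/-- Chambers are indexed by families of group elements, one per factor, and each is carried back to
the base chamber. The integer `σ` is the sign of the reference chamber of the factors relative to
`T₀`. -/
theorem pizza_prod_eq (hU : Pairwise fun i j => U i ⟂ U j)
    (D : ∀ i, ReflectionFactor (U i) (F i)) {E : Set V} (hE : E = ⋃ i, (F i : Set V))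
    {T₀ : Set V} (hT₀ : IsChamber E T₀) {C : Set (Set V)} (hC : IsAdmissible C) (a : V) {K : Set V}
    (hK : ∀ w ∈ coxeterGroup E, w '' K = K) [Fintype (∀ i, (D i).κ)] :
    ∃ σ : ℤ, ((∀ y ∈ T₀, ∀ i, ∀ e ∈ F i, 0 < ⟪e, (D i).base⟫ * ⟪e, y⟫) → σ = 1) ∧
      pizza C E T₀ ((fun x => x + a) '' K) = σ • ∑ c : ∀ i, (D i).κ, (∏ i, (D i).ε (c i)) •
        cls C (K ∩ {x | ∀ i, ∀ n ∈ (D i).walls, 0 ≤ ⟪n, x + (D i).w (c i) a⟫}) := by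
  classical
  choose w hwW hw using exists_prod_isometry hU D hE
  have memE : ∀ {e : V}, e ∈ E ↔ ∃ i, e ∈ F i := fun {e} => by rw [hE]; simp
  have hadj : ∀ (g : V ≃ₗᵢ[ℝ] V) (y x : V), ⟪y, g x⟫ = ⟪g.symm y, x⟫ := fun g y x => by
    rw [← g.inner_map_map (g.symm y) x, g.apply_symm_apply]
  have hadj' : ∀ (g : V ≃ₗᵢ[ℝ] V) (y x : V), ⟪y, g.symm x⟫ = ⟪g y, x⟫ := fun g y x => by
    rw [← g.inner_map_map y (g.symm x), g.apply_symm_apply]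
  have hwin : ∀ c i, ∀ y ∈ U i, ∀ x, ⟪y, w c x⟫ = ⟪y, (D i).w (c i) x⟫ := fun c i y hy x => by
    rw [hadj, hadj, (hw c i y hy).2]
  let x₀ : V := ∑ i, (D i).base
  have hbase : ∀ i, ∀ y ∈ U i, ⟪y, x₀⟫ = ⟪y, (D i).base⟫ := fun i y hy => by
    simp only [x₀, inner_sum]
    refine Finset.sum_eq_single i (fun j _ hji => ?_) (by simp)
    exact (hU hji.symm).inner_eq hy (D j).base_mem
  have hx₀ : x₀ ∈ arrComplement E := fun e he => by
    obtain ⟨i, hi⟩ := memE.1 he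
    rw [hbase i e ((D i).root_mem e hi)]
    exact (D i).base_ne e hi
  have hroot : ∀ c, ∀ e ∈ E, (w c e ∈ E ∨ -(w c e) ∈ E) ∧
      ((w c).symm e ∈ E ∨ -((w c).symm e) ∈ E) := fun c e he => by
    obtain ⟨i, hi⟩ := memE.1 he
    obtain ⟨h1, h2⟩ := hw c i e ((D i).root_mem e hi)
    rw [h1, h2]
    exact ⟨((D i).map_root (c i) e hi).imp (fun h => memE.2 ⟨i, h⟩) fun h => memE.2 ⟨i, h⟩,
      ((D i).symm_root (c i) e hi).imp (fun h => memE.2 ⟨i, h⟩) fun h => memE.2 ⟨i, h⟩⟩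
  have hside : ∀ c x y, y ∈ sameSide E ((w c).symm x) ↔ w c y ∈ sameSide E x := by
    intro c x y
    constructor
    · intro h e he
      rw [hadj]
      rcases (hroot c e he).2 with h1 | h1
      · have := h _ h1
        rwa [hadj', (w c).apply_symm_apply] at this
      · have := h _ h1
        rw [hadj', map_neg, (w c).apply_symm_apply] at this
        simpa using this
    · intro h e he
      rw [hadj']
      rcases (hroot c e he).1 with h1 | h1
      · have := h _ h1
        rwa [(w c).inner_map_map] at this
      · have := h _ h1
        rw [inner_neg_left, inner_neg_left, (w c).inner_map_map] at this
        simpa using this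
  have hbaseside : ∀ c x, w c x ∈ sameSide E x₀ ↔
      ∀ i, ∀ e ∈ F i, 0 < ⟪e, (D i).base⟫ * ⟪e, (D i).w (c i) x⟫ := by
    intro c x
    constructor
    · intro h i e he
      have := h e (memE.2 ⟨i, he⟩)
      rwa [hbase i e ((D i).root_mem e he), hwin c i e ((D i).root_mem e he)] at this
    · intro h e he
      obtain ⟨i, hi⟩ := memE.1 he
      rw [hbase i e ((D i).root_mem e hi), hwin c i e ((D i).root_mem e hi)]
      exact h i e hi
  let X : (∀ i, (D i).κ) → V := fun c => (w c).symm x₀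
  have hX : ∀ c, X c ∈ arrComplement E := fun c e he h0 => by
    simp only [X] at h0
    rw [hadj'] at h0
    rcases (hroot c e he).1 with h1 | h1
    · exact hx₀ _ h1 h0
    · exact hx₀ _ h1 (by rw [inner_neg_left, h0, neg_zero])
  -- Simple transitivity on chambers: a regular point is moved to the base chamber by exactly one
  -- element in each factor.
  have hbij : Set.BijOn (fun c => sameSide E (X c)) Set.univ {T | IsChamber E T} := by
    refine ⟨fun c _ => isChamber_iff.2 ⟨_, hX c, rfl⟩, fun c _ c' _ hcc => ?_, fun T hT => ?_⟩
    · have h1 : X c ∈ sameSide E (X c') := by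
        change sameSide E (X c) = sameSide E (X c') at hcc
        rw [← hcc]; exact mem_sameSide_self (hX c)
      have h2 := (hbaseside c' (X c)).1 ((hside _ _ _).1 h1)
      have h3 := (hbaseside c (X c)).1 ((hside _ _ _).1 (mem_sameSide_self (hX c)))
      funext i
      exact ((D i).existsUnique (X c) fun e he => hX c e (memE.2 ⟨i, he⟩)).unique (h3 i) (h2 i)
    · obtain ⟨x, hx, rfl⟩ := isChamber_iff.1 hT
      choose c hc _ using fun i => (D i).existsUnique x fun e he => hx e (memE.2 ⟨i, he⟩)
      refine ⟨c, Set.mem_univ _, (sameSide_eq ?_).symm⟩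
      exact (hside _ _ _).2 ((hbaseside c x).2 hc)
  obtain ⟨y₀, hy₀, rfl⟩ := isChamber_iff.1 hT₀
  have hdisj : Set.PairwiseDisjoint (Finset.univ : Finset I) F := fun i _ j _ hij => by
    refine Finset.disjoint_left.2 fun e hi hj => ?_
    have h1 := (hU hij).inner_eq ((D i).root_mem e hi) ((D j).root_mem e hj)
    rw [inner_self_eq_zero] at h1
    exact (D i).base_ne e hi (by rw [h1, inner_zero_left])
  let EF : Finset V := Finset.univ.biUnion F
  have hEF : E = EF := by ext e; rw [memE]; simp [EF]
  refine ⟨SignType.sign (∏ e ∈ EF, ⟪e, x₀⟫ * ⟪e, y₀⟫), fun hpos => ?_, ?_⟩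
  · rw [sign_pos, SignType.coe_one]
    refine Finset.prod_pos fun e he => ?_
    obtain ⟨i, hi⟩ := memE.1 (hEF ▸ he : e ∈ E)
    rw [hbase i e ((D i).root_mem e hi)]
    exact hpos y₀ (mem_sameSide_self hy₀) i e hi
  rw [pizza, ← finsum_mem_eq_of_bijOn _ hbij (f := fun c =>
    ((-1 : ℤ) ^ (separating E (sameSide E (X c)) (sameSide E y₀)).ncard) •
      cls C (closure (sameSide E (X c)) ∩ (fun x => x + a) '' K)) fun c _ => rfl,
    finsum_mem_univ, finsum_eq_sum_of_fintype, Finset.smul_sum]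
  refine Finset.sum_congr rfl fun c _ => ?_
  have hsign : (-1 : ℤ) ^ (separating E (sameSide E (X c)) (sameSide E y₀)).ncard
      = SignType.sign (∏ e ∈ EF, ⟪e, x₀⟫ * ⟪e, y₀⟫) * ∏ i, (D i).ε (c i) := by
    have hprod : ∏ e ∈ EF, ⟪e, X c⟫ = (∏ i, ((D i).ε (c i) : ℝ)) * ∏ e ∈ EF, ⟪e, x₀⟫ := by
      simp only [EF]
      rw [Finset.prod_biUnion hdisj, Finset.prod_biUnion hdisj, ← Finset.prod_mul_distrib]
      refine Finset.prod_congr rfl fun i _ => ?_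
      rw [Finset.prod_congr rfl fun e he => show ⟪e, x₀⟫ = ⟪e, (D i).base⟫ from
          hbase i e ((D i).root_mem e he), ← (D i).prod_eq (c i)]
      refine Finset.prod_congr rfl fun e he => ?_
      have he' := (D i).root_mem e he
      rw [hadj', hadj', (hw c i e he').1, hbase i _ ((D i).map_mem (c i) e he')]
    rw [separating_sameSide (hX c) hy₀,
      show {e ∈ E | ⟪e, X c⟫ * ⟪e, y₀⟫ < 0}
        = (EF.filter fun e => ⟪e, X c⟫ * ⟪e, y₀⟫ < 0 : Set V) by ext e; simp [hEF],
      Set.ncard_coe_finset, neg_one_pow_card_filter EF _ fun e he =>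
        mul_ne_zero (hX c e (hEF ▸ he)) (hy₀ e (hEF ▸ he)),
      Finset.prod_mul_distrib, Finset.prod_mul_distrib, hprod, mul_assoc, sign_mul]
    have hε : ∀ i, ((SignType.sign ((D i).ε (c i) : ℝ) : SignType) : ℤ) = (D i).ε (c i) := fun i => by
      rcases (D i).sign_eq (c i) with h | h <;> rw [h] <;> simp
    have : ((SignType.sign (∏ i, ((D i).ε (c i) : ℝ)) : SignType) : ℤ) = ∏ i, (D i).ε (c i) := by
      rw [show SignType.sign (∏ i, ((D i).ε (c i) : ℝ))
        = ∏ i, SignType.sign ((D i).ε (c i) : ℝ) from map_prod signHom _ _]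
      have h2 := map_prod (SignType.castHom (α := ℤ)) (fun i => SignType.sign ((D i).ε (c i) : ℝ))
        Finset.univ
      simp only [SignType.castHom_apply] at h2
      rw [h2]
      exact Finset.prod_congr rfl fun i _ => hε i
    rw [SignType.coe_mul, this, mul_comm]
  rw [hsign, mul_smul]
  congr 2
  have hcl : ∀ y, w c y ∈ closure (sameSide E x₀) ↔ y ∈ closure (sameSide E (X c)) := by
    intro y
    have : w c '' sameSide E (X c) = sameSide E x₀ := by
      ext z
      constructor
      · rintro ⟨y, hy, rfl⟩; exact (hside _ _ _).1 hy
      · intro hz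
        exact ⟨(w c).symm z, (hside _ _ _).2 (by rwa [(w c).apply_symm_apply]),
          (w c).apply_symm_apply z⟩
    rw [← this, show (w c '' sameSide E (X c)) = (w c).toHomeomorph '' sameSide E (X c) from rfl,
      ← Homeomorph.image_closure]
    exact (w c).toHomeomorph.injective.mem_set_image
  have hwalls : ∀ x, x + w c a ∈ closure (sameSide E x₀) ↔
      ∀ i, ∀ n ∈ (D i).walls, 0 ≤ ⟪n, x + (D i).w (c i) a⟫ := by
    intro x
    rw [closure_sameSide hx₀]
    have : ∀ i, (∀ n ∈ (D i).walls, 0 ≤ ⟪n, x + (D i).w (c i) a⟫) ↔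
        ∀ e ∈ F i, 0 ≤ ⟪e, x₀⟫ * ⟪e, x + w c a⟫ := fun i => by
      rw [← (D i).walls_iff]
      refine forall₂_congr fun e he => ?_
      have he' := (D i).root_mem e he
      rw [hbase i e he', inner_add_right, inner_add_right, hwin c i e he']
    simp only [this, Set.mem_ofPred_eq, memE]
    exact ⟨fun h i e he => h e ⟨i, he⟩, fun h e ⟨i, he⟩ => h i e he⟩
  -- Both sets are moved to the base chamber intersected with `K + w c a`, using `w c '' K = K`.
  rw [← cls_image hC (w c).toAffineIsometryEquiv, ← cls_translate hC (K ∩ _) (w c a)]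
  congr 1
  ext z
  simp only [Set.mem_image, Set.mem_inter_iff, Set.mem_ofPred_eq,
    LinearIsometryEquiv.coe_toAffineIsometryEquiv, ← hwalls, ← hcl]
  constructor
  · rintro ⟨_, ⟨h1, x, hx, rfl⟩, rfl⟩
    refine ⟨w c x, ⟨?_, by rwa [map_add] at h1⟩, (map_add _ _ _).symm⟩
    rw [← hK (w c) (hwW c)]
    exact ⟨x, hx, rfl⟩
  · rintro ⟨x, ⟨hx, h1⟩, rfl⟩
    rw [← hK (w c) (hwW c)] at hx
    obtain ⟨x, hx, rfl⟩ := hx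
    exact ⟨x + a, ⟨by rwa [map_add], x, hx, rfl⟩, map_add _ _ _⟩

end Product

end Pizza

namespace Pizza

variable {V : Type*} [NormedAddCommGroup V] [InnerProductSpace ℝ V]

/-! ### Reflections and rank one factors -/

theorem reflection_apply_of_norm_eq_one {e : V} (he : ‖e‖ = 1) (x : V) :
    (ℝ ∙ e)ᗮ.reflection x = x - (2 * ⟪e, x⟫) • e := by
  rw [Submodule.reflection_orthogonal_apply, Submodule.reflection_singleton_apply, he]
  simp [mul_smul, two_smul]

theorem inner_reflection_left {e : V} (y x : V) :
    ⟪y, (ℝ ∙ e)ᗮ.reflection x⟫ = ⟪(ℝ ∙ e)ᗮ.reflection y, x⟫ := by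
  rw [← (ℝ ∙ e)ᗮ.reflection.inner_map_map y, Submodule.reflection_reflection]

theorem reflection_mem_coxeterGroup {E : Set V} {e : V} (he : e ∈ E ∨ -e ∈ E) :
    (ℝ ∙ e)ᗮ.reflection ∈ coxeterGroup E := by
  rcases he with he | he
  · exact Subgroup.subset_closure ⟨e, he, rfl⟩
  · refine Subgroup.subset_closure ⟨-e, he, LinearIsometryEquiv.ext fun x => ?_⟩
    simp only [Submodule.reflection_orthogonal_apply, Submodule.reflection_singleton_apply,
      inner_neg_left, norm_neg, smul_neg, neg_div, neg_smul, neg_neg]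

theorem exists_lineFactor (U : Submodule ℝ V) (e : V) (heU : e ∈ U) (he : ‖e‖ = 1)
    (hU : ∀ y ∈ U, ∃ r : ℝ, y = r • e) :
    ∃ D : ReflectionFactor U {e}, D.base = e ∧ D.walls = {e} ∧
      (∀ (φ : ℝ → ℤ) (a : V), ∑ k, D.ε k * φ ⟪e, D.w k a⟫ = φ ⟪e, a⟫ - φ (-⟪e, a⟫)) ∧
      (∃ k, D.w k e = e) ∧ ∃ k, D.w k e = -e := by
  have hee : ⟪e, e⟫ = 1 := by rw [real_inner_self_eq_norm_sq, he, one_pow]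
  let R := (ℝ ∙ e)ᗮ.reflection
  have hRe : R e = -e := by
    simp only [R]
    rw [reflection_apply_of_norm_eq_one he, hee, mul_one, two_smul]; abel
  have hR : ∀ x, ⟪e, R x⟫ = -⟪e, x⟫ := fun x => by
    simp only [R] at hRe ⊢
    rw [inner_reflection_left, hRe, inner_neg_left]
  have hRU : ∀ y ∈ U, R y ∈ U := fun y hy => by
    simp only [R]
    rw [reflection_apply_of_norm_eq_one he]
    exact U.sub_mem hy (U.smul_mem _ heU)
  have hsymm : R.symm = R := Submodule.reflection_symm
  let D : ReflectionFactor U {e} :=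
    { κ := Bool
      w := fun b => if b then 1 else R
      ε := fun b => if b then 1 else -1
      base := e
      walls := {e}
      root_mem := by simpa using heU
      base_mem := heU
      walls_mem := by simpa using heU
      w_mem := by
        intro b
        cases b
        · exact reflection_mem_coxeterGroup (by simp)
        · exact Subgroup.one_mem _
      map_mem := by
        intro b y hy
        cases b
        · exact hRU y hy
        · exact hy
      symm_mem := by
        intro b y hy
        cases b
        · change R.symm y ∈ U
          rw [hsymm]; exact hRU y hy
        · exact hy
      map_eq := by
        intro b y hy
        cases b
        · change R y = y
          simp only [R]
          rw [reflection_apply_of_norm_eq_one he, Submodule.mem_orthogonal _ _ |>.1 hy e heU]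
          simp
        · rfl
      map_root := by
        intro b
        cases b
        · simp [hRe]
        · simp
      symm_root := by
        intro b
        cases b
        · simp [hsymm, hRe]
        · intro x hx
          exact Or.inl hx
      base_ne := by
        simp only [Finset.mem_singleton, forall_eq, hee]
        exact one_ne_zero
      existsUnique := by
        intro x hx
        have hx : ⟪e, x⟫ ≠ 0 := by simpa using hx
        rcases lt_or_gt_of_ne hx with h | h
        · refine ⟨false, by simp [he, hR, h], fun b hb => ?_⟩
          cases b
          · rfl
          · have : 0 < ⟪e, x⟫ := by simpa [he] using hb
            linarith
        · refine ⟨true, by simp [he, h], fun b hb => ?_⟩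
          cases b
          · have : 0 < -⟪e, x⟫ := by simpa [he, hR] using hb
            linarith
          · rfl
      sign_eq := by intro b; cases b <;> simp
      prod_eq := by
        intro b
        cases b
        · simp [hsymm, hRe]
        · simp only [Finset.prod_singleton, if_true, Int.cast_one, one_mul]
          rfl
      walls_iff := by simp [he]
      exists_neg := by
        intro b
        refine ⟨!b, fun y hy x => ?_⟩
        obtain ⟨r, rfl⟩ := hU y hy
        cases b <;> simp [inner_smul_left, hR]
      vanish := by
        intro o ho x a h
        obtain ⟨r, rfl⟩ := hU o ho
        have h1 := h true
        have h2 := h false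
        simp only [inner_smul_left, inner_add_right, if_true, RCLike.conj_to_real,
          LinearIsometryEquiv.coe_one, id, Bool.false_eq_true, if_false, hR, ← mul_add] at h1 h2
        simp only [Finset.mem_singleton, forall_eq, Fintype.sum_bool, if_true, Bool.false_eq_true,
          if_false, inner_add_right, LinearIsometryEquiv.coe_one, id, hR]
        -- Both values have the sign of the scalar `r`, so the two terms of opposite determinant
        -- cancel.
        have h3 : 0 ≤ ⟪e, x⟫ + ⟪e, a⟫ ↔ 0 ≤ ⟪e, x⟫ + -⟪e, a⟫ := by
          rcases mul_pos_iff.1 h1 with ⟨h3, h4⟩ | ⟨h3, h4⟩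
          · exact ⟨fun _ => ((pos_iff_pos_of_mul_pos h2).1 h3).le, fun _ => h4.le⟩
          · have h5 := (neg_iff_neg_of_mul_pos h2).1 h3
            exact ⟨fun h => absurd h (not_le.2 h4), fun h => absurd h (not_le.2 h5)⟩
        simp only [h3]
        ring }
  refine ⟨D, rfl, rfl, fun φ a => ?_, ⟨true, rfl⟩, ⟨false, hRe⟩⟩
  change ∑ k : Bool, _ = _
  rw [Fintype.sum_bool]
  change (1 : ℤ) * φ ⟪e, a⟫ + (-1 : ℤ) * φ ⟪e, R a⟫ = _
  rw [hR]
  simp [sub_eq_add_neg]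

/-! ### Dihedral factors -/

/-- The unit vector at angle `ψ` in the plane with orthonormal basis `u`, `v`. -/
def angleVec (u v : V) (ψ : ℝ) : V := Real.cos ψ • u + Real.sin ψ • v

theorem angleVec_add_int (u v : V) (ψ : ℝ) (n : ℤ) :
    angleVec u v (ψ + n * (2 * Real.pi)) = angleVec u v ψ := by
  simp only [angleVec, Real.cos_add_int_mul_two_pi, Real.sin_add_int_mul_two_pi]

section Plane

variable {u v : V}

theorem inner_angleVec (hu : ‖u‖ = 1) (hv : ‖v‖ = 1) (huv : ⟪u, v⟫ = 0) (ψ φ : ℝ) :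
    ⟪angleVec u v ψ, angleVec u v φ⟫ = Real.cos (ψ - φ) := by
  have hvu : ⟪v, u⟫ = 0 := by rw [real_inner_comm, huv]
  simp only [angleVec, inner_add_left, inner_add_right, inner_smul_left, inner_smul_right,
    RCLike.conj_to_real, huv, hvu, real_inner_self_eq_norm_sq, hu, hv, Real.cos_sub]
  ring

theorem norm_angleVec (hu : ‖u‖ = 1) (hv : ‖v‖ = 1) (huv : ⟪u, v⟫ = 0) (ψ : ℝ) :
    ‖angleVec u v ψ‖ = 1 := by
  have := inner_angleVec hu hv huv ψ ψ
  rw [real_inner_self_eq_norm_sq, sub_self, Real.cos_zero] at this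
  exact (pow_eq_one_iff_of_nonneg (norm_nonneg _) two_ne_zero).1 this

theorem reflection_angleVec (hu : ‖u‖ = 1) (hv : ‖v‖ = 1) (huv : ⟪u, v⟫ = 0) (φ ψ : ℝ) :
    (ℝ ∙ angleVec u v φ)ᗮ.reflection (angleVec u v ψ) = angleVec u v (2 * φ + Real.pi - ψ) := by
  rw [reflection_apply_of_norm_eq_one (norm_angleVec hu hv huv φ), inner_angleVec hu hv huv]
  have h1 : Real.cos (2 * φ + Real.pi - ψ) = Real.cos ψ - 2 * Real.cos (φ - ψ) * Real.cos φ := by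
    rw [show 2 * φ + Real.pi - ψ = (φ - ψ) + φ + Real.pi by ring, Real.cos_add_pi,
      Real.cos_add (φ - ψ) φ]
    nth_rewrite 3 [show ψ = φ - (φ - ψ) by ring]
    rw [Real.cos_sub φ (φ - ψ)]
    ring
  have h2 : Real.sin (2 * φ + Real.pi - ψ) = Real.sin ψ - 2 * Real.cos (φ - ψ) * Real.sin φ := by
    rw [show 2 * φ + Real.pi - ψ = (φ - ψ) + φ + Real.pi by ring, Real.sin_add_pi,
      Real.sin_add (φ - ψ) φ]
    nth_rewrite 3 [show ψ = φ - (φ - ψ) by ring]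
    rw [Real.sin_sub φ (φ - ψ)]
    ring
  simp only [angleVec, h1, h2]
  module

/-- Polar coordinates of the projection to a plane. -/
theorem exists_polar (u v x : V) :
    ∃ r θ : ℝ, 0 ≤ r ∧ ∀ ψ, ⟪angleVec u v ψ, x⟫ = r * Real.cos (θ - ψ) := by
  let z : ℂ := ⟨⟪u, x⟫, ⟪v, x⟫⟩
  refine ⟨‖z‖, z.arg, norm_nonneg _, fun ψ => ?_⟩
  have h1 := Complex.norm_mul_cos_arg z
  have h2 := Complex.norm_mul_sin_arg z
  simp only [angleVec, inner_add_left, inner_smul_left, RCLike.conj_to_real, Real.cos_sub]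
  have h3 : ⟪u, x⟫ = ‖z‖ * Real.cos z.arg := h1.symm
  have h4 : ⟪v, x⟫ = ‖z‖ * Real.sin z.arg := h2.symm
  rw [h3, h4]; ring

end Plane

/-- The sign of the cosine is constant on the sectors of angle `π / 2m`. -/
theorem exists_sign_cos {m : ℕ} (hm : 0 < m) (j : ℤ) : ∃ σ : ℝ, ∀ φ : ℝ,
    (j * Real.pi / (2 * m) ≤ φ → φ ≤ (j + 1) * Real.pi / (2 * m) → 0 ≤ σ * Real.cos φ) ∧
    (j * Real.pi / (2 * m) < φ → φ < (j + 1) * Real.pi / (2 * m) → 0 < σ * Real.cos φ) := by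
  have hm' : (0 : ℝ) < m := by exact_mod_cast hm
  -- The zeros of the cosine are multiples of `π / 2m`, because `π / 2` is `m` of them. Here `q`
  -- counts the half-periods before the sector, and `(-1) ^ q` is the required sign.
  let q := (j + m) / (2 * m)
  have h1 := Int.emod_add_mul_ediv (j + m) (2 * m)
  have h2 := Int.emod_nonneg (j + m) (show (2 * m : ℤ) ≠ 0 by positivity)
  have h3 := Int.emod_lt_of_pos (j + m) (show (0 : ℤ) < 2 * m by positivity)
  have hlo : (q : ℝ) * (2 * m) ≤ j + m := by
    have : q * (2 * m) ≤ j + m := by simp only [q]; linarith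
    exact_mod_cast this
  have hhi : (j : ℝ) + m + 1 ≤ q * (2 * m) + 2 * m := by
    have : j + m + 1 ≤ q * (2 * m) + 2 * m := by simp only [q]; linarith
    exact_mod_cast this
  have hcos : ∀ φ : ℝ, (-1 : ℝ) ^ q * Real.cos φ = Real.sin (φ + Real.pi / 2 - q * Real.pi) := by
    intro φ
    rw [Real.sin_sub_int_mul_pi, Real.sin_add_pi_div_two]
  have hlo' : (0 : ℝ) ≤ j * Real.pi / (2 * m) + Real.pi / 2 - q * Real.pi := by
    have : j * Real.pi / (2 * m) + Real.pi / 2 - q * Real.pi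
      = (j + m - q * (2 * m)) * Real.pi / (2 * m) := by field_simp
    rw [this]
    have := Real.pi_pos
    have : (0 : ℝ) ≤ j + m - q * (2 * m) := by linarith
    positivity
  have hhi' : (j + 1) * Real.pi / (2 * m) + Real.pi / 2 - q * Real.pi ≤ Real.pi := by
    have : (j + 1) * Real.pi / (2 * m) + Real.pi / 2 - q * Real.pi
      = Real.pi - (q * (2 * m) + 2 * m - (j + m + 1)) * Real.pi / (2 * m) := by field_simp; ring
    rw [this]
    have := Real.pi_pos
    have h5 : (0 : ℝ) ≤ q * (2 * m) + 2 * m - (j + m + 1) := by linarith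
    have : 0 ≤ (q * (2 * m) + 2 * m - (j + m + 1)) * Real.pi / (2 * m) := by positivity
    linarith
  refine ⟨(-1) ^ q, fun φ => ⟨fun ha hb => ?_, fun ha hb => ?_⟩⟩
  · rw [hcos]
    exact Real.sin_nonneg_of_nonneg_of_le_pi (by linarith) (by linarith)
  · rw [hcos]
    exact Real.sin_pos_of_pos_of_lt_pi (by linarith) (by linarith)

theorem exists_angle_mem_sector {δ θ : ℝ} (hδ : 0 < δ) (hδ' : δ < Real.pi)
    (h1 : 0 ≤ Real.sin θ) (h2 : 0 ≤ Real.sin (δ - θ)) :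
    ∃ n : ℤ, 0 ≤ θ + n * (2 * Real.pi) ∧ θ + n * (2 * Real.pi) ≤ δ := by
  have hπ := Real.pi_pos
  obtain ⟨n, hn⟩ : ∃ n : ℤ, toIcoMod (show 0 < 2 * Real.pi by linarith) 0 θ
      = θ + n * (2 * Real.pi) := ⟨-toIcoDiv (show 0 < 2 * Real.pi by linarith) 0 θ, by
    rw [toIcoMod, zsmul_eq_mul]; push_cast; ring⟩
  have hmem := toIcoMod_mem_Ico (show 0 < 2 * Real.pi by linarith) 0 θ
  rw [hn] at hmem
  obtain ⟨ha, hb⟩ := hmem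
  refine ⟨n, ha, ?_⟩
  set t := θ + n * (2 * Real.pi) with ht
  have e1 : Real.sin t = Real.sin θ := Real.sin_add_int_mul_two_pi θ n
  have e2 : Real.sin (δ - t) = Real.sin (δ - θ) := by
    rw [ht, ← sub_sub, Real.sin_sub_int_mul_two_pi]
  have htπ : t ≤ Real.pi := by
    by_contra! hc
    have : Real.sin (t - Real.pi) > 0 := Real.sin_pos_of_pos_of_lt_pi (by linarith) (by linarith)
    rw [Real.sin_sub_pi, e1] at this
    linarith
  by_contra! hc
  have : Real.sin (δ - t) < 0 := Real.sin_neg_of_neg_of_neg_pi_lt (by linarith) (by linarith)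
  linarith

/-- `∏ cos (θ - kπ/n)` changes sign under `θ ↦ θ + π/n`. -/
theorem prod_cos_add {n : ℕ} (hn : 0 < n) (θ : ℝ) :
    ∏ k ∈ Finset.range n, Real.cos (θ + Real.pi / n - k * Real.pi / n)
      = -∏ k ∈ Finset.range n, Real.cos (θ - k * Real.pi / n) := by
  obtain ⟨n, rfl⟩ : ∃ n', n = n' + 1 := ⟨n - 1, by omega⟩
  -- The shift permutes the factors cyclically; only the one that wraps around changes, by an angle
  -- `π` and hence a sign.
  rw [Finset.prod_range_succ', Finset.prod_range_succ]
  have hn' : ((n + 1 : ℕ) : ℝ) ≠ 0 := by positivity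
  have h1 : ∀ k ∈ Finset.range n, Real.cos (θ + Real.pi / (n + 1 : ℕ)
      - (k + 1 : ℕ) * Real.pi / (n + 1 : ℕ)) = Real.cos (θ - k * Real.pi / (n + 1 : ℕ)) := by
    intro k _
    congr 1; push_cast; ring
  rw [Finset.prod_congr rfl h1, ← mul_neg, ← Real.cos_add_pi]
  congr 2
  field_simp
  push_cast
  ring

theorem prod_cos_add_nat {n : ℕ} (hn : 0 < n) (θ : ℝ) (c : ℕ) :
    ∏ k ∈ Finset.range n, Real.cos (θ + c * Real.pi / n - k * Real.pi / n)
      = (-1) ^ c * ∏ k ∈ Finset.range n, Real.cos (θ - k * Real.pi / n) := by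
  induction c with
  | zero => simp
  | succ c ih =>
    rw [pow_succ, mul_right_comm, ← ih, mul_neg_one, ← prod_cos_add hn]
    refine Finset.prod_congr rfl fun k _ => ?_
    congr 1; push_cast; ring

theorem sum_range_shift {M : Type*} [AddCommGroup M] {N : ℕ} (G : ℕ → M)
    (hG : ∀ l, G (l + N) = G l) (c : ℕ) :
    ∑ l ∈ Finset.range N, G (l + c) = ∑ l ∈ Finset.range N, G l := by
  induction c with
  | zero => rfl
  | succ c ih =>
    rw [← ih]
    have h1 := Finset.sum_range_succ (fun l => G (l + c)) N
    have h2 := Finset.sum_range_succ' (fun l => G (l + c)) N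
    rw [h1] at h2
    simp only [zero_add, add_comm N c, hG, add_right_comm _ 1 c] at h2
    exact (add_right_cancel h2).symm

end Pizza

/-! ### Angles and signed sums over the dihedral group of order `4m` -/

namespace Pizza

variable {V : Type*} [NormedAddCommGroup V] [InnerProductSpace ℝ V]

section Angles

variable {m : ℕ} {δ : ℝ}

theorem cos_sub_wall_left (hδ : 2 * m * δ = Real.pi) (φ : ℝ) :
    Real.cos (φ - (m : ℤ) * δ) = Real.sin φ := by
  rw [← Real.cos_sub_pi_div_two]
  congr 1
  push_cast
  linarith

theorem cos_sub_wall_right (hδ : 2 * m * δ = Real.pi) (φ : ℝ) :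
    Real.cos (φ - (1 - m : ℤ) * δ) = Real.sin (δ - φ) := by
  rw [← Real.cos_pi_div_two_sub]
  congr 1
  push_cast
  linarith

/-- The roots `j = m` and `j = 1 - m` are the inward normals of the sector `[0, δ]`. All other root
inequalities follow, since no root changes sign inside the sector. -/
theorem closed_sector_iff (hm : 0 < m) (hδ : 2 * m * δ = Real.pi) (hδ0 : 0 < δ)
    (hδπ : δ < Real.pi) (φ : ℝ) :
    (∀ j : ℤ, 0 ≤ Real.cos (δ / 2 - j * δ) * Real.cos (φ - j * δ)) ↔
      0 ≤ Real.sin φ ∧ 0 ≤ Real.sin (δ - φ) := by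
  have hs : 0 < Real.sin (δ / 2) := Real.sin_pos_of_pos_of_lt_pi (by linarith) (by linarith)
  constructor
  · intro h
    constructor
    · have := h m
      rw [cos_sub_wall_left hδ, cos_sub_wall_left hδ] at this
      exact nonneg_of_mul_nonneg_right this hs
    · have := h (1 - m)
      rw [cos_sub_wall_right hδ, cos_sub_wall_right hδ,
        show δ - δ / 2 = δ / 2 by ring] at this
      exact nonneg_of_mul_nonneg_right this hs
  · rintro ⟨h1, h2⟩ j
    obtain ⟨n, ha, hb⟩ := exists_angle_mem_sector hδ0 hδπ h1 h2
    obtain ⟨σ, hσ⟩ := exists_sign_cos hm (-j)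
    have hm' : (m : ℝ) ≠ 0 := by positivity
    have e1 : ((-j : ℤ) : ℝ) * Real.pi / (2 * m) = -(j * δ) := by
      rw [← hδ]; push_cast; field_simp
    have e2 : (((-j : ℤ) : ℝ) + 1) * Real.pi / (2 * m) = δ - j * δ := by
      rw [← hδ]; push_cast; field_simp; ring
    rw [e1, e2] at hσ
    have h3 := (hσ (φ + n * (2 * Real.pi) - j * δ)).1 (by linarith) (by linarith)
    have h4 := (hσ (δ / 2 - j * δ)).2 (by linarith) (by linarith)
    rw [add_sub_right_comm, Real.cos_add_int_mul_two_pi] at h3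
    have h5 : 0 < σ * σ := mul_self_pos.2 fun h => by simp [h] at h4
    have h6 := mul_nonneg h4.le h3
    rw [mul_mul_mul_comm] at h6
    exact nonneg_of_mul_nonneg_right h6 h5

theorem open_sector_iff (hm : 0 < m) (hδ : 2 * m * δ = Real.pi) (hδ0 : 0 < δ)
    (hδπ : δ < Real.pi) (φ : ℝ) :
    (∀ j : ℤ, 0 < Real.cos (δ / 2 - j * δ) * Real.cos (φ - j * δ)) ↔
      ∃ n : ℤ, 0 < φ + n * (2 * Real.pi) ∧ φ + n * (2 * Real.pi) < δ := by
  have hs : 0 < Real.sin (δ / 2) := Real.sin_pos_of_pos_of_lt_pi (by linarith) (by linarith)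
  constructor
  · intro h
    obtain ⟨h1, h2⟩ := (closed_sector_iff hm hδ hδ0 hδπ φ).1 fun j => (h j).le
    obtain ⟨n, ha, hb⟩ := exists_angle_mem_sector hδ0 hδπ h1 h2
    refine ⟨n, lt_of_le_of_ne ha fun h0 => ?_, lt_of_le_of_ne hb fun h0 => ?_⟩
    · have := h m
      rw [cos_sub_wall_left hδ, cos_sub_wall_left hδ,
        ← Real.sin_add_int_mul_two_pi φ n, ← h0, Real.sin_zero, mul_zero] at this
      exact lt_irrefl _ this
    · have := h (1 - m)
      rw [cos_sub_wall_right hδ, cos_sub_wall_right hδ,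
        ← Real.sin_sub_int_mul_two_pi (δ - φ) n, sub_sub, h0, sub_self, Real.sin_zero,
        mul_zero] at this
      exact lt_irrefl _ this
  · rintro ⟨n, ha, hb⟩ j
    obtain ⟨σ, hσ⟩ := exists_sign_cos hm (-j)
    have hm' : (m : ℝ) ≠ 0 := by positivity
    have e1 : ((-j : ℤ) : ℝ) * Real.pi / (2 * m) = -(j * δ) := by
      rw [← hδ]; push_cast; field_simp
    have e2 : (((-j : ℤ) : ℝ) + 1) * Real.pi / (2 * m) = δ - j * δ := by
      rw [← hδ]; push_cast; field_simp; ring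
    rw [e1, e2] at hσ
    have h3 := (hσ (φ + n * (2 * Real.pi) - j * δ)).2 (by linarith) (by linarith)
    have h4 := (hσ (δ / 2 - j * δ)).2 (by linarith) (by linarith)
    rw [add_sub_right_comm, Real.cos_add_int_mul_two_pi] at h3
    have h5 : 0 < σ * σ := mul_self_pos.2 fun h => by simp [h] at h4
    have h6 := mul_pos h4 h3
    rw [mul_mul_mul_comm] at h6
    exact (pos_iff_pos_of_mul_pos h6).1 h5

/-- The angle of the image of a vector at angle `θ` under an element of the dihedral group. -/
def dihAngle (δ θ : ℝ) (k : Fin (2 * m) × Bool) : ℝ :=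
  if k.2 then θ - 2 * (k.1 : ℕ) * δ else 2 * (k.1 : ℕ) * δ - θ

/-- A regular angle lies within less than `δ` of a unique even multiple `2iδ`. The residue of `i`
modulo `2m` gives the index, and the side on which the angle lies decides between rotation and
reflection. -/
theorem existsUnique_dihAngle (hm : 0 < m) (hδ : 2 * m * δ = Real.pi) (hδ0 : 0 < δ)
    (hδπ : δ < Real.pi) (θ : ℝ) (hθ : ∀ j : ℤ, Real.cos (θ - j * δ) ≠ 0) :
    ∃! k : Fin (2 * m) × Bool, ∀ j : ℤ,
      0 < Real.cos (δ / 2 - j * δ) * Real.cos (dihAngle δ θ k - j * δ) := by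
  simp only [open_sector_iff hm hδ hδ0 hδπ]
  have hne : ∀ i : ℤ, θ ≠ i * δ := fun i hi => hθ (i - m) (by
    rw [hi]
    push_cast
    rw [show (i : ℝ) * δ - (i - m) * δ = Real.pi / 2 by linarith, Real.cos_pi_div_two])
  apply existsUnique_of_exists_of_unique
  · let i : ℤ := round (θ / (2 * δ))
    have hi : |θ / (2 * δ) - i| ≤ 1 / 2 := abs_sub_round _
    have hi2 : |θ - 2 * i * δ| ≤ δ := by
      have : θ - 2 * i * δ = (θ / (2 * δ) - i) * (2 * δ) := by field_simp
      rw [this, abs_mul, abs_of_pos (show 0 < 2 * δ by linarith)]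
      nlinarith
    obtain ⟨hi3, hi4⟩ := abs_le.1 hi2
    have hi5 : θ - 2 * i * δ < δ := lt_of_le_of_ne hi4 fun h => hne (2 * i + 1) (by
      push_cast; linarith)
    have hi6 : -δ < θ - 2 * i * δ := lt_of_le_of_ne hi3 fun h => hne (2 * i - 1) (by
      push_cast; linarith)
    have h2m : (0 : ℤ) < 2 * m := by positivity
    have hmod := Int.emod_nonneg i h2m.ne'
    have hlt := Int.emod_lt_of_pos i h2m
    let l : Fin (2 * m) := ⟨(i % (2 * m)).toNat, by omega⟩
    have hl : ((l : ℕ) : ℝ) = i - 2 * m * (i / (2 * m) : ℤ) := by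
      have h1 : ((l : ℕ) : ℤ) = i % (2 * m) := Int.toNat_of_nonneg hmod
      have h2 := Int.emod_add_mul_ediv i (2 * m)
      have h3 : ((l : ℕ) : ℤ) = i - 2 * m * (i / (2 * m)) := by rw [h1]; linarith
      exact_mod_cast h3
    have hlδ : 2 * ((l : ℕ) : ℝ) * δ = 2 * i * δ - (i / (2 * m) : ℤ) * (2 * Real.pi) := by
      rw [hl, ← hδ]; ring
    rcases lt_or_gt_of_ne (fun h => hne (2 * i) (by push_cast; linarith) :
      θ - 2 * i * δ ≠ 0) with h | h
    · refine ⟨(l, false), (i / (2 * m) : ℤ), ?_, ?_⟩ <;>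
      · simp only [dihAngle, Bool.false_eq_true, if_false]
        linarith
    · refine ⟨(l, true), -(i / (2 * m) : ℤ), ?_, ?_⟩ <;>
      · simp only [dihAngle, if_true, Int.cast_neg]
        linarith
  · have key : ∀ k : Fin (2 * m) × Bool, (∃ n : ℤ, 0 < dihAngle δ θ k + n * (2 * Real.pi) ∧
        dihAngle δ θ k + n * (2 * Real.pi) < δ) → ∃ (n : ℤ) (t : ℝ), |t| < δ ∧
        θ = 2 * ((k.1 : ℕ) + 2 * m * n) * δ + t ∧ (k.2 = true ↔ 0 < t) := by
      rintro ⟨l, b⟩ ⟨n, h1, h2⟩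
      cases b
      · simp only [dihAngle, Bool.false_eq_true, if_false, ← hδ] at h1 h2
        refine ⟨n, θ - 2 * ((l : ℕ) + 2 * m * n) * δ, ?_, by ring, ?_⟩
        · rw [abs_lt]; constructor <;> linarith
        · simp only [Bool.false_eq_true, false_iff, not_lt]; linarith
      · simp only [dihAngle, if_true, ← hδ] at h1 h2
        refine ⟨-n, θ - 2 * ((l : ℕ) + 2 * m * (-n : ℤ)) * δ, ?_, by push_cast; ring, ?_⟩
        · push_cast; rw [abs_lt]; constructor <;> linarith
        · simp only [true_iff]; push_cast; linarith
    rintro k k' hk hk'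
    obtain ⟨n, t, ht, h1, h2⟩ := key k hk
    obtain ⟨n', t', ht', h1', h2'⟩ := key k' hk'
    have hz : (((k.1 : ℕ) + 2 * m * n - (k'.1 : ℕ) - 2 * m * n' : ℤ) : ℝ) * (2 * δ) = t' - t := by
      push_cast; linarith
    have hz0 : ((k.1 : ℕ) + 2 * m * n - (k'.1 : ℕ) - 2 * m * n' : ℤ) = 0 := by
      have hb : |t' - t| < 2 * δ := (abs_sub _ _).trans_lt (by linarith)
      rw [← hz, abs_mul, abs_of_pos (show 0 < 2 * δ by linarith)] at hb
      have : |(((k.1 : ℕ) + 2 * m * n - (k'.1 : ℕ) - 2 * m * n' : ℤ) : ℝ)| < 1 := by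
        by_contra! hc
        nlinarith
      rw [← Int.cast_abs] at this
      exact Int.abs_lt_one_iff.1 (by exact_mod_cast this)
    rw [hz0] at hz
    have htt : t' = t := by push_cast at hz; linarith
    have hl : k.1 = k'.1 := by
      have hk1 := k.1.2
      have hk2 := k'.1.2
      have h3 : ((k.1 : ℕ) : ℤ) - (k'.1 : ℕ) = 2 * m * (n' - n) := by linarith
      have h4 : n' - n = 0 := by
        by_contra hc
        rcases lt_or_gt_of_ne hc with hc | hc
        · nlinarith
        · nlinarith
      rw [h4, mul_zero] at h3
      ext; omega
    have hb : k.2 = k'.2 := by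
      rw [Bool.eq_iff_iff, h2, h2', htt]
    exact Prod.ext hl hb

theorem sum_dih {M : Type*} [AddCommGroup M] (G : Bool → ℕ → M) :
    ∑ k : Fin (2 * m) × Bool, (if k.2 then (1 : ℤ) else -1) • G k.2 k.1
      = ∑ l ∈ Finset.range (2 * m), G true l - ∑ l ∈ Finset.range (2 * m), G false l := by
  rw [Fintype.sum_prod_type, ← Finset.sum_sub_distrib,
    Finset.sum_range (fun l => G true l - G false l)]
  refine Finset.sum_congr rfl fun l _ => ?_
  simp [sub_eq_add_neg]

/-- With an even number of lines, the direction orthogonal to a root is again a root. Reflection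
along it preserves the coordinate and reverses the sign: rotation `l` cancels reflection `l + m`, by
`sin (π - x) = sin x`. -/
theorem sum_dih_left (hδ : 2 * m * δ = Real.pi) (r α : ℝ) (φ : ℝ → ℝ) :
    ∑ k : Fin (2 * m) × Bool, ((if k.2 then (1 : ℤ) else -1 : ℤ) : ℝ)
      * φ (r * Real.sin (dihAngle δ α k)) = 0 := by
  have := sum_dih (m := m) fun b l => φ (r * Real.sin (if b then α - 2 * l * δ else 2 * l * δ - α))
  simp only [zsmul_eq_mul, if_true, Bool.false_eq_true, if_false] at this
  rw [show ∑ k : Fin (2 * m) × Bool, ((if k.2 then (1 : ℤ) else -1 : ℤ) : ℝ)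
      * φ (r * Real.sin (dihAngle δ α k)) = _ from this, sub_eq_zero,
    ← sum_range_shift (fun l : ℕ => φ (r * Real.sin (2 * l * δ - α))) (N := 2 * m) (fun l => by
      congr 2
      rw [← Real.sin_add_two_pi (2 * l * δ - α)]
      congr 1; push_cast; linarith) m]
  refine Finset.sum_congr rfl fun l _ => ?_
  rw [← Real.sin_pi_sub]
  congr 3
  push_cast; linarith

/-- The same cancellation for the other wall; here reflection `l` is matched with rotation `l + m -
1`. -/
theorem sum_dih_right (hm : 0 < m) (hδ : 2 * m * δ = Real.pi) (r α : ℝ) (φ : ℝ → ℝ) :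
    ∑ k : Fin (2 * m) × Bool, ((if k.2 then (1 : ℤ) else -1 : ℤ) : ℝ)
      * φ (r * Real.sin (δ - dihAngle δ α k)) = 0 := by
  have := sum_dih (m := m) fun b l =>
    φ (r * Real.sin (δ - if b then α - 2 * l * δ else 2 * l * δ - α))
  simp only [zsmul_eq_mul, if_true, Bool.false_eq_true, if_false] at this
  rw [show ∑ k : Fin (2 * m) × Bool, ((if k.2 then (1 : ℤ) else -1 : ℤ) : ℝ)
      * φ (r * Real.sin (δ - dihAngle δ α k)) = _ from this, sub_eq_zero,
    ← sum_range_shift (fun l : ℕ => φ (r * Real.sin (δ - (α - 2 * l * δ)))) (N := 2 * m)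
      (fun l => by
        congr 2
        rw [← Real.sin_add_two_pi (δ - (α - 2 * l * δ))]
        congr 1; push_cast; linarith) (m - 1)]
  refine Finset.sum_congr rfl fun l _ => ?_
  rw [← Real.sin_pi_sub]
  congr 3
  push_cast [Nat.cast_sub (show 1 ≤ m from hm)]; linarith

/-- Pairing rotation and reflection of the same index leaves a multiple of `∑ sin (2 (α - 2lδ))`, a
sum over equally spaced angles with step `2π / m`. It telescopes after multiplication by `2 sin 2δ`.
-/
theorem sum_dih_mul (hm : 2 ≤ m) (hδ : 2 * m * δ = Real.pi) (r α : ℝ) :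
    ∑ k : Fin (2 * m) × Bool, ((if k.2 then (1 : ℤ) else -1 : ℤ) : ℝ)
      * ((r * Real.sin (δ - dihAngle δ α k)) * (r * Real.sin (dihAngle δ α k))) = 0 := by
  have := sum_dih (m := m) fun b l =>
    (r * Real.sin (δ - if b then α - 2 * l * δ else 2 * l * δ - α))
      * (r * Real.sin (if b then α - 2 * l * δ else 2 * l * δ - α))
  simp only [zsmul_eq_mul, if_true, Bool.false_eq_true, if_false] at this
  rw [show ∑ k : Fin (2 * m) × Bool, ((if k.2 then (1 : ℤ) else -1 : ℤ) : ℝ)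
      * ((r * Real.sin (δ - dihAngle δ α k)) * (r * Real.sin (dihAngle δ α k))) = _ from this,
    ← Finset.sum_sub_distrib]
  have hm' : (2 : ℝ) ≤ m := by exact_mod_cast hm
  have hπ := Real.pi_pos
  have hδ0 : 0 < δ := by
    by_contra! hc
    nlinarith
  -- This needs `m ≥ 2`: for `m = 1` the angle `2δ` is `π`.
  have hs : 0 < Real.sin (2 * δ) :=
    Real.sin_pos_of_pos_of_lt_pi (by linarith) (by nlinarith)
  have htel := Finset.sum_range_sub' (fun l : ℕ => Real.cos (2 * α + 2 * δ - 4 * l * δ)) (2 * m)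
  rw [show Real.cos (2 * α + 2 * δ - 4 * ((2 * m : ℕ) : ℝ) * δ)
      = Real.cos (2 * α + 2 * δ - 4 * ((0 : ℕ) : ℝ) * δ) by
    rw [← Real.cos_sub_int_mul_two_pi (2 * α + 2 * δ - 4 * ((0 : ℕ) : ℝ) * δ) 2]
    congr 1; push_cast; linarith, sub_self] at htel
  have h0 : ∑ l ∈ Finset.range (2 * m), Real.sin (2 * (α - 2 * l * δ)) = 0 := by
    have h1 : ∀ l : ℕ, Real.cos (2 * α + 2 * δ - 4 * l * δ)
        - Real.cos (2 * α + 2 * δ - 4 * (l + 1 : ℕ) * δ)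
        = -(2 * Real.sin (2 * δ)) * Real.sin (2 * (α - 2 * l * δ)) := fun l => by
      rw [show 2 * α + 2 * δ - 4 * l * δ = 2 * (α - 2 * l * δ) + 2 * δ by ring,
        show 2 * α + 2 * δ - 4 * (l + 1 : ℕ) * δ = 2 * (α - 2 * l * δ) - 2 * δ by
          push_cast; ring, Real.cos_add, Real.cos_sub]
      ring
    simp only [h1, ← Finset.mul_sum] at htel
    exact (mul_eq_zero.1 htel).resolve_left (by linarith)
  have h1 : ∀ l : ℕ, r * Real.sin (δ - (α - 2 * l * δ)) * (r * Real.sin (α - 2 * l * δ))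
      - r * Real.sin (δ - (2 * l * δ - α)) * (r * Real.sin (2 * l * δ - α))
      = (r ^ 2 * Real.sin δ) * Real.sin (2 * (α - 2 * l * δ)) := fun l => by
    rw [show 2 * l * δ - α = -(α - 2 * l * δ) by ring]
    generalize α - 2 * l * δ = β
    rw [Real.sin_neg, Real.sin_two_mul, Real.sin_sub, Real.sin_sub, Real.cos_neg, Real.sin_neg]
    ring
  simp only [h1, ← Finset.mul_sum, h0, mul_zero]

end Angles

end Pizza

/-! ### Root systems and group elements in a plane -/

namespace Pizza

variable {V : Type*} [NormedAddCommGroup V] [InnerProductSpace ℝ V]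

/-- `u`, `v` is an orthonormal basis of the plane `U`. -/
structure IsPlaneBasis (U : Submodule ℝ V) (u v : V) : Prop where
  left_mem : u ∈ U
  right_mem : v ∈ U
  norm_left : ‖u‖ = 1
  norm_right : ‖v‖ = 1
  inner_eq : ⟪u, v⟫ = 0
  exists_eq : ∀ y ∈ U, ∃ a b : ℝ, y = a • u + b • v

theorem IsPlaneBasis.of_finrank {U : Submodule ℝ V} (hU : Module.finrank ℝ U = 2) {u v : V}
    (hu : u ∈ U) (hv : v ∈ U) (hu1 : ‖u‖ = 1) (hv1 : ‖v‖ = 1) (huv : ⟪u, v⟫ = 0) :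
    IsPlaneBasis U u v := by
  refine ⟨hu, hv, hu1, hv1, huv, ?_⟩
  have hvu : ⟪v, u⟫ = 0 := by rw [real_inner_comm, huv]
  have hon : Orthonormal ℝ ![(⟨u, hu⟩ : U), ⟨v, hv⟩] := by
    rw [orthonormal_iff_ite]
    intro i j
    fin_cases i <;> fin_cases j <;> simp [huv, hvu, hu1, hv1]
  have : FiniteDimensional ℝ U := Module.finite_of_finrank_pos (by omega)
  have hspan := hon.linearIndependent.span_eq_top_of_card_eq_finrank (by simp [hU])
  intro y hy
  have h1 : (⟨y, hy⟩ : U) ∈ Submodule.span ℝ (Set.range ![(⟨u, hu⟩ : U), ⟨v, hv⟩]) := by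
    rw [hspan]; trivial
  rw [Matrix.range_cons, Matrix.range_cons, Matrix.range_empty, Set.union_empty,
    Set.singleton_union, Submodule.mem_span_pair] at h1
  obtain ⟨a, b, hab⟩ := h1
  exact ⟨a, b, by simpa using (congrArg Subtype.val hab).symm⟩

/-- The pseudo-roots `D ∪ (-D)` are the unit vectors at angles in `ℤδ`. -/
structure IsRootSystem (u v : V) (δ : ℝ) (D : Finset V) : Prop where
  exists_int : ∀ e ∈ D, ∃ j : ℤ, e = angleVec u v (j * δ)
  mem_or : ∀ j : ℤ, angleVec u v (j * δ) ∈ D ∨ -angleVec u v (j * δ) ∈ D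
  neg_notMem : ∀ e ∈ D, -e ∉ D

theorem IsDihedral.exists_isRootSystem {U : Submodule ℝ V} (hU : Module.finrank ℝ U = 2) {m : ℕ}
    (hm : 0 < m) {δ : ℝ} (hδ : 2 * m * δ = Real.pi) {D : Set V} (hD : IsDihedral U (2 * m) D) :
    ∃ (u v : V) (D' : Finset V), (D' : Set V) = D ∧ IsPlaneBasis U u v ∧ IsRootSystem u v δ D' := by
  obtain ⟨hneg, u, hu, v, hv, hu1, hv1, huv, hD⟩ := hD
  have hm' : (m : ℝ) ≠ 0 := by positivity
  have hang : ∀ k : ℝ, k * Real.pi / ((2 * m : ℕ) : ℝ) = k * δ := fun k => by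
    rw [← hδ]; push_cast; field_simp
  have hmem : ∀ x, (x ∈ D ∨ -x ∈ D) ↔ ∃ k : Fin (2 * (2 * m)), x = angleVec u v ((k : ℕ) * δ) := by
    intro x
    have := Set.ext_iff.1 hD x
    simp only [Set.mem_union, Set.mem_neg, Set.mem_ofPred_eq, hang] at this
    exact this
  have hfin : D.Finite := by
    refine (Set.finite_range fun k : Fin (2 * (2 * m)) => angleVec u v ((k : ℕ) * δ)).subset ?_
    intro x hx
    obtain ⟨k, hk⟩ := (hmem x).1 (Or.inl hx)
    exact ⟨k, hk.symm⟩
  refine ⟨u, v, hfin.toFinset, hfin.coe_toFinset, .of_finrank hU hu hv hu1 hv1 huv, ?_, ?_, ?_⟩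
  · intro e he
    obtain ⟨k, hk⟩ := (hmem e).1 (Or.inl (hfin.mem_toFinset.1 he))
    exact ⟨((k : ℕ) : ℤ), by simpa using hk⟩
  · intro j
    simp only [hfin.mem_toFinset]
    have h4m : (0 : ℤ) < 2 * (2 * m) := by positivity
    have h1 := Int.emod_nonneg j h4m.ne'
    have h2 := Int.emod_lt_of_pos j h4m
    refine (hmem _).2 ⟨⟨(j % (2 * (2 * m))).toNat, by omega⟩, ?_⟩
    have h3 : (((j % (2 * (2 * m))).toNat : ℕ) : ℤ) = j % (2 * (2 * m)) := Int.toNat_of_nonneg h1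
    have h4 : (((j % (2 * (2 * m))).toNat : ℕ) : ℤ)
        = j - 2 * (2 * m) * (j / (2 * (2 * m))) := by
      rw [h3]; linarith [Int.emod_add_mul_ediv j (2 * (2 * m))]
    have h5 : (((j % (2 * (2 * m))).toNat : ℕ) : ℝ)
        = j - 2 * (2 * m) * ((j / (2 * (2 * m)) : ℤ) : ℝ) := by exact_mod_cast h4
    simp only [h5]
    rw [← angleVec_add_int u v (j * δ) (-(j / (2 * (2 * m)))), ← hδ]
    congr 1
    push_cast
    ring
  · intro e he he'
    rw [hfin.mem_toFinset] at he he'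
    have : e ∈ D ∩ -D := ⟨he, he'⟩
    rwa [hneg] at this

/-- The elements of the dihedral group: rotations for `true`, reflections for `false`. -/
def dihIso (u v : V) (m : ℕ) (δ : ℝ) (k : Fin (2 * m) × Bool) : V ≃ₗᵢ[ℝ] V :=
  if k.2 then (ℝ ∙ angleVec u v (Real.pi / 2))ᗮ.reflection
      * (ℝ ∙ angleVec u v ((k.1 : ℕ) * δ + Real.pi / 2))ᗮ.reflection
    else (ℝ ∙ angleVec u v ((k.1 : ℕ) * δ + Real.pi / 2))ᗮ.reflection

section

variable {U : Submodule ℝ V} {u v : V} {m : ℕ} {δ : ℝ} (h : IsPlaneBasis U u v)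
include h

theorem IsPlaneBasis.reflection_eq (ψ α : ℝ) :
    (ℝ ∙ angleVec u v (α + Real.pi / 2))ᗮ.reflection (angleVec u v ψ)
      = angleVec u v (2 * α - ψ) := by
  rw [reflection_angleVec h.norm_left h.norm_right h.inner_eq,
    ← angleVec_add_int u v (2 * α - ψ) 1]
  congr 1; push_cast; ring

theorem IsPlaneBasis.reflection_eq_zero (ψ : ℝ) :
    (ℝ ∙ angleVec u v (Real.pi / 2))ᗮ.reflection (angleVec u v ψ) = angleVec u v (-ψ) := by
  simpa using h.reflection_eq ψ 0

theorem IsPlaneBasis.dihIso_angleVec (k : Fin (2 * m) × Bool) (ψ : ℝ) :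
    dihIso u v m δ k (angleVec u v ψ) = angleVec u v (dihAngle δ ψ k) := by
  obtain ⟨l, b⟩ := k
  cases b
  · simp only [dihIso, dihAngle, Bool.false_eq_true, if_false]
    rw [h.reflection_eq]
    congr 1; ring
  · simp only [dihIso, dihAngle, if_true, LinearIsometryEquiv.coe_mul, Function.comp]
    rw [h.reflection_eq, h.reflection_eq_zero]
    congr 1; ring

theorem IsPlaneBasis.dihIso_symm_angleVec (k : Fin (2 * m) × Bool) (ψ : ℝ) :
    (dihIso u v m δ k).symm (angleVec u v ψ)
      = angleVec u v (if k.2 then ψ + 2 * (k.1 : ℕ) * δ else 2 * (k.1 : ℕ) * δ - ψ) := by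
  rw [LinearIsometryEquiv.symm_apply_eq, h.dihIso_angleVec]
  congr 1
  obtain ⟨l, b⟩ := k
  cases b <;> simp [dihAngle]

theorem IsPlaneBasis.angleVec_mem (ψ : ℝ) : angleVec u v ψ ∈ U :=
  U.add_mem (U.smul_mem _ h.left_mem) (U.smul_mem _ h.right_mem)

theorem IsPlaneBasis.norm_eq (ψ : ℝ) : ‖angleVec u v ψ‖ = 1 :=
  norm_angleVec h.norm_left h.norm_right h.inner_eq ψ

theorem IsPlaneBasis.inner_dihIso {x : V} {r θ : ℝ}
    (hx : ∀ ψ, ⟪angleVec u v ψ, x⟫ = r * Real.cos (θ - ψ)) (k : Fin (2 * m) × Bool) (ψ : ℝ) :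
    ⟪angleVec u v ψ, dihIso u v m δ k x⟫ = r * Real.cos (dihAngle δ θ k - ψ) := by
  have hsymm : ⟪angleVec u v ψ, dihIso u v m δ k x⟫
      = ⟪(dihIso u v m δ k).symm (angleVec u v ψ), x⟫ := by
    rw [← (dihIso u v m δ k).inner_map_map ((dihIso u v m δ k).symm _) x,
      (dihIso u v m δ k).apply_symm_apply]
  rw [hsymm, h.dihIso_symm_angleVec, hx]
  congr 1
  obtain ⟨l, b⟩ := k
  cases b
  · simp only [dihAngle, Bool.false_eq_true, if_false]
    rw [← Real.cos_neg]; congr 1; ring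
  · simp only [dihAngle, if_true]
    congr 1; ring

theorem IsPlaneBasis.reflection_eq_self (ψ : ℝ) {y : V} (hy : y ∈ Uᗮ) :
    (ℝ ∙ angleVec u v ψ)ᗮ.reflection y = y := by
  rw [reflection_apply_of_norm_eq_one (h.norm_eq ψ),
    (Submodule.mem_orthogonal _ _).1 hy _ (h.angleVec_mem ψ)]
  simp

/-- Every vector of the plane is a combination of the two wall normals. -/
theorem IsPlaneBasis.exists_walls (hs : Real.sin δ ≠ 0) {y : V} (hy : y ∈ U) :
    ∃ a b : ℝ, y = a • angleVec u v (δ - Real.pi / 2) + b • angleVec u v (Real.pi / 2) := by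
  obtain ⟨a, b, rfl⟩ := h.exists_eq y hy
  refine ⟨a / Real.sin δ, b + a / Real.sin δ * Real.cos δ, ?_⟩
  simp only [angleVec, Real.cos_sub_pi_div_two, Real.sin_sub_pi_div_two, Real.cos_pi_div_two,
    Real.sin_pi_div_two]
  have : a = a / Real.sin δ * Real.sin δ := by field_simp
  nth_rewrite 1 [this]
  module

/-- The edges of the base chamber, at angles `0` and `δ`, are each orthogonal to one wall normal, so
they form the dual basis up to the factor `sin δ`. -/
theorem IsPlaneBasis.exists_dual (hs : Real.sin δ ≠ 0) (x y : ℝ) :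
    ∃ w ∈ U, ⟪angleVec u v (δ - Real.pi / 2), w⟫ = x ∧ ⟪angleVec u v (Real.pi / 2), w⟫ = y := by
  refine ⟨(x / Real.sin δ) • angleVec u v 0 + (y / Real.sin δ) • angleVec u v δ,
    U.add_mem (U.smul_mem _ (h.angleVec_mem _)) (U.smul_mem _ (h.angleVec_mem _)), ?_, ?_⟩
  · rw [inner_add_right, inner_smul_right, inner_smul_right,
      inner_angleVec h.norm_left h.norm_right h.inner_eq,
      inner_angleVec h.norm_left h.norm_right h.inner_eq, sub_zero, Real.cos_sub_pi_div_two,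
      show δ - Real.pi / 2 - δ = -(Real.pi / 2) by ring, Real.cos_neg, Real.cos_pi_div_two]
    field_simp; simp
  · rw [inner_add_right, inner_smul_right, inner_smul_right,
      inner_angleVec h.norm_left h.norm_right h.inner_eq,
      inner_angleVec h.norm_left h.norm_right h.inner_eq, sub_zero, Real.cos_pi_div_two,
      Real.cos_pi_div_two_sub]
    field_simp; simp

end

section

variable {u v : V} {δ : ℝ} {D : Finset V} (hD : IsRootSystem u v δ D)
include hD

theorem IsRootSystem.forall_iff (P : V → Prop) (hP : ∀ e, P e ↔ P (-e)) :
    (∀ e ∈ D, P e) ↔ ∀ j : ℤ, P (angleVec u v (j * δ)) := by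
  constructor
  · intro h j
    rcases hD.mem_or j with hj | hj
    · exact h _ hj
    · exact (hP _).2 (h _ hj)
  · intro h e he
    obtain ⟨j, rfl⟩ := hD.exists_int e he
    exact h j

/-- The arrangement contains one of each opposite pair of roots, and the angles `kδ` with `k < 2m`
meet each pair once; `τ` collects the resulting signs. -/
theorem IsRootSystem.exists_prod_eq {U : Submodule ℝ V} (h : IsPlaneBasis U u v) {m : ℕ}
    (hm : 0 < m) (hδ : 2 * m * δ = Real.pi) : ∃ τ : ℝ, ∀ x : V,
    ∏ e ∈ D, ⟪e, x⟫ = τ * ∏ k ∈ Finset.range (2 * m), ⟪angleVec u v (k * δ), x⟫ := by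
  classical
  let s : ℕ → ℝ := fun k => if angleVec u v (k * δ) ∈ D then 1 else -1
  have hs : ∀ k, s k • angleVec u v (k * δ) ∈ D := by
    intro k
    have := hD.mem_or k
    rw [Int.cast_natCast] at this
    simp only [s]
    split_ifs with h1
    · simpa using h1
    · simpa using this.resolve_left h1
  have hs2 : ∀ k, s k * s k = 1 := fun k => by simp only [s]; split_ifs <;> simp
  refine ⟨∏ k ∈ Finset.range (2 * m), s k, fun x => ?_⟩
  rw [← Finset.prod_mul_distrib]
  symm
  refine Finset.prod_bij (fun k _ => s k • angleVec u v (k * δ)) (fun k _ => hs k) ?_ ?_ ?_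
  · intro k hk k' hk' heq
    have h1 : s k * s k' * Real.cos (k * δ - k' * δ) = 1 := by
      rw [← inner_angleVec h.norm_left h.norm_right h.inner_eq]
      have h2 : ⟪s k • angleVec u v (k * δ), s k' • angleVec u v (k' * δ)⟫ = 1 := by
        rw [← heq, inner_smul_left, inner_smul_right,
          inner_angleVec h.norm_left h.norm_right h.inner_eq, sub_self, Real.cos_zero]
        simpa using hs2 k
      rw [inner_smul_left, inner_smul_right, RCLike.conj_to_real] at h2
      rw [mul_assoc, h2]
    have h3 : Real.sin (k * δ - k' * δ) = 0 := by
      have h4 : Real.cos (k * δ - k' * δ) ^ 2 = 1 := by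
        have := congrArg (fun z => z * z) h1
        have e : s k * s k' * Real.cos (k * δ - k' * δ) * (s k * s k' * Real.cos (k * δ - k' * δ))
          = (s k * s k) * (s k' * s k') * Real.cos (k * δ - k' * δ) ^ 2 := by ring
        rw [e, hs2, hs2] at this
        simpa using this
      have := Real.sin_sq_add_cos_sq (k * δ - k' * δ)
      rw [h4] at this
      have : Real.sin (k * δ - k' * δ) ^ 2 = 0 := by linarith
      exact pow_eq_zero_iff two_ne_zero |>.1 this
    obtain ⟨n, hn⟩ := Real.sin_eq_zero_iff.1 h3
    have hδ0 : δ ≠ 0 := by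
      rintro rfl
      have := Real.pi_pos
      simp at hδ
      linarith
    have h5 : (n * (2 * m) : ℝ) = k - k' := by
      rw [← hδ] at hn
      have : (n * (2 * m) : ℝ) * δ = (k - k') * δ := by linarith
      exact mul_right_cancel₀ hδ0 this
    have h6 : n * (2 * m) = (k : ℤ) - k' := by exact_mod_cast h5
    have hk1 := Finset.mem_range.1 hk
    have hk2 := Finset.mem_range.1 hk'
    have h7 : n = 0 := by
      by_contra hc
      rcases lt_or_gt_of_ne hc with hc | hc
      · nlinarith
      · nlinarith
    rw [h7, zero_mul] at h6
    omega
  · intro e he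
    obtain ⟨j, rfl⟩ := hD.exists_int e he
    have h2m : (0 : ℤ) < 2 * m := by positivity
    have h1 := Int.emod_nonneg j h2m.ne'
    have h2 := Int.emod_lt_of_pos j h2m
    let k := (j % (2 * m)).toNat
    have hk : (k : ℤ) = j % (2 * m) := Int.toNat_of_nonneg h1
    refine ⟨k, Finset.mem_range.2 (by omega), ?_⟩
    have hk2 : (k : ℤ) = j - 2 * m * (j / (2 * m)) := by
      rw [hk]; linarith [Int.emod_add_mul_ediv j (2 * m)]
    have hk3 : (k : ℝ) = j - 2 * m * ((j / (2 * m) : ℤ) : ℝ) := by exact_mod_cast hk2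
    have hang : (k : ℝ) * δ = j * δ - (j / (2 * m) : ℤ) * Real.pi := by rw [hk3, ← hδ]; ring
    have hor : angleVec u v (k * δ) = angleVec u v (j * δ)
        ∨ angleVec u v (k * δ) = -angleVec u v (j * δ) := by
      rw [hang]
      simp only [angleVec, Real.cos_sub_int_mul_pi, Real.sin_sub_int_mul_pi]
      rcases Int.even_or_odd (j / (2 * m)) with hev | hodd
      · left; rw [hev.neg_one_zpow]; simp
      · right; rw [hodd.neg_one_zpow]; simp; abel
    rcases hor with hor | hor
    · simp only [s, hor, he, if_true, one_smul]
    · simp only [s, hor, hD.neg_notMem _ he, if_false]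
      simp
  · intro k _
    rw [inner_smul_left, RCLike.conj_to_real]

end

end Pizza

/-! ### Construction of the dihedral factor -/

namespace Pizza

variable {V : Type*} [NormedAddCommGroup V] [InnerProductSpace ℝ V]

/-- On an open half-plane bounded by a line through the corner, the indicator of the quadrant is a
function of `A` plus a function of `B`. If both coefficients are positive, for instance, `A` and `B`
are never both negative, and it equals `1_A + 1_B - 1`. -/
theorem sum_sign_quadrant {κ : Type*} [Fintype κ] (ε : κ → ℤ) (A B : κ → ℝ)
    (hA : ∀ φ : ℝ → ℝ, ∑ k, ε k * φ (A k) = 0) (hB : ∀ φ : ℝ → ℝ, ∑ k, ε k * φ (B k) = 0)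
    (α β : ℝ) (h : ∀ k, 0 < α * A k + β * B k) :
    ∑ k, ε k * (if 0 ≤ A k ∧ 0 ≤ B k then 1 else 0) = 0 := by
  obtain ⟨c₁, c₂, c₃, hc⟩ : ∃ c₁ c₂ c₃ : ℝ, ∀ k, (if 0 ≤ A k ∧ 0 ≤ B k then (1 : ℝ) else 0)
      = c₁ * (if 0 ≤ A k then 1 else 0) + c₂ * (if 0 ≤ B k then 1 else 0) + c₃ := by
    rcases lt_or_ge 0 α with hα | hα <;> rcases lt_or_ge 0 β with hβ | hβ
    · refine ⟨1, 1, -1, fun k => ?_⟩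
      have := h k
      by_cases h1 : 0 ≤ A k <;> by_cases h2 : 0 ≤ B k
      · simp [h1, h2]
      · simp [h1, h2]
      · simp [h1, h2]
      · nlinarith
    · refine ⟨0, 1, 0, fun k => ?_⟩
      have := h k
      by_cases h1 : 0 ≤ A k <;> by_cases h2 : 0 ≤ B k
      · simp [h1, h2]
      · simp [h1, h2]
      · nlinarith
      · simp [h1, h2]
    · refine ⟨1, 0, 0, fun k => ?_⟩
      have := h k
      by_cases h1 : 0 ≤ A k <;> by_cases h2 : 0 ≤ B k
      · simp [h1, h2]
      · nlinarith
      · simp [h1, h2]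
      · simp [h1, h2]
    · refine ⟨0, 0, 0, fun k => ?_⟩
      have := h k
      by_cases h1 : 0 ≤ A k <;> by_cases h2 : 0 ≤ B k
      · nlinarith
      · simp [h2]
      · simp [h1]
      · simp [h1]
  have h1 := hA fun x => c₁ * (if 0 ≤ x then 1 else 0) + c₃
  have h2 := hB fun x => c₂ * (if 0 ≤ x then 1 else 0)
  have h3 : ∑ k, (ε k : ℝ) * (if 0 ≤ A k ∧ 0 ≤ B k then 1 else 0) = 0 := by
    refine Eq.trans ?_ ((congrArg₂ (· + ·) h1 h2).trans (add_zero 0))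
    rw [← Finset.sum_add_distrib]
    refine Finset.sum_congr rfl fun k _ => ?_
    rw [hc]; ring
  exact_mod_cast h3

theorem IsPlaneBasis.eq_angleVec {U : Submodule ℝ V} {u v : V} (h : IsPlaneBasis U u v) {y : V}
    (hy : y ∈ U) :
    ∃ a b : ℝ, y = a • angleVec u v 0 + b • angleVec u v (Real.pi / 2) := by
  obtain ⟨a, b, rfl⟩ := h.exists_eq y hy
  exact ⟨a, b, by simp [angleVec]⟩

/-- Since `2mδ = π`, the rotation by `π` belongs to the group; composing with it shifts the index by
`m`. -/
theorem IsPlaneBasis.exists_dihIso_neg {U : Submodule ℝ V} {u v : V} (h : IsPlaneBasis U u v)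
    {m : ℕ} {δ : ℝ} (hδ : 2 * m * δ = Real.pi) (k : Fin (2 * m) × Bool) :
    ∃ k' : Fin (2 * m) × Bool, ∀ y ∈ U, ∀ x,
      ⟪y, dihIso u v m δ k' x⟫ = -⟪y, dihIso u v m δ k x⟫ := by
  obtain ⟨l, b⟩ := k
  have hl := l.2
  obtain ⟨l', hl'⟩ : ∃ l' : Fin (2 * m), 2 * (l' : ℕ) * δ = 2 * (l : ℕ) * δ + Real.pi
      ∨ 2 * (l' : ℕ) * δ = 2 * (l : ℕ) * δ - Real.pi := by
    rcases lt_or_ge (l : ℕ) m with hlt | hge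
    · refine ⟨⟨l + m, by omega⟩, Or.inl ?_⟩
      rw [← hδ]; push_cast; ring
    · refine ⟨⟨l - m, by omega⟩, Or.inr ?_⟩
      rw [← hδ]; push_cast [hge]; ring
  refine ⟨(l', b), fun y hy x => ?_⟩
  obtain ⟨r, θ, _, hx⟩ := exists_polar u v x
  have key : ∀ ψ, Real.cos (dihAngle δ θ (l', b) - ψ) = -Real.cos (dihAngle δ θ (l, b) - ψ) := by
    intro ψ
    cases b <;> simp only [dihAngle, if_true, Bool.false_eq_true, if_false]
    · rcases hl' with hl' | hl' <;> rw [hl']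
      · rw [← Real.cos_add_pi]; congr 1; ring
      · rw [← Real.cos_sub_pi]; congr 1; ring
    · rcases hl' with hl' | hl' <;> rw [hl']
      · rw [← Real.cos_sub_pi]; congr 1; ring
      · rw [← Real.cos_add_pi]; congr 1; ring
  obtain ⟨a, b', rfl⟩ := h.eq_angleVec hy
  simp only [inner_add_left, inner_smul_left, h.inner_dihIso hx, key]
  ring

theorem IsRootSystem.dihIso_mem {u v : V} {m : ℕ} {δ : ℝ} {D : Finset V}
    (hD : IsRootSystem u v δ D) (hδ : 2 * m * δ = Real.pi) (k : Fin (2 * m) × Bool) :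
    dihIso u v m δ k ∈ coxeterGroup (D : Set V) := by
  have hr : ∀ l : ℕ, (ℝ ∙ angleVec u v (l * δ + Real.pi / 2))ᗮ.reflection
      ∈ coxeterGroup (D : Set V) := fun l => by
    refine reflection_mem_coxeterGroup ?_
    have := hD.mem_or (l + m)
    rwa [show ((l + m : ℤ) : ℝ) * δ = l * δ + Real.pi / 2 by push_cast; linarith] at this
  have h0 := hr 0
  simp only [Nat.cast_zero, zero_mul, zero_add] at h0
  unfold dihIso
  split_ifs
  · exact Subgroup.mul_mem _ h0 (hr _)
  · exact hr _

/-- The product of the roots changes sign at each step of `δ`. Rotations make an even number of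
steps from `δ / 2`, reflections an odd number. -/
theorem IsRootSystem.prod_dihIso_symm {U : Submodule ℝ V} {u v : V} (h : IsPlaneBasis U u v)
    {m : ℕ} (hm : 0 < m) {δ : ℝ} (hδ : 2 * m * δ = Real.pi) {D : Finset V}
    (hD : IsRootSystem u v δ D) (k : Fin (2 * m) × Bool) :
    ∏ e ∈ D, ⟪e, (dihIso u v m δ k).symm (angleVec u v (δ / 2))⟫
      = ((if k.2 then 1 else -1 : ℤ) : ℝ) * ∏ e ∈ D, ⟪e, angleVec u v (δ / 2)⟫ := by
  obtain ⟨τ, hτ⟩ := hD.exists_prod_eq h hm hδ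
  have hm' : (m : ℝ) ≠ 0 := by positivity
  have hang : δ = Real.pi / (2 * m : ℕ) := by rw [← hδ]; push_cast; field_simp
  have hQ : ∀ ψ, ∏ k ∈ Finset.range (2 * m), ⟪angleVec u v (k * δ), angleVec u v ψ⟫
      = ∏ k ∈ Finset.range (2 * m), Real.cos (ψ - k * Real.pi / (2 * m : ℕ)) := fun ψ => by
    refine Finset.prod_congr rfl fun k _ => ?_
    rw [inner_angleVec h.norm_left h.norm_right h.inner_eq, ← Real.cos_neg]
    congr 1
    rw [mul_div_assoc, ← hang]; ring
  have h2 : ∀ (ψ : ℝ) (l : ℕ), ψ + 2 * l * δ = ψ + (2 * l : ℕ) * Real.pi / (2 * m : ℕ) :=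
    fun ψ l => by rw [mul_div_assoc, ← hang]; push_cast; ring
  rw [h.dihIso_symm_angleVec, hτ, hτ, hQ, hQ]
  obtain ⟨l, b⟩ := k
  cases b
  · simp only [Bool.false_eq_true, if_false]
    have h3 := prod_cos_add (n := 2 * m) (by omega) (-(δ / 2))
    rw [show 2 * ((l : ℕ) : ℝ) * δ - δ / 2 = -(δ / 2) + 2 * ((l : ℕ) : ℝ) * δ by ring, h2,
      prod_cos_add_nat (by omega), pow_mul, neg_one_sq, one_pow, one_mul]
    rw [← hang, show -(δ / 2) + δ = δ / 2 by ring] at h3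
    rw [h3]; push_cast; ring
  · simp only [if_true]
    rw [h2, prod_cos_add_nat (by omega), pow_mul, neg_one_sq, one_pow, one_mul]
    push_cast; ring

theorem exists_dihedralFactor {U : Submodule ℝ V} {u v : V} (h : IsPlaneBasis U u v)
    {m : ℕ} (hm : 2 ≤ m) {δ : ℝ} (hδ : 2 * m * δ = Real.pi) {D : Finset V}
    (hD : IsRootSystem u v δ D) :
    ∃ F : ReflectionFactor U D, ∃ s ∈ U, ∃ t ∈ U, s ≠ t ∧ (∀ n, n ∈ F.walls ↔ n = s ∨ n = t) ∧
      (∀ x y : ℝ, ∃ w ∈ U, ⟪s, w⟫ = x ∧ ⟪t, w⟫ = y) ∧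
      ∀ a, (∀ φ : ℝ → ℝ, ∑ k, F.ε k * φ ⟪s, F.w k a⟫ = 0) ∧
        (∀ φ : ℝ → ℝ, ∑ k, F.ε k * φ ⟪t, F.w k a⟫ = 0) ∧
        ∑ k, F.ε k * (⟪s, F.w k a⟫ * ⟪t, F.w k a⟫) = 0 := by
  classical
  have hm0 : 0 < m := by omega
  have hπ := Real.pi_pos
  have hm2 : (2 : ℝ) ≤ m := by exact_mod_cast hm
  have hδ0 : 0 < δ := by
    by_contra! hc
    nlinarith [mul_nonneg (show (0 : ℝ) ≤ m by linarith) (neg_nonneg.2 hc)]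
  have hδπ : δ < Real.pi := by nlinarith
  have hs : Real.sin δ ≠ 0 := (Real.sin_pos_of_pos_of_lt_pi hδ0 hδπ).ne'
  -- The base chamber is the sector of angles from `0` to `δ`: `s` and `t` are its inward normals
  -- and `b` lies on its bisector.
  set s := angleVec u v (δ - Real.pi / 2) with hs_def
  set t := angleVec u v (Real.pi / 2) with ht_def
  set b := angleVec u v (δ / 2) with hb_def
  have hsU : s ∈ U := h.angleVec_mem _
  have htU : t ∈ U := h.angleVec_mem _
  have hin := inner_angleVec h.norm_left h.norm_right h.inner_eq
  have hbase : ∀ j : ℤ, ⟪angleVec u v (j * δ), b⟫ = Real.cos (δ / 2 - j * δ) := fun j => by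
    rw [hb_def, hin, ← Real.cos_neg]; congr 1; ring
  have hst : ∀ (x : V) (r θ : ℝ), (∀ ψ, ⟪angleVec u v ψ, x⟫ = r * Real.cos (θ - ψ)) →
      ⟪s, x⟫ = r * Real.sin (δ - θ) ∧ ⟪t, x⟫ = r * Real.sin θ := by
    intro x r θ hx
    rw [hs_def, ht_def, hx, hx, Real.cos_sub_pi_div_two]
    refine ⟨?_, rfl⟩
    rw [← Real.cos_pi_div_two_sub]
    congr 2; ring
  have hstw : ∀ (x : V) (r θ : ℝ), (∀ ψ, ⟪angleVec u v ψ, x⟫ = r * Real.cos (θ - ψ)) →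
      ∀ k : Fin (2 * m) × Bool, ⟪s, dihIso u v m δ k x⟫ = r * Real.sin (δ - dihAngle δ θ k)
        ∧ ⟪t, dihIso u v m δ k x⟫ = r * Real.sin (dihAngle δ θ k) :=
    fun x r θ hx k => hst _ r _ fun ψ => h.inner_dihIso hx k ψ
  let ε : Fin (2 * m) × Bool → ℤ := fun k => if k.2 then 1 else -1
  have hsumL : ∀ (a : V) (φ : ℝ → ℝ), ∑ k, (ε k : ℝ) * φ ⟪t, dihIso u v m δ k a⟫ = 0 := by
    intro a φ
    obtain ⟨r, θ, _, hx⟩ := exists_polar u v a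
    simp only [(hstw a r θ hx _).2]
    exact sum_dih_left hδ r θ φ
  have hsumR : ∀ (a : V) (φ : ℝ → ℝ), ∑ k, (ε k : ℝ) * φ ⟪s, dihIso u v m δ k a⟫ = 0 := by
    intro a φ
    obtain ⟨r, θ, _, hx⟩ := exists_polar u v a
    simp only [(hstw a r θ hx _).1]
    exact sum_dih_right hm0 hδ r θ φ
  have hpos : ∀ (x : V) (r θ : ℝ), (∀ ψ, ⟪angleVec u v ψ, x⟫ = r * Real.cos (θ - ψ)) →
      ((∀ e ∈ D, 0 < ⟪e, b⟫ * ⟪e, x⟫) ↔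
        ∀ j : ℤ, 0 < Real.cos (δ / 2 - j * δ) * (r * Real.cos (θ - j * δ))) := by
    intro x r θ hx
    rw [hD.forall_iff (fun e => 0 < ⟪e, b⟫ * ⟪e, x⟫) fun e => by simp [inner_neg_left]]
    simp only [hbase, hx]
  have hnonneg : ∀ (x : V) (r θ : ℝ), (∀ ψ, ⟪angleVec u v ψ, x⟫ = r * Real.cos (θ - ψ)) →
      ((∀ e ∈ D, 0 ≤ ⟪e, b⟫ * ⟪e, x⟫) ↔
        ∀ j : ℤ, 0 ≤ Real.cos (δ / 2 - j * δ) * (r * Real.cos (θ - j * δ))) := by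
    intro x r θ hx
    rw [hD.forall_iff (fun e => 0 ≤ ⟪e, b⟫ * ⟪e, x⟫) fun e => by simp [inner_neg_left]]
    simp only [hbase, hx]
  refine ⟨
    { κ := Fin (2 * m) × Bool
      w := dihIso u v m δ
      ε := ε
      base := b
      walls := {s, t}
      root_mem := fun e he => ?_
      base_mem := h.angleVec_mem _
      walls_mem := fun n hn => ?_
      w_mem := fun k => hD.dihIso_mem hδ k
      map_mem := fun k y hy => ?_
      symm_mem := fun k y hy => ?_
      map_eq := fun k y hy => ?_
      map_root := fun k e he => ?_
      symm_root := fun k e he => ?_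
      base_ne := fun e he => ?_
      existsUnique := fun x hx => ?_
      sign_eq := fun k => ?_
      prod_eq := fun k => hD.prod_dihIso_symm h hm0 hδ k
      walls_iff := fun x => ?_
      exists_neg := fun k => h.exists_dihIso_neg hδ k
      vanish := fun o ho x a hk => ?_ }, s, hsU, t, htU, fun hc => ?_, fun n => by simp,
    h.exists_dual hs, fun a => ⟨hsumR a, hsumL a, ?_⟩⟩
  · obtain ⟨j, rfl⟩ := hD.exists_int e he
    exact h.angleVec_mem _
  · rcases Finset.mem_insert.1 hn with rfl | hn
    · exact hsU
    · exact Finset.mem_singleton.1 hn ▸ htU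
  · obtain ⟨c, d, rfl⟩ := h.eq_angleVec hy
    rw [map_add, map_smul, map_smul, h.dihIso_angleVec, h.dihIso_angleVec]
    exact U.add_mem (U.smul_mem _ (h.angleVec_mem _)) (U.smul_mem _ (h.angleVec_mem _))
  · obtain ⟨c, d, rfl⟩ := h.eq_angleVec hy
    rw [map_add, map_smul, map_smul, h.dihIso_symm_angleVec, h.dihIso_symm_angleVec]
    exact U.add_mem (U.smul_mem _ (h.angleVec_mem _)) (U.smul_mem _ (h.angleVec_mem _))
  · unfold dihIso
    split_ifs
    · rw [LinearIsometryEquiv.coe_mul, Function.comp, h.reflection_eq_self _ hy,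
        h.reflection_eq_self _ hy]
    · exact h.reflection_eq_self _ hy
  · obtain ⟨j, rfl⟩ := hD.exists_int e he
    rw [h.dihIso_angleVec]
    unfold dihAngle
    split_ifs
    · have := hD.mem_or (j - 2 * (k.1 : ℕ))
      push_cast at this
      rwa [sub_mul] at this
    · have := hD.mem_or (2 * (k.1 : ℕ) - j)
      push_cast at this
      rwa [sub_mul] at this
  · obtain ⟨j, rfl⟩ := hD.exists_int e he
    rw [h.dihIso_symm_angleVec]
    split_ifs
    · have := hD.mem_or (j + 2 * (k.1 : ℕ))
      push_cast at this
      rwa [add_mul] at this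
    · have := hD.mem_or (2 * (k.1 : ℕ) - j)
      push_cast at this
      rwa [sub_mul] at this
  · obtain ⟨j, rfl⟩ := hD.exists_int e he
    rw [hbase]
    have := (open_sector_iff hm0 hδ hδ0 hδπ (δ / 2)).2 ⟨0, by simp; linarith, by simp; linarith⟩ j
    exact left_ne_zero_of_mul this.ne'
  · obtain ⟨r, θ, hr, hp⟩ := exists_polar u v x
    have hx' := (hD.forall_iff (fun e => ⟪e, x⟫ ≠ 0) fun e => by simp [inner_neg_left]).1 hx
    simp only [hp] at hx'
    have hr0 : 0 < r := lt_of_le_of_ne hr (left_ne_zero_of_mul (hx' 0)).symm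
    simp only [fun k => hpos (dihIso u v m δ k x) r _ fun ψ => h.inner_dihIso hp k ψ,
      mul_left_comm _ r, mul_pos_iff_of_pos_left hr0]
    exact existsUnique_dihAngle hm0 hδ hδ0 hδπ θ fun j => right_ne_zero_of_mul (hx' j)
  · simp only [ε]; split_ifs <;> simp
  · obtain ⟨r, θ, hr, hp⟩ := exists_polar u v x
    rw [hnonneg x r θ hp]
    simp only [Finset.mem_insert, Finset.mem_singleton, forall_eq_or_imp, forall_eq,
      (hst x r θ hp).1, (hst x r θ hp).2]
    rcases hr.eq_or_lt with rfl | hr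
    · simp
    · simp only [mul_left_comm _ r, mul_nonneg_iff_of_pos_left hr]
      rw [closed_sector_iff hm0 hδ hδ0 hδπ, and_comm]
  · obtain ⟨α, β, rfl⟩ := h.exists_walls hs ho
    have := sum_sign_quadrant ε (fun k => ⟪s, x + dihIso u v m δ k a⟫)
      (fun k => ⟪t, x + dihIso u v m δ k a⟫)
      (fun φ => by simpa only [inner_add_right] using hsumR a fun z => φ (⟪s, x⟫ + z))
      (fun φ => by simpa only [inner_add_right] using hsumL a fun z => φ (⟪t, x⟫ + z)) α β
      fun k => by
        have := hk k
        rwa [inner_add_left, inner_smul_left, inner_smul_left] at this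
    refine Eq.trans (Finset.sum_congr rfl fun k _ => ?_) this
    simp only [Finset.mem_insert, Finset.mem_singleton, forall_eq_or_imp, forall_eq]
  · have h1 : ⟪s, t⟫ = 1 := by rw [hc, real_inner_self_eq_norm_sq, h.norm_eq, one_pow]
    rw [hs_def, ht_def, hin, show δ - Real.pi / 2 - Real.pi / 2 = δ - Real.pi by ring,
      Real.cos_sub_pi] at h1
    have h2 := Real.sin_sq_add_cos_sq δ
    have h3 : Real.cos δ = -1 := by linarith
    rw [h3] at h2
    exact hs (pow_eq_zero_iff two_ne_zero |>.1 (by linarith))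
  · obtain ⟨r, θ, _, hx⟩ := exists_polar u v a
    simp only [(hstw a r θ hx _).1, (hstw a r θ hx _).2]
    exact sum_dih_mul hm hδ r θ

end Pizza

/-! ### The product function, its support, and the vanishing for a plane factor -/

namespace Pizza

variable {V : Type*} [NormedAddCommGroup V] [InnerProductSpace ℝ V]

theorem polyCls_eq_cls {C : Set (Set V)} (hC : IsAdmissible C) {A : Set V} (hA : A ∈ C)
    (g : polyFun V) (S : Finset (V × ℝ)) {B : Set V} (hB : ∀ x, x ∈ polyhedron S ↔ x ∈ B)
    (h1 : ∀ x ∈ B, (g : V → ℤ) x = 1) (h0 : ∀ x ∉ B, (g : V → ℤ) x = 0) :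
    polyCls hC hA g = cls C (A ∩ B) := by
  obtain rfl : polyhedron S = B := Set.ext hB
  rw [← polyCls_polyInd hC hA S]
  congr 1
  apply Subtype.ext
  ext x
  by_cases hx : x ∈ polyhedron S
  · rw [h1 x hx]; simp [polyInd, hx]
  · rw [h0 x hx]; simp [polyInd, hx]

theorem inner_map_right (g : V ≃ₗᵢ[ℝ] V) (y x : V) : ⟪y, g x⟫ = ⟪g.symm y, x⟫ := by
  rw [← g.inner_map_map (g.symm y) x, g.apply_symm_apply]

/-- The signed sum of the indicator functions of the closed base chamber translated by `-w a`. -/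
def ReflectionFactor.chamberFun {U : Submodule ℝ V} {E : Finset V} (D : ReflectionFactor U E)
    (a : V) : polyFun V :=
  ∑ k, D.ε k • ∏ n ∈ D.walls, halfInd n (-⟪n, D.w k a⟫)

open Classical in
theorem prod_halfInd_apply (S : Finset V) (y x : V) :
    ((∏ n ∈ S, halfInd n (-⟪n, y⟫) : polyFun V) : V → ℤ) x
      = if ∀ n ∈ S, 0 ≤ ⟪n, x + y⟫ then 1 else 0 := by
  simp only [SubmonoidClass.coe_finsetProd, Finset.prod_apply, halfInd_apply, inner_add_right,
    neg_le_iff_add_nonneg]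
  rw [Finset.prod_boole]

open Classical in
theorem ReflectionFactor.chamberFun_apply {U : Submodule ℝ V} {E : Finset V}
    (D : ReflectionFactor U E) (a x : V) : (D.chamberFun a : V → ℤ) x
      = ∑ k, D.ε k * (if ∀ n ∈ D.walls, 0 ≤ ⟪n, x + D.w k a⟫ then 1 else 0) := by
  simp only [chamberFun, AddSubmonoidClass.coe_finsetSum, Finset.sum_apply, SetLike.val_smul,
    Pi.smul_apply, prod_halfInd_apply, smul_eq_mul]

theorem ReflectionFactor.chamberFun_add {U : Submodule ℝ V} {E : Finset V}
    (D : ReflectionFactor U E) (a x : V) {v : V} (hv : ∀ y ∈ U, ⟪y, v⟫ = 0) :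
    (D.chamberFun a : V → ℤ) (x + v) = (D.chamberFun a : V → ℤ) x := by
  classical
  simp only [D.chamberFun_apply]
  refine Finset.sum_congr rfl fun k _ => ?_
  congr 2
  refine propext (forall₂_congr fun n hn => ?_)
  rw [add_right_comm, inner_add_right n (x + D.w k a) v, hv n (D.walls_mem n hn), add_zero]

section Product

variable {I : Type*} [Fintype I] {U : I → Submodule ℝ V} {F : I → Finset V}

theorem pizza_eq_polyCls (hU : Pairwise fun i j => U i ⟂ U j)
    (D : ∀ i, ReflectionFactor (U i) (F i)) {E : Set V} (hE : E = ⋃ i, (F i : Set V))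
    {T₀ : Set V} (hT₀ : IsChamber E T₀) {C : Set (Set V)} (hC : IsAdmissible C) (a : V) {K : Set V}
    (hKC : K ∈ C) (hK : ∀ w ∈ coxeterGroup E, w '' K = K) :
    ∃ σ : ℤ, ((∀ y ∈ T₀, ∀ i, ∀ e ∈ F i, 0 < ⟪e, (D i).base⟫ * ⟪e, y⟫) → σ = 1) ∧
      pizza C E T₀ ((fun x => x + a) '' K)
        = σ • polyCls hC hKC (∏ i, (D i).chamberFun a) := by
  classical
  obtain ⟨σ, h1, h2⟩ := pizza_prod_eq hU D hE hT₀ hC a hK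
  refine ⟨σ, h1, ?_⟩
  rw [h2]
  congr 1
  simp only [ReflectionFactor.chamberFun]
  rw [Finset.prod_univ_sum, Fintype.piFinset_univ, map_sum]
  refine Finset.sum_congr rfl fun c _ => ?_
  rw [Finset.prod_smul, map_smul]
  congr 1
  symm
  have hval : ∀ x, ((∏ i, ∏ n ∈ (D i).walls, halfInd n (-⟪n, (D i).w (c i) a⟫) : polyFun V) :
      V → ℤ) x = if ∀ i, ∀ n ∈ (D i).walls, 0 ≤ ⟪n, x + (D i).w (c i) a⟫ then 1 else 0 := fun x => by
    rw [SubmonoidClass.coe_finsetProd, Finset.prod_apply]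
    simp only [prod_halfInd_apply]
    rw [Finset.prod_boole]
    simp only [Finset.mem_univ, forall_true_left]
  refine polyCls_eq_cls hC hKC _ (Finset.univ.biUnion fun i => (D i).walls.image fun n =>
    (n, -⟪n, (D i).w (c i) a⟫)) (fun x => ?_) (fun x hx => ?_) (fun x hx => ?_)
  · simp only [polyhedron, Finset.mem_biUnion, Finset.mem_univ, true_and, Finset.mem_image,
      forall_exists_index, and_imp, Set.mem_ofPred_eq, inner_add_right]
    constructor
    · intro h i n hn
      have := h _ i n hn rfl
      linarith
    · rintro h _ i n hn rfl
      have := h i n hn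
      simp only
      linarith
  · rw [hval]; exact if_pos hx
  · rw [hval]; exact if_neg hx

/-- A point outside the hull is separated from it by a vector `ω`, which splits into components in
the factors. The hypothesis picks an element for each component, and its negative, available by
`exists_neg`, produces an orbit point on the wrong side. -/
theorem mem_convexHull_orbit [FiniteDimensional ℝ V] (hU : Pairwise fun i j => U i ⟂ U j)
    (hU_top : ⨆ i, U i = ⊤) (D : ∀ i, ReflectionFactor (U i) (F i)) {E : Set V}
    (hE : E = ⋃ i, (F i : Set V)) (a x : V)
    (hx : ∀ i, ∀ o ∈ U i, ∃ k, ⟪o, x + (D i).w k a⟫ ≤ 0) :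
    x ∈ convexHull ℝ {y | ∃ w ∈ coxeterGroup E, y = w a} := by
  classical
  choose w hwW hw using exists_prod_isometry hU D hE
  have hsub : Set.range (fun c => w c a) ⊆ {y | ∃ w ∈ coxeterGroup E, y = w a} := by
    rintro _ ⟨c, rfl⟩
    exact ⟨w c, hwW c, rfl⟩
  refine convexHull_mono hsub ?_
  by_contra hcon
  have : CompleteSpace V := FiniteDimensional.complete ℝ V
  obtain ⟨f, z, hf1, hf2⟩ := geometric_hahn_banach_closed_point (E := V) (convex_convexHull ℝ _)
    ((Set.finite_range fun c => w c a).isClosed_convexHull ℝ) hcon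
  have hω : ∀ y, f y = ⟪(InnerProductSpace.toDual ℝ V).symm f, y⟫ := fun y => by
    rw [InnerProductSpace.toDual_symm_apply]
  generalize (InnerProductSpace.toDual ℝ V).symm f = ω at hω
  have hωt : ω ∈ ⨆ i, U i := by rw [hU_top]; trivial
  obtain ⟨o, ho, hsum⟩ := (Submodule.mem_iSup_iff_exists_finsupp _ _).1 hωt
  rw [Finsupp.sum_fintype _ _ fun _ => rfl] at hsum
  choose k hk using fun i => hx i (o i) (ho i)
  choose k' hk' using fun i => (D i).exists_neg (k i)
  have h1 : ⟪ω, w k' a⟫ = -∑ i, ⟪o i, (D i).w (k i) a⟫ := by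
    rw [← hsum, sum_inner, ← Finset.sum_neg_distrib]
    refine Finset.sum_congr rfl fun i _ => ?_
    rw [← hk' i _ (ho i), inner_map_right, inner_map_right, (hw k' i _ (ho i)).2]
  have h2 : ⟪ω, x⟫ = ∑ i, ⟪o i, x⟫ := by rw [← hsum, sum_inner]
  have h3 : ∑ i, ⟪o i, x + (D i).w (k i) a⟫ ≤ 0 := Finset.sum_nonpos fun i _ => hk i
  simp only [inner_add_right, Finset.sum_add_distrib] at h3
  have h4 := hf1 _ (subset_convexHull ℝ _ ⟨k', rfl⟩)
  rw [hω] at h4 hf2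
  linarith

theorem mem_convexHull_of_prod_ne_zero [FiniteDimensional ℝ V]
    (hU : Pairwise fun i j => U i ⟂ U j)
    (hU_top : ⨆ i, U i = ⊤) (D : ∀ i, ReflectionFactor (U i) (F i)) {E : Set V}
    (hE : E = ⋃ i, (F i : Set V)) (a x : V)
    (hx : ∀ i, ((D i).chamberFun a : V → ℤ) x ≠ 0) :
    x ∈ convexHull ℝ {y | ∃ w ∈ coxeterGroup E, y = w a} := by
  classical
  refine mem_convexHull_orbit hU hU_top D hE a x fun i o ho => ?_
  by_contra! hc
  refine hx i ?_
  rw [(D i).chamberFun_apply]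
  exact (D i).vanish o ho x a hc

/-- With the other factors fixed as `f'`, the map `g ↦ polyCls (g * f')` is a planar valuation:
translations along `U p` do not change `f'`, and supports stay in `K`. The area argument then
applies to the plane function. -/
theorem polyCls_prod_eq_zero [FiniteDimensional ℝ V] (hU : Pairwise fun i j => U i ⟂ U j)
    (hU_top : ⨆ i, U i = ⊤) (D : ∀ i, ReflectionFactor (U i) (F i)) {E : Set V}
    (hE : E = ⋃ i, (F i : Set V)) {C : Set (Set V)} (hC : IsAdmissible C) (a : V) {K : Set V}
    (hKC : K ∈ C) (hK : convexHull ℝ {y | ∃ w ∈ coxeterGroup E, y = w a} ⊆ K) (p : I) {s t : V}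
    (hst : s ≠ t) (hwalls : ∀ n, n ∈ (D p).walls ↔ n = s ∨ n = t)
    (hdual : ∀ x y : ℝ, ∃ w ∈ U p, ⟪s, w⟫ = x ∧ ⟪t, w⟫ = y)
    (hs : ∀ φ : ℝ → ℝ, ∑ k, (D p).ε k * φ ⟪s, (D p).w k a⟫ = 0)
    (ht : ∀ φ : ℝ → ℝ, ∑ k, (D p).ε k * φ ⟪t, (D p).w k a⟫ = 0)
    (hmul : ∑ k, (D p).ε k * (⟪s, (D p).w k a⟫ * ⟪t, (D p).w k a⟫) = 0) :
    polyCls hC hKC (∏ i, (D i).chamberFun a) = 0 := by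
  classical
  let f' : polyFun V := ∏ i ∈ Finset.univ.erase p, (D i).chamberFun a
  let Ψ : polyFun V →+ DissectionGroup C :=
    (polyCls hC hKC).toAddMonoidHom.comp (AddMonoidHom.mulRight f')
  have hΨ : ∀ g, Ψ g = polyCls hC hKC (g * f') := fun g => rfl
  have hfun : (D p).chamberFun a = ∑ k, (D p).ε k •
      (halfInd s (-⟪s, (D p).w k a⟫) * halfInd t (-⟪t, (D p).w k a⟫)) := by
    have : (D p).walls = {s, t} := by ext n; simp [hwalls]
    unfold ReflectionFactor.chamberFun
    rw [this]
    simp only [Finset.prod_pair hst]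
  have hf'val : ∀ x, (f' : V → ℤ) x
      = ∏ i ∈ Finset.univ.erase p, ((D i).chamberFun a : V → ℤ) x := fun x => by
    simp only [f', SubmonoidClass.coe_finsetProd, Finset.prod_apply]
  have hmemK : ∀ g : polyFun V, (∀ x, (g : V → ℤ) x ≠ 0 → ((D p).chamberFun a : V → ℤ) x ≠ 0) →
      ∀ x, ((g * f' : polyFun V) : V → ℤ) x ≠ 0 → x ∈ K := by
    intro g hg x hx
    have hx' : (g : V → ℤ) x * (f' : V → ℤ) x ≠ 0 := hx
    have h1 := hg x (left_ne_zero_of_mul hx')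
    have h2 := right_ne_zero_of_mul hx'
    rw [hf'val, Finset.prod_ne_zero_iff] at h2
    refine hK (mem_convexHull_of_prod_ne_zero hU hU_top D hE a x fun i => ?_)
    by_cases hi : i = p
    · exact hi ▸ h1
    · exact h2 i (Finset.mem_erase.2 ⟨hi, Finset.mem_univ i⟩)
  have hinv : IsPlanarInvariant s t Ψ {x | ((D p).chamberFun a : V → ℤ) x ≠ 0} := by
    intro b c
    obtain ⟨v, hv, hvs, hvt⟩ := hdual b c
    refine ⟨v, hvs, hvt, fun g g' hg hsg hsg' => ?_⟩
    rw [hΨ, hΨ]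
    refine polyCls_translation_invariant hC hKC v _ _ (fun x => ?_) (hmemK g hsg) (hmemK g' hsg')
    change (g' : V → ℤ) x * (f' : V → ℤ) x = (g : V → ℤ) (x + v) * (f' : V → ℤ) (x + v)
    rw [hg, hf'val, hf'val]
    congr 1
    refine Finset.prod_congr rfl fun i hi => ?_
    exact ((D i).chamberFun_add a x fun y hy =>
      Submodule.IsOrtho.inner_eq (hU (Finset.ne_of_mem_erase hi)) hy hv).symm
  have := hinv.sum_eq_zero (D p).ε (fun k => -⟪s, (D p).w k a⟫) (fun k => -⟪t, (D p).w k a⟫)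
    (fun φ => hs fun z => φ (-z)) (fun φ => ht fun z => φ (-z))
    (by simpa only [neg_mul_neg] using hmul) (fun x hx => by rwa [← hfun] at hx)
  rw [← hfun, hΨ, Finset.mul_prod_erase _ (fun i => (D i).chamberFun a) (Finset.mem_univ p)] at this
  exact this

end Product

end Pizza

/-! ### Half-open boxes and products of lines -/

namespace Pizza

variable {V : Type*} [NormedAddCommGroup V] [InnerProductSpace ℝ V]

/-- Inclusion-exclusion for a set of the family minus finitely many hyperplanes. -/
theorem hasClass_diff_hyperplanes {C : Set (Set V)} (hC : IsAdmissible C) {ι : Type*}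
    [DecidableEq ι] (e : ι → V) (F : Finset ι) : ∀ A ∈ C, (0 : V) ∈ A →
    HasClass C (A \ {y | ∃ i ∈ F, ⟪e i, y⟫ = 0})
      (∑ S ∈ F.powerset, ((-1 : ℤ) ^ S.card) • cls C (A ∩ {y | ∀ i ∈ S, ⟪e i, y⟫ = 0})) := by
  induction F using Finset.induction_on with
  | empty =>
    intro A hA _
    simpa using HasClass.of A hA
  | insert i F hi ih =>
    intro A hA h0
    -- The point `0` keeps every intersection nonempty, so it lies in `C` itself and has a class by
    -- the rules.
    have hmem : A ∩ {y | ⟪e i, y⟫ = 0} ∈ C := by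
      refine (hC.inter_eq (Or.inr hA) (e i) 0).resolve_left ?_
      exact Set.Nonempty.ne_empty ⟨0, h0, inner_zero_right _⟩
    have h1 := ih _ hmem ⟨h0, inner_zero_right _⟩
    have h2 := HasClass.diff _ _ _ _ _ (ih A hA h0) (.of _ hmem)
      (by
        rw [show A \ {y | ∃ i ∈ F, ⟪e i, y⟫ = 0} ∩ (A ∩ {y | ⟪e i, y⟫ = 0})
          = (A ∩ {y | ⟪e i, y⟫ = 0}) \ {y | ∃ i ∈ F, ⟪e i, y⟫ = 0} by
            ext y; simp only [Set.mem_inter_iff, Set.mem_sdiff]; tauto]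
        exact h1)
    convert h2 using 1
    · ext y
      simp only [Set.mem_sdiff, Set.mem_ofPred_eq, Finset.exists_mem_insert, Set.mem_inter_iff]
      generalize (∃ x ∈ F, ⟪e x, y⟫ = 0) = p
      tauto
    · rw [Finset.sum_powerset_insert hi, sub_eq_add_neg, ← Finset.sum_neg_distrib]
      congr 1
      refine Finset.sum_congr rfl fun S hS => ?_
      have hiS : i ∉ S := fun h => hi (Finset.mem_powerset.1 hS h)
      rw [Finset.card_insert_of_notMem hiS, pow_succ, mul_neg_one, neg_smul]
      congr 3
      ext y
      simp only [Set.mem_inter_iff, Set.mem_ofPred_eq, Finset.forall_mem_insert]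
      tauto

section Lines

variable {r : ℕ} {e : Fin r → V}

theorem mem_prodSet_iff (he : Orthonormal ℝ e) (hspan : ∀ y, y = ∑ j, ⟪e j, y⟫ • e j)
    (S : Fin r → Set V) (hS : ∀ j, ∀ y ∈ S j, ∃ c : ℝ, y = c • e j) (y : V) :
    y ∈ prodSet S ↔ ∀ j, ⟪e j, y⟫ • e j ∈ S j := by
  classical
  constructor
  · rintro ⟨z, hz, rfl⟩ j
    choose c hc using fun j => hS j (z j) (hz j)
    have : ⟪e j, ∑ i, z i⟫ = c j := by
      simp_rw [hc]
      exact he.inner_right_fintype c j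
    rw [this, ← hc]
    exact hz j
  · intro h
    exact ⟨_, h, (hspan y).symm⟩

theorem smul_mem_segment_iff {e : V} (he : e ≠ 0) (c d : ℝ) :
    c • e ∈ segment ℝ 0 (d • e) ↔ ∃ θ : ℝ, 0 ≤ θ ∧ θ ≤ 1 ∧ c = θ * d := by
  rw [segment_eq_image]
  constructor
  · rintro ⟨θ, ⟨h0, h1⟩, h⟩
    refine ⟨θ, h0, h1, ?_⟩
    simp only [smul_zero, zero_add, smul_smul] at h
    exact (smul_left_injective ℝ he h).symm
  · rintro ⟨θ, h0, h1, rfl⟩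
    exact ⟨θ, ⟨h0, h1⟩, by simp [smul_smul]⟩

theorem eq_smul_of_mem_segment {e y : V} {d : ℝ} (hy : y ∈ segment ℝ 0 (d • e)) :
    ∃ c : ℝ, y = c • e := by
  rw [segment_eq_image] at hy
  obtain ⟨θ, _, rfl⟩ := hy
  exact ⟨θ * d, by simp [smul_smul]⟩

theorem exists_mul_eq_iff_abs_le {b τ x : ℝ} (hτ : τ * τ = 1) :
    (∃ θ : ℝ, 0 ≤ θ ∧ θ ≤ 1 ∧ b - τ * x = θ * (2 * b)) ↔ |x| ≤ |b| := by
  have hx : |τ * x| = |x| := by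
    have : |τ| = 1 := by
      have := abs_mul_abs_self τ
      rw [hτ] at this
      nlinarith [abs_nonneg τ]
    rw [abs_mul, this, one_mul]
  rw [← hx]
  generalize τ * x = z
  constructor
  · rintro ⟨θ, h0, h1, h⟩
    rw [show z = (1 - 2 * θ) * b by linarith, abs_mul]
    exact mul_le_of_le_one_left (abs_nonneg b) (abs_le.2 ⟨by linarith, by linarith⟩)
  · intro h
    by_cases hb : b = 0
    · subst hb
      rw [abs_zero, abs_nonpos_iff] at h
      exact ⟨0, le_rfl, zero_le_one, by simp [h]⟩
    · have h1 : |z / b| ≤ 1 := by rw [abs_div]; exact div_le_one_of_le₀ h (abs_nonneg b)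
      rw [abs_le] at h1
      refine ⟨(1 - z / b) / 2, by linarith [h1.2], by linarith [h1.1], ?_⟩
      field_simp

open Classical in
/-- The faces of the closed box `∏ [0, 2⟪a, e j⟫ e j]`, seen from its centre `a`. -/
def centredFace (e : Fin r → V) (a : V) (S : Finset (Fin r)) : Set V :=
  {x | ∀ j, if j ∈ S then ⟪e j, x⟫ = |⟪a, e j⟫| else |⟪e j, x⟫| ≤ |⟪a, e j⟫|}

theorem mem_boxFace_iff (he : Orthonormal ℝ e) (hspan : ∀ y, y = ∑ j, ⟪e j, y⟫ • e j) (a : V)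
    (S : Finset (Fin r)) (inst : ∀ j, Decidable (j ∈ S)) (y : V) :
    (y ∈ prodSet fun j => @ite _ (j ∈ S) (inst j) {0} (segment ℝ 0 ((2 * ⟪a, e j⟫) • e j))) ↔
      ∀ j, (j ∈ S → ⟪e j, y⟫ = 0) ∧
        (j ∉ S → ∃ θ : ℝ, 0 ≤ θ ∧ θ ≤ 1 ∧ ⟪e j, y⟫ = θ * (2 * ⟪a, e j⟫)) := by
  rw [mem_prodSet_iff he hspan]
  · refine forall_congr' fun j => ?_
    split_ifs with hj
    · simp [hj, he.ne_zero j]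
    · simp [hj, smul_mem_segment_iff (he.ne_zero j)]
  · intro j z hz
    split_ifs at hz
    · exact ⟨0, by simpa using hz⟩
    · exact eq_smul_of_mem_segment hz

/-- The map `x ↦ a - w x`, with `w` adjusting signs, sends the coordinate `z` to `b - τ z`, where
`τ` is the sign of `b = ⟪a, e j⟫`, taken as `1` at `b = 0`. So `|b|` goes to `0`, and `[-|b|, |b|]`
goes to the segment from `0` to `2b`. -/
theorem exists_boxIsometry (he : Orthonormal ℝ e) (hspan : ∀ y, y = ∑ j, ⟪e j, y⟫ • e j) (a : V)
    (w : V ≃ₗᵢ[ℝ] V) (hw : ∀ j, w.symm (e j) = (if 0 ≤ ⟪a, e j⟫ then (1 : ℝ) else -1) • e j) :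
    ∃ g : V ≃ᵃⁱ[ℝ] V, ∀ (S : Finset (Fin r)) (inst : ∀ j, Decidable (j ∈ S)),
      g '' centredFace e a S
        = prodSet fun j => @ite _ (j ∈ S) (inst j) {0} (segment ℝ 0 ((2 * ⟪a, e j⟫) • e j)) := by
  let g : V ≃ᵃⁱ[ℝ] V :=
    w.toAffineIsometryEquiv.trans (AffineIsometryEquiv.constVSub ℝ a)
  have hg : ∀ x, g x = a - w x := fun x => rfl
  refine ⟨g, fun S inst => ?_⟩
  have key : ∀ x, g x ∈ (prodSet fun j =>
      @ite _ (j ∈ S) (inst j) {0} (segment ℝ 0 ((2 * ⟪a, e j⟫) • e j))) ↔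
      x ∈ centredFace e a S := by
    intro x
    rw [mem_boxFace_iff he hspan]
    refine forall_congr' fun j => ?_
    have h1 : ⟪e j, g x⟫ = ⟪a, e j⟫ - (if 0 ≤ ⟪a, e j⟫ then (1 : ℝ) else -1) * ⟪e j, x⟫ := by
      rw [hg, inner_sub_right, inner_map_right, hw, inner_smul_left, real_inner_comm,
        RCLike.conj_to_real]
    have hτ : (if 0 ≤ ⟪a, e j⟫ then (1 : ℝ) else -1) * (if 0 ≤ ⟪a, e j⟫ then (1 : ℝ) else -1) = 1 :=
      by split_ifs <;> norm_num
    rw [h1]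
    by_cases hj : j ∈ S
    · simp only [hj, not_true_eq_false, false_implies, and_true, true_implies, if_true]
      split_ifs with hb
      · rw [abs_of_nonneg hb]; constructor <;> intro h <;> linarith
      · rw [abs_of_neg (not_le.1 hb)]; constructor <;> intro h <;> linarith
    · simp only [hj, not_false_eq_true, false_implies, true_and, true_implies, if_false]
      exact exists_mul_eq_iff_abs_le hτ
  ext y
  constructor
  · rintro ⟨x, hx, rfl⟩
    exact (key x).2 hx
  · intro hy
    rw [← g.apply_symm_apply y, key] at hy
    exact ⟨_, hy, g.apply_symm_apply y⟩

theorem hasClass_boxClass (he : Orthonormal ℝ e) (hspan : ∀ y, y = ∑ j, ⟪e j, y⟫ • e j) (a : V)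
    {C : Set (Set V)} (hC : IsAdmissible C)
    (hmem : (prodSet fun j => segment ℝ 0 ((2 * ⟪a, e j⟫) • e j)) ∈ C) :
    HasClass C (prodSet fun j => halfOpenSegment ((2 * ⟪a, e j⟫) • e j))
      (boxClass C fun j => (2 * ⟪a, e j⟫) • e j) := by
  classical
  have hbox : ∀ y, (y ∈ prodSet fun j => segment ℝ 0 ((2 * ⟪a, e j⟫) • e j)) ↔
      ∀ j, ∃ θ : ℝ, 0 ≤ θ ∧ θ ≤ 1 ∧ ⟪e j, y⟫ = θ * (2 * ⟪a, e j⟫) := fun y => by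
    simpa using mem_boxFace_iff he hspan a ∅ (fun _ => inferInstance) y
  have h := hasClass_diff_hyperplanes hC e Finset.univ _ hmem
    ((hbox 0).2 fun j => ⟨0, le_rfl, zero_le_one, by simp⟩)
  convert h using 1
  · ext y
    rw [mem_prodSet_iff he hspan _ fun j y hy => eq_smul_of_mem_segment hy.1, Set.mem_sdiff, hbox]
    simp only [halfOpenSegment, Set.mem_sdiff, smul_mem_segment_iff (he.ne_zero _),
      Set.mem_singleton_iff, smul_eq_zero, he.ne_zero, or_false, forall_and, Finset.mem_univ,
      true_and, Set.mem_ofPred_eq, not_exists]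
  · rw [Finset.powerset_univ, boxClass]
    refine Finset.sum_congr rfl fun S _ => ?_
    congr 2
    ext y
    rw [mem_boxFace_iff he hspan, Set.mem_inter_iff, hbox, Set.mem_ofPred_eq]
    constructor
    · refine fun h => ⟨fun j => ?_, fun j hj => (h j).1 hj⟩
      by_cases hj : j ∈ S
      · exact ⟨0, le_rfl, zero_le_one, by rw [(h j).1 hj, zero_mul]⟩
      · exact (h j).2 hj
    · exact fun h j => ⟨h.2 j, fun _ => h.1 j⟩

theorem centredFace_polyhedron (a : V) (S : Finset (Fin r)) :
    ∃ P : Finset (V × ℝ), polyhedron P = centredFace e a S := by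
  classical
  refine ⟨Finset.univ.biUnion fun j => {(e j, if j ∈ S then |⟪a, e j⟫| else -|⟪a, e j⟫|),
    (-e j, -|⟪a, e j⟫|)}, ?_⟩
  ext x
  simp only [polyhedron, centredFace, Finset.mem_biUnion, Finset.mem_univ, true_and,
    Finset.mem_insert, Finset.mem_singleton, Set.mem_ofPred_eq, forall_exists_index]
  rw [forall_comm]
  refine forall_congr' fun j => ?_
  simp only [forall_eq_or_imp, forall_eq, inner_neg_left]
  split_ifs
  · rw [neg_le_neg_iff, le_antisymm_iff, and_comm]
  · rw [neg_le_neg_iff, abs_le]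

/-- A product of differences of indicator functions of symmetric segments and their upper
endpoints. -/
theorem polyCls_prod_lines {C : Set (Set V)} (hC : IsAdmissible C) {K : Set V} (hK : K ∈ C)
    (a : V) (f : Fin r → polyFun V)
    (hf : ∀ j x, (f j : V → ℤ) x = (if 0 ≤ ⟪e j, x⟫ + ⟪a, e j⟫ then 1 else 0)
      - if 0 ≤ ⟪e j, x⟫ - ⟪a, e j⟫ then 1 else 0) :
    polyCls hC hK (∏ j, f j) = (∏ j, (SignType.sign ⟪a, e j⟫ : ℤ)) •
      ∑ S : Finset (Fin r), ((-1 : ℤ) ^ S.card) • cls C (K ∩ centredFace e a S) := by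
  classical
  choose P hP using fun S => centredFace_polyhedron (e := e) a S
  have hsum : ∏ j, f j = (∏ j, (SignType.sign ⟪a, e j⟫ : ℤ)) •
      ∑ S : Finset (Fin r), ((-1 : ℤ) ^ S.card) • (⟨polyInd (P S), polyInd_mem _⟩ : polyFun V) := by
    apply Subtype.ext
    ext x
    simp only [SubmonoidClass.coe_finsetProd, Finset.prod_apply, SetLike.val_smul, Pi.smul_apply,
      AddSubmonoidClass.coe_finsetSum, Finset.sum_apply, smul_eq_mul]
    -- The indicator of `[-|b|, |b|)` is that of the closed segment minus that of its upper
    -- endpoint; expanding the product chooses a set `S` of endpoints.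
    have hj : ∀ j, (f j : V → ℤ) x = (SignType.sign ⟪a, e j⟫ : ℤ) *
        (-(if ⟪e j, x⟫ = |⟪a, e j⟫| then 1 else 0)
          + (if |⟪e j, x⟫| ≤ |⟪a, e j⟫| then 1 else 0)) := by
      intro j
      rw [hf]
      generalize ⟪e j, x⟫ = z
      generalize ⟪a, e j⟫ = b
      rcases lt_trichotomy b 0 with hb | rfl | hb
      · rw [sign_neg hb, abs_of_neg hb]
        simp only [abs_le]
        split_ifs <;> first | rfl | grind
      · simp
      · rw [sign_pos hb, abs_of_pos hb]
        simp only [abs_le]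
        split_ifs <;> first | rfl | grind
    simp only [hj]
    rw [Finset.prod_mul_distrib, Finset.prod_add, Finset.powerset_univ]
    congr 1
    refine Finset.sum_congr rfl fun S _ => ?_
    rw [Finset.prod_neg, mul_assoc, Finset.prod_boole, Finset.prod_boole]
    congr 1
    simp only [polyInd, hP, Set.indicator, centredFace, Set.mem_ofPred_eq, Pi.one_apply]
    simp only [mul_ite, mul_one, mul_zero, ← ite_and]
    congr 1
    refine propext ⟨fun h j => ?_, fun h => ⟨fun j hj => ?_, fun j hj => ?_⟩⟩
    · split_ifs with hj
      · exact h.2 j hj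
      · exact h.1 j (by simp [hj])
    · have := h j
      rwa [if_neg (by simpa using hj)] at this
    · simpa [hj] using h j
  rw [hsum, map_smul, map_sum]
  congr 1
  refine Finset.sum_congr rfl fun S _ => ?_
  rw [map_smul, polyCls_polyInd, hP]

end Lines

end Pizza

/-! ### The case of lines only, and the theorem -/

namespace Pizza

variable {V : Type*} [NormedAddCommGroup V] [InnerProductSpace ℝ V]

theorem eq_sum_inner_smul {ι κ : Type*} [Fintype κ] {U : ι → Submodule ℝ V} {e : κ → V}
    (he : Orthonormal ℝ e) (hU_top : ⨆ i, U i = ⊤)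
    (h : ∀ i, ∀ y ∈ U i, ∃ (j : κ) (c : ℝ), y = c • e j) (y : V) : y = ∑ j, ⟪e j, y⟫ • e j := by
  rw [← sub_eq_zero]
  set z := y - ∑ j, ⟪e j, y⟫ • e j with hz
  have hej : ∀ j, ⟪e j, z⟫ = 0 := fun j => by
    rw [hz, inner_sub_right, he.inner_right_fintype (fun j => ⟪e j, y⟫) j, sub_self]
  have hle : ⨆ i, U i ≤ (ℝ ∙ z)ᗮ := iSup_le fun i x hx => by
    obtain ⟨j, c, rfl⟩ := h i x hx
    rw [Submodule.mem_orthogonal_singleton_iff_inner_left, inner_smul_left, hej, mul_zero]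
  rw [hU_top] at hle
  have := hle (Submodule.mem_top : z ∈ ⊤)
  rwa [Submodule.mem_orthogonal_singleton_iff_inner_left, inner_self_eq_zero] at this

theorem polyCls_lines_eq [FiniteDimensional ℝ V] {r : ℕ} {U : Fin r ⊕ Fin 0 → Submodule ℝ V}
    {F : Fin r ⊕ Fin 0 → Finset V} (hU : Pairwise fun i j => U i ⟂ U j) (hU_top : ⨆ i, U i = ⊤)
    (D : ∀ i, ReflectionFactor (U i) (F i)) {e : Fin r → V} (he_mem : ∀ j, e j ∈ U (Sum.inl j))
    (he_norm : ∀ j, ‖e j‖ = 1) (hline : ∀ j, ∀ y ∈ U (Sum.inl j), ∃ c : ℝ, y = c • e j)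
    (hwalls : ∀ j, (D (Sum.inl j)).walls = {e j})
    (hsum : ∀ j (φ : ℝ → ℤ) (a : V), ∑ k, (D (Sum.inl j)).ε k * φ ⟪e j, (D (Sum.inl j)).w k a⟫
      = φ ⟪e j, a⟫ - φ (-⟪e j, a⟫))
    (hone : ∀ j, ∃ k, (D (Sum.inl j)).w k (e j) = e j)
    (hneg : ∀ j, ∃ k, (D (Sum.inl j)).w k (e j) = -e j)
    {E : Set V} (hE : E = ⋃ i, (F i : Set V)) {C : Set (Set V)} (hC : IsAdmissible C) (a : V)
    {K : Set V} (hKC : K ∈ C) (hK : convexHull ℝ {y | ∃ w ∈ coxeterGroup E, y = w a} ⊆ K) :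
    HasClass C (prodSet fun j => halfOpenSegment ((2 * ⟪a, e j⟫) • e j))
        (boxClass C fun j => (2 * ⟪a, e j⟫) • e j) ∧
      polyCls hC hKC (∏ i, (D i).chamberFun a)
        = (∏ j, (SignType.sign ⟪a, e j⟫ : ℤ)) • boxClass C fun j => (2 * ⟪a, e j⟫) • e j := by
  classical
  have he : Orthonormal ℝ e := ⟨he_norm, fun i j hij =>
    Submodule.IsOrtho.inner_eq (hU (Sum.inl_injective.ne hij)) (he_mem i) (he_mem j)⟩
  have hspan : ∀ y, y = ∑ j, ⟪e j, y⟫ • e j := eq_sum_inner_smul he hU_top fun i y hy => by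
    rcases i with j | j
    · exact ⟨j, hline j y hy⟩
    · exact j.elim0
  have hτ : ∀ j, ∃ k, ((D (Sum.inl j)).w k).symm (e j)
      = (if 0 ≤ ⟪a, e j⟫ then (1 : ℝ) else -1) • e j := by
    intro j
    split_ifs
    · obtain ⟨k, hk⟩ := hone j
      exact ⟨k, by rw [LinearIsometryEquiv.symm_apply_eq, one_smul, hk]⟩
    · obtain ⟨k, hk⟩ := hneg j
      exact ⟨k, by rw [LinearIsometryEquiv.symm_apply_eq, neg_one_smul, map_neg, hk, neg_neg]⟩
  choose k hk using hτ
  obtain ⟨w, -, hw⟩ := exists_prod_isometry hU D hE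
    (fun i => match i with
      | Sum.inl j => k j
      | Sum.inr j => j.elim0)
  obtain ⟨g, hg⟩ := exists_boxIsometry he hspan a w fun j =>
    (hw (Sum.inl j) _ (he_mem j)).2.trans (hk j)
  -- The centred box is contained in the hull of the orbit: on each line one of the two group
  -- elements makes `⟪o, w a⟫` equal to `-|⟪o, a⟫|`. Hence intersecting its faces with `K` changes
  -- nothing.
  have hsub : ∀ S, centredFace e a S ⊆ K := by
    intro S x hx
    refine hK (mem_convexHull_orbit hU hU_top D hE a x fun i o ho => ?_)
    rcases i with j | j
    · obtain ⟨c, rfl⟩ := hline j o ho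
      have hx' : |⟪e j, x⟫| ≤ |⟪a, e j⟫| := by
        have := hx j
        split_ifs at this
        · rw [this, abs_abs]
        · exact this
      have h1 : c * ⟪e j, x⟫ ≤ |c * ⟪a, e j⟫| := by
        refine (le_abs_self _).trans ?_
        rw [abs_mul, abs_mul]
        exact mul_le_mul_of_nonneg_left hx' (abs_nonneg c)
      rcases le_total 0 (c * ⟪a, e j⟫) with hb | hb
      · obtain ⟨k, hk⟩ := hneg j
        refine ⟨k, ?_⟩
        have h2 : ((D (Sum.inl j)).w k).symm (e j) = -e j := by
          rw [LinearIsometryEquiv.symm_apply_eq, map_neg, hk, neg_neg]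
        rw [abs_of_nonneg hb] at h1
        rw [inner_smul_left, inner_add_right, inner_map_right, h2, inner_neg_left,
          real_inner_comm a, RCLike.conj_to_real]
        linarith
      · obtain ⟨k, hk⟩ := hone j
        refine ⟨k, ?_⟩
        have h2 : ((D (Sum.inl j)).w k).symm (e j) = e j := by
          rw [LinearIsometryEquiv.symm_apply_eq, hk]
        rw [abs_of_nonpos hb] at h1
        rw [inner_smul_left, inner_add_right, inner_map_right, h2, real_inner_comm a,
          RCLike.conj_to_real]
        linarith
    · exact j.elim0
  have haK : a ∈ K := hK (subset_convexHull ℝ _ ⟨1, Subgroup.one_mem _, rfl⟩)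
  -- The closed box is an isometric image of the centred box, a nonempty polyhedral part of `K`;
  -- this starts the derivation of the class of the half-open box.
  have hbox : (prodSet fun j => segment ℝ 0 ((2 * ⟪a, e j⟫) • e j)) ∈ C := by
    have h1 := hg ∅ fun _ => inferInstance
    simp only [Finset.notMem_empty, if_false] at h1
    rw [← h1]
    refine hC.isometry _ _ ?_
    obtain ⟨P, hP⟩ := centredFace_polyhedron (e := e) a ∅
    have h2 := hC.inter_polyhedron (Or.inr hKC) P
    rw [hP, Set.inter_eq_right.2 (hsub ∅)] at h2
    refine h2.resolve_left (Set.Nonempty.ne_empty ⟨a, fun j => ?_⟩)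
    simp [real_inner_comm a]
  refine ⟨hasClass_boxClass he hspan a hC hbox, ?_⟩
  rw [Fintype.prod_sum_type, Finset.univ_eq_empty (α := Fin 0), Finset.prod_empty, mul_one,
    polyCls_prod_lines (e := e) hC hKC a _ fun j x => ?_]
  · congr 1
    refine Finset.sum_congr rfl fun S _ => ?_
    rw [Set.inter_eq_right.2 (hsub S), ← hg S fun _ => inferInstance, cls_image hC]
  · rw [(D (Sum.inl j)).chamberFun_apply]
    have := hsum j (fun z => if 0 ≤ ⟪e j, x⟫ + z then 1 else 0) a
    simp only [hwalls, Finset.mem_singleton, forall_eq, inner_add_right]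
    rw [this, real_inner_comm a, ← sub_eq_add_neg]

end Pizza

end

theorem lemma3p8 {V : Type*} [NormedAddCommGroup V] [InnerProductSpace ℝ V]
    [FiniteDimensional ℝ V] (r s : ℕ)
    -- `V` is the orthogonal product of `r` lines and `s` planes
    (U : Fin r ⊕ Fin s → Submodule ℝ V)
    (hU_orth : Pairwise fun i j => U i ⟂ U j) (hU_top : ⨆ i, U i = ⊤)
    (hU_one : ∀ j : Fin r, Module.finrank ℝ (U (Sum.inl j)) = 1)
    (hU_two : ∀ j : Fin s, Module.finrank ℝ (U (Sum.inr j)) = 2)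
    -- a rank one arrangement on each line, a dihedral one of type `I₂(2m)` on each plane
    (e : Fin r → V) (he_mem : ∀ j, e j ∈ U (Sum.inl j)) (he_norm : ∀ j, ‖e j‖ = 1)
    (m : Fin s → ℕ) (hm : ∀ j, 2 ≤ m j)
    (D : Fin s → Set V) (hD : ∀ j, Pizza.IsDihedral (U (Sum.inr j)) (2 * m j) (D j))
    -- the product arrangement and its base chamber
    (E : Set V) (hE : E = Set.range e ∪ ⋃ j, D j)
    (T₀ : Set V) (hT₀ : Pizza.IsChamber E T₀)
    -- the family of sets, and the set `K`
    (C : Set (Set V)) (hC : Pizza.IsAdmissible C)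
    (a : V) (K : Set V) (hK : K ∈ C)
    (hK_stable : ∀ w ∈ Pizza.coxeterGroup E, w '' K = K)
    (hK_hull : convexHull ℝ {x | ∃ w ∈ Pizza.coxeterGroup E, x = w a} ⊆ K) :
    (1 ≤ s → Pizza.pizza C E T₀ ((fun x => x + a) '' K) = 0) ∧
    (s = 0 → (∀ j, ∀ x ∈ T₀, 0 < ⟪e j, x⟫) →
      Pizza.HasClass C
        (Pizza.prodSet fun j => Pizza.halfOpenSegment ((2 * ⟪a, e j⟫) • e j))
        (Pizza.boxClass C fun j => (2 * ⟪a, e j⟫) • e j) ∧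
      Pizza.pizza C E T₀ ((fun x => x + a) '' K) =
        (∏ j, (SignType.sign ⟪a, e j⟫ : ℤ)) •
          Pizza.boxClass C fun j => (2 * ⟪a, e j⟫) • e j) := by
  have hline : ∀ j, ∀ y ∈ U (Sum.inl j), ∃ c : ℝ, y = c • e j := by
    intro j y hy
    have hne : (⟨e j, he_mem j⟩ : U (Sum.inl j)) ≠ 0 := fun h => by
      have := congrArg Subtype.val h
      have h1 := he_norm j
      simp only [ZeroMemClass.coe_zero] at this
      simp [this] at h1
    obtain ⟨c, hc⟩ := (finrank_eq_one_iff_of_nonzero' _ hne).1 (hU_one j) ⟨y, hy⟩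
    exact ⟨c, (congrArg Subtype.val hc).symm⟩
  choose L hLbase hLwalls hLsum hLone hLneg using fun j =>
    Pizza.exists_lineFactor (U (Sum.inl j)) (e j) (he_mem j) (he_norm j) (hline j)
  have hang : ∀ j, 2 * (m j : ℝ) * (Real.pi / (2 * m j)) = Real.pi := fun j => by
    have : (m j : ℝ) ≠ 0 := by have := hm j; positivity
    field_simp
  choose u v D' hD' hbasis hroot using fun j =>
    (hD j).exists_isRootSystem (hU_two j) (by have := hm j; omega) (hang j)
  choose P s' hs' t' ht' hst hPwalls hdual hPsum using fun j =>
    Pizza.exists_dihedralFactor (hbasis j) (hm j) (hang j) (hroot j)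
  let F : Fin r ⊕ Fin s → Finset V := Sum.elim (fun j => {e j}) D'
  let R : ∀ i, Pizza.ReflectionFactor (U i) (F i) := fun i => match i with
    | Sum.inl j => L j
    | Sum.inr j => P j
  have hEF : E = ⋃ i, (F i : Set V) := by
    ext x
    simp [hE, F, ← hD', Sum.exists, eq_comm]
  obtain ⟨σ, hσ, hpizza⟩ := Pizza.pizza_eq_polyCls hU_orth R hEF hT₀ hC a hK hK_stable
  refine ⟨fun hs => ?_, fun hs hpos => ?_⟩
  -- A single plane factor already forces the class to vanish, so the first one is used.
  · let j : Fin s := ⟨0, hs⟩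
    obtain ⟨h1, h2, h3⟩ := hPsum j a
    rw [hpizza, Pizza.polyCls_prod_eq_zero hU_orth hU_top R hEF hC a hK hK_hull (Sum.inr j) (hst j)
      (hPwalls j) (hdual j) h1 h2 h3, smul_zero]
  · subst hs
    obtain ⟨h1, h2⟩ := Pizza.polyCls_lines_eq hU_orth hU_top R he_mem he_norm hline hLwalls hLsum
      hLone hLneg hEF hC a hK hK_hull
    refine ⟨h1, ?_⟩
    -- The reference chamber of the line factors contains `∑ e j`; the positivity assumption says
    -- that it is `T₀`, so the global sign is `1`.
    rw [hpizza, h2, hσ, one_smul]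
    rintro y hy (j | j) x hx
    · obtain rfl := Finset.mem_singleton.1 hx
      change 0 < ⟪e j, (L j).base⟫ * _
      rw [hLbase, real_inner_self_eq_norm_sq, he_norm, one_pow, one_mul]
      exact hpos j y hy
    · exact j.elim0
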